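/- An index is a finite tuple $\boldsymbol{k}=(k_1,\dots,k_r)$ of positive integers (possibly empty); it is admissible if it is empty or $k_r\ge 2$. For admissible $\boldsymbol{k}$ put $\zeta(\boldsymbol{k})=\sum_{0<n_1<\cdots<n_r}n_1^{-k_1}\cdots n_r^{-k_r}$, with $\zeta(\varnothing)=1$. Let $\{1\}^a$ denote $1,\dots,1$ ($a$ times). *Finite side.* Let $\mathcal{A}_1=\prod_p\mathbb{Z}/p\mathbb{Z}\,\big/\bigoplus_p\mathbb{Z}/p\mathbb{Z}$, where $p$ runs over all primes, and define in $\mathcal{A}_1$ $$\zeta_{\mathcal{A}_1}(\boldsymbol{k})=\Bigl(\sum_{0<n_1<\cdots<n_r<p}\frac{1}{n_1^{k_1}\cdots n_r^{k_r}}\bmod p\Bigr)_p,\qquad \zeta^{\star}_{\mathcal{A}_1}(\boldsymbol{k})=\Bigl(\sum_{1\le n_1\le\cdots\le n_r\le p-1}\frac{1}{n_1^{k_1}\cdots n_r^{k_r}}\bmod p\Bigr)_p,$$ and, for $k\ge2$, $\mathfrak{Z}_{\mathcal{A}_1}(k)=\bigl(\tfrac{B_{p-k}}{k}\bmod p\bigr)_p$,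 where $B_j$ is the $j$-th Bernoulli number (the finitely many primes for which an expression is undefined are irrelevant). *Symmetric side.* Let $\mathcal{Z}\subset\mathbb{R}$ be the $\mathbb{Q}$-subalgebra generated by all $\zeta(\boldsymbol{k})$ with $\boldsymbol{k}$ admissible, and $\overline{\mathcal{Z}}=\mathcal{Z}/\zeta(2)\mathcal{Z}$. In $\mathbb{Q}\langle e_0,e_1\rangle$ put $e_{\boldsymbol{k}}=e_1e_0^{k_1-1}\cdots e_1e_0^{k_r-1}$, $\mathfrak{H}^1=\mathbb{Q}+e_1\mathbb{Q}\langle e_0,e_1\rangle$ and $\mathfrak{H}^0=\mathbb{Q}+e_1\mathbb{Q}\langle e_0,e_1\rangle e_0$. For the shuffle product $\mathbin{\mathrm{sh}}$, each $w\in\mathfrak{H}^1$ is uniquely of the form $\sum_i w_i\mathbin{\mathrm{sh}}e_1^{\mathbin{\mathrm{sh}} i}$ with $w_i\in\mathfrak{H}^0$; the shuffle regularized value $\zeta^{\mathrm{sh}}(\boldsymbol{k})\in\mathcal{Z}$ is the image of the term $w_0$ of $w=e_{\boldsymbol{k}}$ under the $\mathbb{Q}$-linear map $\mathfrak{H}^0\to\mathcal{Z}$,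 $e_{\boldsymbol{l}}\mapsto\zeta(\boldsymbol{l})$. Define $$\zeta^{\mathrm{sh}}_{\widehat{\mathcal{S}}}(\boldsymbol{k})=\sum_{i=0}^r(-1)^{k_{i+1}+\cdots+k_r}\zeta^{\mathrm{sh}}(k_1,\dots,k_i)\sum_{l_{i+1},\dots,l_r\ge0}\Bigl[\prod_{j=i+1}^r\binom{k_j+l_j-1}{l_j}\Bigr]\zeta^{\mathrm{sh}}(k_r+l_r,\dots,k_{i+1}+l_{i+1})\,t^{l_{i+1}+\cdots+l_r}\in\mathcal{Z}[[t]],$$ let $\zeta_{\widehat{\mathcal{S}}}(\boldsymbol{k})\in\overline{\mathcal{Z}}[[t]]$ be its reduction modulo $\zeta(2)$, and let $\zeta^{\star}_{\widehat{\mathcal{S}}}(\boldsymbol{k})=\sum\zeta_{\widehat{\mathcal{S}}}(k_1\square\cdots\square k_r)$, where each $\square$ runs over a comma `,' and a plus `$+$'. Let $\zeta_{\mathcal{S}_1}(\boldsymbol{k})$, $\zeta^{\star}_{\mathcal{S}_1}(\boldsymbol{k})$ be their images in $\overline{\mathcal{Z}}[[t]]/(t)$, and let $\mathfrak{Z}_{\mathcal{S}_1}(k)=\zeta(k)\bmod\zeta(2)\in\overline{\mathcal{Z}}[[t]]/(t)$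 for $k\ge2$. **Theorem.** For all integers $a,b\ge0$ and for each of $\mathcal{F}=\mathcal{A}$ and $\mathcal{F}=\mathcal{S}$, $$\zeta_{\mathcal{F}_1}(\{1\}^a,2,\{1\}^b)=(-1)^b\binom{a+b+2}{a+1}\mathfrak{Z}_{\mathcal{F}_1}(a+b+2),\qquad \zeta^{\star}_{\mathcal{F}_1}(\{1\}^a,2,\{1\}^b)=(-1)^b\binom{a+b+2}{a+1}\mathfrak{Z}_{\mathcal{F}_1}(a+b+2).$$ -/

import Mathlib

namespace FMZV

noncomputable section

/-- An index: a finite tuple of positive integers, possibly empty. -/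
abbrev Index : Type := List ℕ+

/-- The weight `k₁ + ⋯ + k_r`. -/
def Index.wt (k : Index) : ℕ := (k.map (fun x : ℕ+ => (x : ℕ))).sum

/-- An index is admissible if it is empty or its last entry is at least `2`. -/
def Index.Admissible (k : Index) : Prop := ∀ h : k ≠ [], 2 ≤ k.getLast h

/-- The index `({1}^a, 2, {1}^b)`. -/
def index121 (a b : ℕ) : Index := List.replicate a 1 ++ 2 :: List.replicate b 1

/-- All indices `k₁ □ k₂ □ ⋯ □ k_r`, where each `□` is a comma or a plus; the first entry of the
tuple is given separately. -/
def Index.mergesAux : ℕ+ → Index → List Index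
  | k, [] => [[k]]
  | k, l :: ks => (Index.mergesAux l ks).map (fun m => k :: m) ++ Index.mergesAux (k + l) ks

/-- The list (with multiplicity) of all indices `k₁ □ k₂ □ ⋯ □ k_r`, where each `□` is a comma or a
plus. -/
def Index.merges : Index → List Index
  | [] => [[]]
  | k :: ks => Index.mergesAux k ks

/-! ### The rings `𝒜_n` and the values in them -/

/-- The ideal `⨁_p ℤ/p^n` of families with only finitely many non-zero components. -/
def finSuppIdeal (n : ℕ) : Ideal (∀ p : Nat.Primes, ZMod ((p : ℕ) ^ n)) where
  carrier := {f | {p | f p ≠ 0}.Finite}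
  zero_mem' := by simp
  add_mem' := by
    intro f g hf hg
    refine (Set.Finite.union hf hg).subset ?_
    intro p hp
    by_contra h
    simp only [Set.mem_union, Set.mem_ofPred_eq, not_or, not_not] at h
    exact hp (by simp [h.1, h.2])
  smul_mem' := by
    intro c f hf
    refine Set.Finite.subset hf ?_
    intro p hp h
    exact hp (by simp [h])

/-- `𝒜_n = ∏_p ℤ/p^n / ⨁_p ℤ/p^n`. -/
abbrev ARing (n : ℕ) : Type := (∀ p : Nat.Primes, ZMod ((p : ℕ) ^ n)) ⧸ finSuppIdeal n

/-- The class `(x_p)_p` in `𝒜_n` of a family. -/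
def ARing.mk (n : ℕ) (x : ∀ p : Nat.Primes, ZMod ((p : ℕ) ^ n)) : ARing n :=
  Ideal.Quotient.mk (finSuppIdeal n) x

open Classical in
/-- `ζ_{𝒜_n}(k)`: the sums run over `0 < n₁ < ⋯ < n_r < p`. -/
def zetaA (n : ℕ) (k : Index) : ARing n :=
  ARing.mk n fun p =>
    ∑ m ∈ (Fintype.piFinset fun _ : Fin k.length => Finset.Ioo 0 (p : ℕ)).filter
        (fun m => StrictMono m),
      ∏ i : Fin k.length, ((m i : ZMod ((p : ℕ) ^ n)) ^ (k.get i : ℕ))⁻¹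

open Classical in
/-- `ζ^⋆_{𝒜_n}(k)`: the sums run over `1 ≤ n₁ ≤ ⋯ ≤ n_r ≤ p - 1`. -/
def zetaStarA (n : ℕ) (k : Index) : ARing n :=
  ARing.mk n fun p =>
    ∑ m ∈ (Fintype.piFinset fun _ : Fin k.length => Finset.Icc 1 ((p : ℕ) - 1)).filter
        (fun m => Monotone m),
      ∏ i : Fin k.length, ((m i : ZMod ((p : ℕ) ^ n)) ^ (k.get i : ℕ))⁻¹

/-- Reduction of a rational number modulo `N` (meaningful if its denominator is prime to `N`). -/
def ratMod (N : ℕ) (q : ℚ) : ZMod N := (q.num : ZMod N) * (q.den : ZMod N)⁻¹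

/-- `𝔷_{𝒜_n}(k) = (B_{p^{n-1}(p-1)-k+1} / (k-1+p^{n-1}) mod p^n)_p`. The truncated subtraction
affects only the finitely many primes for which the Bernoulli index would be negative. -/
def frakZA (n : ℕ) (k : ℕ+) : ARing n :=
  ARing.mk n fun p =>
    ratMod ((p : ℕ) ^ n)
      (bernoulli ((p : ℕ) ^ (n - 1) * ((p : ℕ) - 1) + 1 - (k : ℕ)) /
        ((k : ℚ) - 1 + (p : ℚ) ^ (n - 1)))

/-! ### Multiple zeta values and their shuffle regularization -/

/-- The multiple zeta value `∑_{0 < n₁ < ⋯ < n_r} ∏ 1 / n_i ^ k_i` (meaningful if `k` is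
admissible). -/
def mzv (k : Index) : ℝ :=
  ∑' m : {m : Fin k.length → ℕ+ // StrictMono m},
    ∏ i : Fin k.length, 1 / (((m.1 i : ℕ) : ℝ) ^ (k.get i : ℕ))

/-- `𝒵`, the `ℚ`-subalgebra of `ℝ` generated by all multiple zeta values. -/
def MZVAlg : Subalgebra ℚ ℝ := Algebra.adjoin ℚ {x | ∃ k : Index, k.Admissible ∧ x = mzv k}

open Classical in
/-- `ζ(k)` as an element of `𝒵`, for admissible `k` (and `0` for other indices). -/
def mzvZ (k : Index) : MZVAlg :=
  if h : k.Admissible then ⟨mzv k, Algebra.subset_adjoin ⟨k, h, rfl⟩⟩ else 0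

/-- `ℚ⟨e₀, e₁⟩`. -/
abbrev NCPoly : Type := FreeAlgebra ℚ (Fin 2)

/-- The letters `e₀` and `e₁`. -/
def letter (u : Fin 2) : NCPoly := FreeAlgebra.ι ℚ u

/-- The words, as a basis of `ℚ⟨e₀, e₁⟩`. -/
def wordBasis : Module.Basis (FreeMonoid (Fin 2)) ℚ NCPoly := FreeAlgebra.basisFreeMonoid ℚ (Fin 2)

/-- The shuffle product of two words. -/
def shuffleWord : List (Fin 2) → List (Fin 2) → NCPoly
  | [], w => wordBasis (FreeMonoid.ofList w)
  | w, [] => wordBasis (FreeMonoid.ofList w)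
  | u₁ :: w₁, u₂ :: w₂ =>
      letter u₁ * shuffleWord w₁ (u₂ :: w₂) + letter u₂ * shuffleWord (u₁ :: w₁) w₂
termination_by w₁ w₂ => w₁.length + w₂.length

/-- The `ℚ`-bilinear shuffle product on `ℚ⟨e₀, e₁⟩`. -/
def shuffle : NCPoly →ₗ[ℚ] NCPoly →ₗ[ℚ] NCPoly :=
  wordBasis.constr ℚ fun w₁ => wordBasis.constr ℚ fun w₂ =>
    shuffleWord (FreeMonoid.toList w₁) (FreeMonoid.toList w₂)

/-- The shuffle power `e₁ ш ⋯ ш e₁` with `i` factors. -/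
def shufflePowE1 : ℕ → NCPoly
  | 0 => 1
  | i + 1 => shuffle (letter 1) (shufflePowE1 i)

/-- `ℌ⁰ = ℚ + e₁ ℚ⟨e₀, e₁⟩ e₀`. -/
def H0 : Submodule ℚ NCPoly :=
  1 ⊔ LinearMap.range (LinearMap.mulLeft ℚ (letter 1) ∘ₗ LinearMap.mulRight ℚ (letter 0))

/-- `a = ∑ᵢ aᵢ ш e₁^{ш i}` with all `aᵢ` in `ℌ⁰`. -/
def IsShuffleExpansion (a : NCPoly) (c : ℕ →₀ NCPoly) : Prop :=
  (∀ i, c i ∈ H0) ∧ a = c.sum fun i x => shuffle x (shufflePowE1 i)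

open Classical in
/-- The shuffle regularization `reg_ш`: every `a` in `ℌ¹ = ℚ + e₁ ℚ⟨e₀, e₁⟩` has exactly one
expansion `a = ∑ᵢ aᵢ ш e₁^{ш i}` with `aᵢ` in `ℌ⁰`, and `reg_ш a = a₀`. -/
def regShuffle (a : NCPoly) : NCPoly :=
  if h : ∃ c, IsShuffleExpansion a c then h.choose 0 else 0

/-- `e_k = e_{k₁} ⋯ e_{k_r}` with `e_j = e₁ e₀^{j-1}`. -/
def eIndex (k : Index) : NCPoly :=
  (k.map fun j : ℕ+ => letter 1 * letter 0 ^ ((j : ℕ) - 1)).prod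

/-- Reading a word `e₀^z e_{k₁} ⋯ e_{k_r}` as the pair `(z, (k₁, …, k_r))`. -/
def readWord : List (Fin 2) → ℕ × Index
  | [] => (0, [])
  | u :: w =>
      if u = 0 then ((readWord w).1 + 1, (readWord w).2)
      else (0, Nat.succPNat (readWord w).1 :: (readWord w).2)

/-- A linear extension to `ℚ⟨e₀, e₁⟩` of the `ℚ`-linear map `Z : ℌ⁰ → 𝒵`, `e_k ↦ ζ(k)` for
admissible `k`; only its values on `ℌ⁰` matter. -/
def ZMap : NCPoly →ₗ[ℚ] MZVAlg :=
  wordBasis.constr ℚ fun w => mzvZ (readWord (FreeMonoid.toList w)).2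

/-- The shuffle regularized multiple zeta value. -/
def mzvSh (k : Index) : MZVAlg := ZMap (regShuffle (eIndex k))

/-! ### Symmetric multiple zeta values -/

/-- For `k = (k₁, …, k_s)`, the power series
`∑_{l₁, …, l_s ≥ 0} [∏_j binom(k_j + l_j - 1, l_j)] ζ^ш(k_s + l_s, …, k₁ + l₁) t^{l₁ + ⋯ + l_s}`. -/
def reversedSeries (k : Index) : PowerSeries MZVAlg :=
  PowerSeries.mk fun d =>
    ∑ l ∈ Finset.Nat.antidiagonalTuple k.length d,
      (∏ j : Fin k.length, (Nat.choose ((k.get j : ℕ) + l j - 1) (l j) : MZVAlg)) *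
        mzvSh (List.ofFn fun j : Fin k.length =>
          (⟨(k.get j : ℕ) + l j, Nat.add_pos_left (k.get j).pos _⟩ : ℕ+)).reverse

/-- `ζ^ш_Ŝ(k)` in `𝒵⟦t⟧`. -/
def zetaHatSh (k : Index) : PowerSeries MZVAlg :=
  ∑ i ∈ Finset.range (k.length + 1),
    (-1) ^ (Index.wt (k.drop i)) * PowerSeries.C (mzvSh (k.take i)) * reversedSeries (k.drop i)

/-- `𝒵 / ζ(2)𝒵`. -/
abbrev MZVBar : Type := MZVAlg ⧸ Ideal.span {mzvZ [2]}

/-- The `t`-adic symmetric multiple zeta value `ζ_Ŝ(k)` in `(𝒵 / ζ(2)𝒵)⟦t⟧`. -/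
def zetaHatS (k : Index) : PowerSeries MZVBar :=
  PowerSeries.map (Ideal.Quotient.mk (Ideal.span {mzvZ [2]})) (zetaHatSh k)

/-- The `t`-adic symmetric multiple zeta-star value `ζ^⋆_Ŝ(k)`. -/
def zetaStarHatS (k : Index) : PowerSeries MZVBar := (k.merges.map zetaHatS).sum

/-- `(𝒵 / ζ(2)𝒵)⟦t⟧ / (t^n)`. -/
abbrev SRing (n : ℕ) : Type :=
  PowerSeries MZVBar ⧸ Ideal.span {(PowerSeries.X : PowerSeries MZVBar) ^ n}

/-- The projection `π_n`. -/
def SRing.proj (n : ℕ) : PowerSeries MZVBar →+* SRing n := Ideal.Quotient.mk _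

/-- `ζ_{𝒮_n}(k)`. -/
def zetaS (n : ℕ) (k : Index) : SRing n := SRing.proj n (zetaHatS k)

/-- `ζ^⋆_{𝒮_n}(k)`. -/
def zetaStarS (n : ℕ) (k : Index) : SRing n := SRing.proj n (zetaStarHatS k)

/-- `𝔷_{𝒮_n}(k) = ζ(k) mod ζ(2)` (for `k ≥ 2`). -/
def frakZS (n : ℕ) (k : ℕ+) : SRing n :=
  SRing.proj n (PowerSeries.C (Ideal.Quotient.mk (Ideal.span {mzvZ [2]}) (mzvZ [k])))

end

end FMZV

/-! Finite side. Let S_a(n) be the sum of 1/(n_1⋯n_a) over 1 ≤ n_1 ≤ ⋯ ≤ n_a ≤ n modulo p. The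
substitution n_i ↦ p - n_i and the vanishing of S_b(p-1) for 0 < b < p-1 rewrite both the strict and
the weak sum as (-1)^b ∑ S_a(n) S_b(p-n) / n², so the star and non-star values agree. The identity
S_a(n) = ∑ (-1)^(m+1) C(n,m) / m^a (`starHarmonic_eq_sum_choose`) and a Vandermonde convolution
collapse this to minus the double sum of 1/(m^(a+1) l^(b+1)) over m ≤ l
(`nestLe_index121_prime_eq_double_sum`). There Faulhaber's formula and Fermat's little theorem
select a single Bernoulli number.

Symmetric side. Shuffling with e₁ is multiplication by Li_1(t) = -log(1-t), so ζ^sh(k) is the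
constant term of the expansion of Li_k(t), as t → 1, in powers of -log(1-t)
(`exists_hasLogExpansion_eIndex`). Such an expansion is unique, so any way of finding the
asymptotics computes ζ^sh. Modulo t only the terms with all l_j = 0 remain, and ζ^sh({1}^n) = 0 for
n > 0 leaves only the two extreme cuts of ({1}^a,2,{1}^b) (`symSum_index121`).

Non-star values. The shuffle of e₁ with e₁^(a+1) e₀ e₁^b combines the words of ({1}^a,2,{1}^(b+1))
and ({1}^(a+1),2,{1}^b), and its regularization is 0. Iterating gives ζ^sh({1}^a,2,{1}^b) = (-1)^b
C(a+b+1,b) ζ({1}^(a+b),2); duality, proved by a connected sum, turns the last factor into ζ(a+b+2).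
Pascal's rule adds the two cuts.

Star values. Merging commutes with cutting (`starSum_symSum`), so sums of ζ^sh over merges are
needed. The words add up to e₁(e₀+e₁)^a e₀(e₀+e₁)^b. In the coordinate y = t/(1-t) the letter e₀+e₁
is the form dy/y; hence e₁(e₀+e₁)^j gives L_(j+1)(y) = -Li_(j+1)(-y), and the mixed word gives ∫₀¹
log(1/u)^a/a! · (L_(b+1)(y) - L_(b+1)(uy))/(1-u) du (`integral_negPolylog_slope`). The inversion y ↔
1/y (`negPolylog_inversion`) yields the expansion at infinity. Its constant term combines zeta
values with the constants L_i(1)(1+(-1)^i), which for i > 0 are 0 or rational multiples of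
ζ(2)^(i/2). Modulo ζ(2) one term survives, the merge sum of {1}^n with n > 0 vanishes, and the two
cuts are added as before. -/

namespace FMZV

/-! ### Nested sums by recursion on the index -/

section NestedSums

variable {R : Type*} [CommSemiring R]

/-- The nested sum of `∏ g k_i n_i` over `M < n_1 < ⋯ < n_r < N`. -/
def nestLt (g : ℕ+ → ℕ → R) : Index → ℕ → ℕ → R
  | [], _, _ => 1
  | k :: ks, M, N => ∑ n ∈ Finset.Ioo M N, g k n * nestLt g ks n N

/-- The nested sum of `∏ g k_i n_i` over `M ≤ n_1 ≤ ⋯ ≤ n_r < N`. -/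
def nestLe (g : ℕ+ → ℕ → R) : Index → ℕ → ℕ → R
  | [], _, _ => 1
  | k :: ks, M, N => ∑ n ∈ Finset.Ico M N, g k n * nestLe g ks n N

/-- The recursion peels entries off the left; splitting at an arbitrary entry is what isolates the 2
in ({1}^a,2,{1}^b), and also gives a recursion at the right end. -/
theorem nestLt_append_cons (g : ℕ+ → ℕ → R) (ks : Index) (k : ℕ+) (ls : Index) (M N : ℕ) :
    nestLt g (ks ++ k :: ls) M N =
      ∑ n ∈ Finset.Ioo M N, nestLt g ks M n * g k n * nestLt g ls n N := by
  induction ks generalizing M with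
  | nil => simp [nestLt]
  | cons k' ks ih =>
    simp only [List.cons_append, nestLt, ih, Finset.mul_sum, Finset.sum_mul]
    rw [Finset.sum_comm' (t' := Finset.Ioo M N) (s' := fun n => Finset.Ioo M n)]
    · exact Finset.sum_congr rfl fun n _ => Finset.sum_congr rfl fun m _ => by ring
    · intro x y
      simp only [Finset.mem_Ioo]
      omega

/-- The left factor runs up to `n + 1` because the ranges are half open and n_i = n is allowed. -/
theorem nestLe_append_cons (g : ℕ+ → ℕ → R) (ks : Index) (k : ℕ+) (ls : Index) (M N : ℕ) :
    nestLe g (ks ++ k :: ls) M N =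
      ∑ n ∈ Finset.Ico M N, nestLe g ks M (n + 1) * g k n * nestLe g ls n N := by
  induction ks generalizing M with
  | nil => simp [nestLe]
  | cons k' ks ih =>
    simp only [List.cons_append, nestLe, ih, Finset.mul_sum, Finset.sum_mul]
    rw [Finset.sum_comm' (t' := Finset.Ico M N) (s' := fun n => Finset.Ico M (n + 1))]
    · exact Finset.sum_congr rfl fun n _ => Finset.sum_congr rfl fun m _ => by ring
    · intro x y
      simp only [Finset.mem_Ico]
      omega

theorem strictMono_fin_succ_iff {n : ℕ} {α : Type*} [Preorder α] (m : Fin (n + 1) → α) :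
    StrictMono m ↔ (∀ i, m 0 < Fin.tail m i) ∧ StrictMono (Fin.tail m) := by
  constructor
  · intro h
    exact ⟨fun i => h (Fin.succ_pos i), fun i j hij => h (Fin.succ_lt_succ_iff.2 hij)⟩
  · rintro ⟨h0, h⟩ i j hij
    induction j using Fin.cases with
    | zero => exact absurd hij (Fin.not_lt_zero i)
    | succ j =>
      induction i using Fin.cases with
      | zero => exact h0 j
      | succ i => exact h (Fin.succ_lt_succ_iff.1 hij)

theorem monotone_fin_succ_iff {n : ℕ} {α : Type*} [Preorder α] (m : Fin (n + 1) → α) :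
    Monotone m ↔ (∀ i, m 0 ≤ Fin.tail m i) ∧ Monotone (Fin.tail m) := by
  constructor
  · intro h
    exact ⟨fun i => h (Fin.zero_le _), fun i j hij => h (Fin.succ_le_succ_iff.2 hij)⟩
  · rintro ⟨h0, h⟩ i j hij
    induction j using Fin.cases with
    | zero => rw [Fin.le_zero_iff.1 hij]
    | succ j =>
      induction i using Fin.cases with
      | zero => exact h0 j
      | succ i => exact h (Fin.succ_le_succ_iff.1 hij)

open Classical in
theorem sum_filter_strictMono_eq_nestLt (g : ℕ+ → ℕ → R) (k : Index) (M N : ℕ) :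
    ∑ m ∈ (Fintype.piFinset fun _ : Fin k.length => Finset.Ioo M N).filter
        (fun m => StrictMono m), ∏ i, g (k.get i) (m i) = nestLt g k M N := by
  induction k generalizing M with
  | nil =>
    have h : ∀ m : Fin ([] : Index).length → ℕ, StrictMono m := fun m i => Fin.elim0 i
    rw [Finset.filter_true_of_mem fun m _ => h m]
    simp [nestLt]
  | cons k ks ih =>
    simp only [nestLt, ← ih, Finset.mul_sum]
    rw [Finset.sum_sigma']
    refine Finset.sum_bij' (fun m _ => ⟨m 0, Fin.tail m⟩) (fun s _ => Fin.cons s.1 s.2)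
      ?_ ?_ ?_ ?_ ?_
    · intro m hm
      simp only [Finset.mem_filter, Fintype.mem_piFinset, Finset.mem_sigma] at hm ⊢
      have h2 := (strictMono_fin_succ_iff m).1 hm.2
      refine ⟨hm.1 0, fun i => ?_, h2.2⟩
      have := hm.1 i.succ
      have h3 := h2.1 i
      simp only [Finset.mem_Ioo, Fin.tail] at this h3 ⊢
      omega
    · intro s hs
      simp only [Finset.mem_filter, Fintype.mem_piFinset, Finset.mem_sigma, Finset.mem_Ioo] at hs ⊢
      refine ⟨fun i => ?_, (strictMono_fin_succ_iff _).2 ⟨fun i => ?_, ?_⟩⟩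
      · induction i using Fin.cases with
        | zero => simpa using hs.1
        | succ i =>
          have := hs.2.1 i
          simp only [Fin.cons_succ]
          omega
      · simpa using (hs.2.1 i).1
      · simpa using hs.2.2
    · intro m _
      exact Fin.cons_self_tail m
    · intro s _
      simp
    · intro m _
      exact Fin.prod_univ_succ _

open Classical in
theorem sum_filter_monotone_eq_nestLe (g : ℕ+ → ℕ → R) (k : Index) (M N : ℕ) :
    ∑ m ∈ (Fintype.piFinset fun _ : Fin k.length => Finset.Ico M N).filter
        (fun m => Monotone m), ∏ i, g (k.get i) (m i) = nestLe g k M N := by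
  induction k generalizing M with
  | nil =>
    have h : ∀ m : Fin ([] : Index).length → ℕ, Monotone m := fun m i => Fin.elim0 i
    rw [Finset.filter_true_of_mem fun m _ => h m]
    simp [nestLe]
  | cons k ks ih =>
    simp only [nestLe, ← ih, Finset.mul_sum]
    rw [Finset.sum_sigma']
    refine Finset.sum_bij' (fun m _ => ⟨m 0, Fin.tail m⟩) (fun s _ => Fin.cons s.1 s.2)
      ?_ ?_ ?_ ?_ ?_
    · intro m hm
      simp only [Finset.mem_filter, Fintype.mem_piFinset, Finset.mem_sigma] at hm ⊢
      have h2 := (monotone_fin_succ_iff m).1 hm.2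
      refine ⟨hm.1 0, fun i => ?_, h2.2⟩
      have := hm.1 i.succ
      have h3 := h2.1 i
      simp only [Finset.mem_Ico, Fin.tail] at this h3 ⊢
      omega
    · intro s hs
      simp only [Finset.mem_filter, Fintype.mem_piFinset, Finset.mem_sigma, Finset.mem_Ico] at hs ⊢
      refine ⟨fun i => ?_, (monotone_fin_succ_iff _).2 ⟨fun i => ?_, ?_⟩⟩
      · induction i using Fin.cases with
        | zero => simpa using hs.1
        | succ i =>
          have := hs.2.1 i
          simp only [Fin.cons_succ]
          omega
      · simpa using (hs.2.1 i).1
      · simpa using hs.2.2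
    · intro m _
      exact Fin.cons_self_tail m
    · intro s _
      simp
    · intro m _
      exact Fin.prod_univ_succ _

end NestedSums

end FMZV

namespace FMZV

/-! ### Harmonic sums modulo p and the reflection n ↦ p - n -/

section FiniteSide

/-- Classify the subsets of size r + s + 1 of an (N+1)-element chain by their (r+1)-st element i. -/
theorem Nat.sum_range_choose_mul_choose_sub (N r s : ℕ) :
    ∑ i ∈ Finset.range (N + 1), Nat.choose i r * Nat.choose (N - i) s =
      Nat.choose (N + 1) (r + s + 1) := by
  induction N generalizing s with
  | zero =>
    rcases r with _ | r <;> rcases s with _ | s <;> simp [Nat.choose_eq_zero_of_lt]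
  | succ N ih =>
    rw [Finset.sum_range_succ]
    rcases s with _ | s
    · have := ih 0
      simp only [Nat.choose_zero_right, mul_one, add_zero] at this ⊢
      rw [this, Nat.choose_succ_succ' (N + 1) r, add_comm]
    · have h : ∀ i ∈ Finset.range (N + 1), Nat.choose i r * Nat.choose (N + 1 - i) (s + 1) =
          Nat.choose i r * Nat.choose (N - i) s + Nat.choose i r * Nat.choose (N - i) (s + 1) := by
        intro i hi
        rw [Nat.succ_sub (Nat.lt_succ_iff.1 (Finset.mem_range.1 hi)), Nat.choose_succ_succ', mul_add]
      rw [Finset.sum_congr rfl h, Finset.sum_add_distrib, ih, ih]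
      simp only [Nat.sub_self, Nat.choose_zero_succ, mul_zero, add_zero]
      rw [show r + (s + 1) + 1 = (r + s + 1) + 1 by ring, Nat.choose_succ_succ' (N + 1)]

variable {p : ℕ} [hp : Fact p.Prime]

/-- The summand `1 / n ^ k` modulo `p`. -/
noncomputable def invPow (p : ℕ) (k : ℕ+) (n : ℕ) : ZMod p := ((n : ZMod p) ^ (k : ℕ))⁻¹

theorem ZMod.natCast_ne_zero_of_lt {m : ℕ} (h0 : 0 < m) (h : m < p) : (m : ZMod p) ≠ 0 := by
  rw [Ne, ZMod.natCast_eq_zero_iff]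
  exact Nat.not_dvd_of_pos_of_lt h0 h

theorem ZMod.natCast_self_sub {m : ℕ} (h : m ≤ p) : ((p - m : ℕ) : ZMod p) = -(m : ZMod p) := by
  rw [Nat.cast_sub h, ZMod.natCast_self, zero_sub]

/-- By Pascal's rule, consecutive binomials of p - 1 add up to a binomial of p, which is 0 modulo p.
-/
theorem ZMod.choose_prime_sub_one {m : ℕ} (h : m < p) :
    ((p - 1).choose m : ZMod p) = (-1) ^ m := by
  induction m with
  | zero => simp
  | succ m ih =>
    have h1 : (p.choose (m + 1) : ZMod p) = 0 := by
      rw [ZMod.natCast_eq_zero_iff]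
      exact hp.out.dvd_choose_self (Nat.succ_ne_zero m) h
    obtain ⟨q, rfl⟩ : ∃ q, p = q + 1 := ⟨p - 1, by omega⟩
    rw [Nat.choose_succ_succ', Nat.cast_add] at h1
    simp only [Nat.add_sub_cancel] at ih ⊢
    rw [ih (by omega)] at h1
    rw [pow_succ]
    linear_combination h1

theorem ZMod.sum_Ico_pow (i : ℕ) :
    ∑ m ∈ Finset.Ico 1 p, (m : ZMod p) ^ i = if p - 1 ∣ i then -1 else 0 := by
  have h := FiniteField.sum_pow_units (ZMod p) i
  rw [ZMod.card p] at h
  rw [← h]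
  refine Finset.sum_bij' (fun m _ => if hm : (m : ZMod p) ≠ 0 then Units.mk0 _ hm else 1)
    (fun u _ => (u : ZMod p).val) ?_ ?_ ?_ ?_ ?_
  · simp
  · intro u _
    rw [Finset.mem_Ico]
    refine ⟨Nat.one_le_iff_ne_zero.2 ?_, ZMod.val_lt _⟩
    simp [ZMod.val_eq_zero]
  · intro m hm
    rw [Finset.mem_Ico] at hm
    rw [dif_pos (ZMod.natCast_ne_zero_of_lt hm.1 hm.2)]
    simp [ZMod.val_natCast_of_lt hm.2]
  · intro u _
    ext
    simp
  · intro m hm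
    rw [Finset.mem_Ico] at hm
    rw [dif_pos (ZMod.natCast_ne_zero_of_lt hm.1 hm.2)]
    simp

theorem ZMod.inv_pow_eq_pow {m b : ℕ} (h0 : 0 < m) (h : m < p) (hb : b ≤ p - 1) :
    ((m : ZMod p) ^ b)⁻¹ = (m : ZMod p) ^ (p - 1 - b) := by
  have hm := ZMod.natCast_ne_zero_of_lt h0 h
  rw [inv_eq_iff_eq_inv, eq_comm, inv_eq_of_mul_eq_one_left]
  rw [← pow_add, Nat.add_sub_cancel' hb, ZMod.pow_card_sub_one_eq_one hm]

/-- The sum of `∏ 1 / n_i` modulo `p` over `1 ≤ n_1 ≤ ⋯ ≤ n_a ≤ n`. -/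
noncomputable def starHarmonic (p a n : ℕ) : ZMod p :=
  nestLe (invPow p) (List.replicate a 1) 1 (n + 1)

theorem starHarmonic_succ_left (a n : ℕ) :
    starHarmonic p (a + 1) n = ∑ m ∈ Finset.Ico 1 (n + 1), starHarmonic p a m * (m : ZMod p)⁻¹ := by
  rw [starHarmonic, List.replicate_succ', nestLe_append_cons]
  simp [starHarmonic, nestLe, invPow]

theorem starHarmonic_succ_succ (a n : ℕ) :
    starHarmonic p (a + 1) (n + 1) =
      starHarmonic p (a + 1) n + starHarmonic p a (n + 1) * ((n + 1 : ℕ) : ZMod p)⁻¹ := by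
  rw [starHarmonic_succ_left, starHarmonic_succ_left, Finset.sum_Ico_succ_top (by omega)]

/-- Induction on a, then on n: (n+1) C(n,m-1) = m C(n+1,m) turns the new factor 1/(n+1) into 1/m,
and Pascal's rule merges the two terms. For a = 0 this is the vanishing of the alternating binomial
sum, which fails for n = 0; hence 0 < a + n. The range of m does not depend on n, so that sums over
n can later be exchanged with it. -/
theorem starHarmonic_eq_sum_choose (a n : ℕ) (hn : n < p) (h : 0 < a + n) :
    starHarmonic p a n =
      ∑ m ∈ Finset.Ico 1 p, (-1) ^ (m + 1) * (n.choose m : ZMod p) * ((m : ZMod p) ^ a)⁻¹ := by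
  induction a generalizing n with
  | zero =>
    have h1 : ∑ m ∈ Finset.range p, (-1 : ℤ) ^ m * (n.choose m : ℤ) = 0 := by
      rw [← Finset.sum_subset (Finset.range_subset_range.2 hn),
        Int.alternating_sum_range_choose_of_ne (by omega)]
      intro m _ hm
      rw [Nat.choose_eq_zero_of_lt (by simpa using hm)]
      simp
    have h2 := congrArg (Int.cast : ℤ → ZMod p) h1
    push_cast at h2
    rw [Finset.range_eq_Ico, Finset.sum_eq_sum_Ico_succ_bot hp.out.pos] at h2
    simp only [starHarmonic, List.replicate_zero, nestLe, pow_zero, inv_one, mul_one, pow_succ,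
      mul_neg, neg_mul, Finset.sum_neg_distrib]
    simp only [pow_zero, Nat.choose_zero_right, Nat.cast_one, mul_one, zero_add] at h2
    linear_combination h2
  | succ a iha =>
    induction n with
    | zero =>
      rw [starHarmonic_succ_left, Finset.sum_eq_zero, Finset.sum_eq_zero]
      · intro m hm
        rw [Nat.choose_eq_zero_of_lt (Finset.mem_Ico.1 hm).1]
        simp
      · simp
    | succ n ihn =>
      rw [starHarmonic_succ_succ, ihn (by omega) (by omega), iha (n + 1) hn (by omega),
        Finset.sum_mul, ← Finset.sum_add_distrib]
      refine Finset.sum_congr rfl fun m hm => ?_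
      rw [Finset.mem_Ico] at hm
      have hm0 := ZMod.natCast_ne_zero_of_lt hm.1 hm.2
      have hn0 := ZMod.natCast_ne_zero_of_lt (Nat.succ_pos n) hn
      obtain ⟨m, rfl⟩ : ∃ q, m = q + 1 := ⟨m - 1, by omega⟩
      have hc := congrArg (Nat.cast : ℕ → ZMod p) (Nat.add_one_mul_choose_eq n m)
      rw [Nat.choose_succ_succ'] at hc ⊢
      push_cast at hc hm0 hn0 ⊢
      field_simp
      linear_combination (-((m : ZMod p) + 1) ^ a) * hc

/-- At n = p - 1 the binomials are signs, and what is left is a power sum whose exponent p - 1 - b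
is not divisible by p - 1. -/
theorem starHarmonic_prime_sub_one {b : ℕ} (h0 : 0 < b) (h : b < p - 1) :
    starHarmonic p b (p - 1) = 0 := by
  rw [starHarmonic_eq_sum_choose b _ (by omega) (by omega)]
  have : ∀ m ∈ Finset.Ico 1 p, (-1) ^ (m + 1) * ((p - 1).choose m : ZMod p) * ((m : ZMod p) ^ b)⁻¹ =
      - (m : ZMod p) ^ (p - 1 - b) := by
    intro m hm
    rw [Finset.mem_Ico] at hm
    rw [ZMod.choose_prime_sub_one hm.2, ZMod.inv_pow_eq_pow hm.1 hm.2 h.le, pow_succ]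
    have : ((-1 : ZMod p) ^ m) * (-1) ^ m = 1 := by rw [← mul_pow]; simp
    linear_combination (-(m : ZMod p) ^ (p - 1 - b)) * this
  rw [Finset.sum_congr rfl this, Finset.sum_neg_distrib, ZMod.sum_Ico_pow,
    if_neg (Nat.not_dvd_of_pos_of_lt (by omega) (by omega)), neg_zero]

/-- Both sides obey the same recurrence in n. Descending induction starts at n = p - 1, where the
left side is an empty sum for b > 0 and the right side is `starHarmonic_prime_sub_one`. -/
theorem nestLt_replicate_one_prime (b n : ℕ) (hn : n < p) (hb : b < p - 1) :
    nestLt (invPow p) (List.replicate b 1) n p = (-1) ^ b * starHarmonic p b n := by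
  obtain ⟨d, hd⟩ : ∃ d, d + n = p - 1 := ⟨p - 1 - n, by omega⟩
  induction d generalizing n b with
  | zero =>
    obtain rfl : n = p - 1 := by omega
    rcases b with _ | b
    · simp [nestLt, starHarmonic, nestLe]
    · rw [starHarmonic_prime_sub_one (by omega) hb, List.replicate_succ, nestLt, mul_zero]
      refine Finset.sum_eq_zero fun m hm => ?_
      rw [Finset.mem_Ioo] at hm
      omega
  | succ d ih =>
    rcases b with _ | b
    · simp [nestLt, starHarmonic, nestLe]
    · have h1 := ih b (n + 1) (by omega) (by omega) (by omega)
      have h2 := ih (b + 1) (n + 1) (by omega) hb (by omega)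
      rw [List.replicate_succ, nestLt] at h2 ⊢
      rw [show Finset.Ioo n p = insert (n + 1) (Finset.Ioo (n + 1) p) by
        ext; simp only [Finset.mem_Ioo, Finset.mem_insert]; omega,
        Finset.sum_insert (by simp), h2, h1, starHarmonic_succ_succ]
      simp only [invPow, PNat.one_coe, pow_one]
      ring

/-- The substitution n_i ↦ p - n_i reverses the order of the variables and contributes one sign for
each of them. -/
theorem nestLe_replicate_one_prime (b n : ℕ) (h0 : 0 < n) (hn : n ≤ p) :
    nestLe (invPow p) (List.replicate b 1) n p = (-1) ^ b * starHarmonic p b (p - n) := by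
  induction b generalizing n with
  | zero => simp [nestLe, starHarmonic]
  | succ b ih =>
    rw [List.replicate_succ, nestLe, starHarmonic_succ_left, Finset.mul_sum]
    refine Finset.sum_bij' (fun m _ => p - m) (fun m _ => p - m) ?_ ?_ ?_ ?_ ?_
    · intro m hm; rw [Finset.mem_Ico] at hm ⊢; omega
    · intro m hm; rw [Finset.mem_Ico] at hm ⊢; omega
    · intro m hm; rw [Finset.mem_Ico] at hm; omega
    · intro m hm; rw [Finset.mem_Ico] at hm; omega
    · intro m hm
      rw [Finset.mem_Ico] at hm
      rw [ih m (by omega) (by omega), ZMod.natCast_self_sub (by omega), invPow, inv_neg]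
      simp only [PNat.one_coe, pow_one]
      ring

theorem nestLt_replicate_one_reflect (b n : ℕ) (hn : n ≤ p) :
    nestLt (invPow p) (List.replicate b 1) 0 n =
      (-1) ^ b * nestLt (invPow p) (List.replicate b 1) (p - n) p := by
  induction b generalizing n with
  | zero => simp [nestLt]
  | succ b ih =>
    rw [List.replicate_succ', nestLt_append_cons, ← List.replicate_succ', List.replicate_succ,
      nestLt, Finset.mul_sum]
    refine Finset.sum_bij' (fun m _ => p - m) (fun m _ => p - m) ?_ ?_ ?_ ?_ ?_
    · intro m hm; rw [Finset.mem_Ioo] at hm ⊢; omega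
    · intro m hm; rw [Finset.mem_Ioo] at hm ⊢; omega
    · intro m hm; rw [Finset.mem_Ioo] at hm; omega
    · intro m hm; rw [Finset.mem_Ioo] at hm; omega
    · intro m hm
      rw [Finset.mem_Ioo] at hm
      rw [ih m (by omega), invPow, invPow, ZMod.natCast_self_sub (by omega)]
      simp only [PNat.one_coe, pow_one, nestLt, inv_neg]
      ring

theorem nestLe_index121_prime (a b : ℕ) :
    nestLe (invPow p) (index121 a b) 1 p = (-1) ^ b *
      ∑ n ∈ Finset.Ico 1 p, starHarmonic p a n * starHarmonic p b (p - n) *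
        ((n : ZMod p) ^ 2)⁻¹ := by
  rw [index121, nestLe_append_cons, Finset.mul_sum]
  refine Finset.sum_congr rfl fun n hn => ?_
  rw [Finset.mem_Ico] at hn
  rw [nestLe_replicate_one_prime b n hn.1 hn.2.le, invPow]
  change starHarmonic p a n * _ * _ = _
  simp only [PNat.val_ofNat]
  ring

/-- Reflecting the left block of ones and converting both blocks to weak sums, the strict sum
becomes the weak one after n ↦ p - n in the middle variable. This is why the star and non-star
values coincide. -/
theorem nestLt_index121_prime (a b : ℕ) (ha : a < p - 1) (hb : b < p - 1) :
    nestLt (invPow p) (index121 a b) 0 p = nestLe (invPow p) (index121 a b) 1 p := by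
  rw [nestLe_index121_prime, index121, nestLt_append_cons, Finset.mul_sum]
  refine Finset.sum_bij' (fun m _ => p - m) (fun m _ => p - m) ?_ ?_ ?_ ?_ ?_
  · intro m hm; rw [Finset.mem_Ioo] at hm; rw [Finset.mem_Ico]; omega
  · intro m hm; rw [Finset.mem_Ico] at hm; rw [Finset.mem_Ioo]; omega
  · intro m hm; rw [Finset.mem_Ioo] at hm; omega
  · intro m hm; rw [Finset.mem_Ico] at hm; omega
  · intro n hn
    rw [Finset.mem_Ioo] at hn
    rw [nestLt_replicate_one_reflect a n hn.2.le,
      nestLt_replicate_one_prime a _ (by omega) ha, nestLt_replicate_one_prime b _ hn.2 hb,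
      ZMod.natCast_self_sub hn.2.le, Nat.sub_sub_self hn.2.le, invPow]
    have : ((-1 : ZMod p) ^ a) * (-1) ^ a = 1 := by rw [← mul_pow]; simp
    simp only [PNat.val_ofNat, neg_sq]
    linear_combination (-1) ^ b * starHarmonic p a (p - n) * ((n : ZMod p) ^ 2)⁻¹ *
      starHarmonic p b n * this

end FiniteSide

end FMZV

namespace FMZV

/-! ### Evaluation by a Bernoulli number modulo p -/

section FiniteEvaluation

variable {p : ℕ} [hp : Fact p.Prime]

/-- Absorption extracts n/m from C(n,m) and (p-n)/l ≡ -n/l from C(p-n,l). The two factors n cancel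
n⁻², and a Vandermonde convolution with N = p - 2 remains. -/
theorem sum_choose_mul_choose_inv_sq {m l : ℕ} (hm : m ∈ Finset.Ico 1 p) (hl : l ∈ Finset.Ico 1 p) :
    ∑ n ∈ Finset.Ico 1 p, (n.choose m : ZMod p) * ((p - n).choose l : ZMod p) *
      ((n : ZMod p) ^ 2)⁻¹ =
      -((m : ZMod p) * l)⁻¹ * ((p - 1).choose (m + l - 1) : ZMod p) := by
  rw [Finset.mem_Ico] at hm hl
  have hm0 := ZMod.natCast_ne_zero_of_lt hm.1 hm.2
  have hl0 := ZMod.natCast_ne_zero_of_lt hl.1 hl.2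
  obtain ⟨m, rfl⟩ : ∃ q, m = q + 1 := ⟨m - 1, by omega⟩
  obtain ⟨l, rfl⟩ : ∃ q, l = q + 1 := ⟨l - 1, by omega⟩
  have h2 := hp.out.two_le
  have hv := congrArg (Nat.cast : ℕ → ZMod p) (Nat.sum_range_choose_mul_choose_sub (p - 2) m l)
  rw [show p - 2 + 1 = p - 1 by omega, show m + l + 1 = m + 1 + (l + 1) - 1 by omega] at hv
  rw [← hv, Nat.cast_sum, Finset.mul_sum, Finset.sum_Ico_eq_sum_range]
  refine Finset.sum_congr rfl fun i hi => ?_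
  rw [Finset.mem_range] at hi
  have hi0 := ZMod.natCast_ne_zero_of_lt (Nat.succ_pos i) (show i + 1 < p by omega)
  have e1 := congrArg (Nat.cast : ℕ → ZMod p) (Nat.add_one_mul_choose_eq i m)
  have e2 := congrArg (Nat.cast : ℕ → ZMod p) (Nat.add_one_mul_choose_eq (p - 2 - i) l)
  have e3 : ((p - 2 - i + 1 : ℕ) : ZMod p) = -((i + 1 : ℕ) : ZMod p) := by
    rw [show p - 2 - i + 1 = p - (i + 1) by omega, ZMod.natCast_self_sub (by omega)]
  rw [show p - (1 + i) = p - 2 - i + 1 by omega, add_comm 1 i]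
  rw [Nat.cast_mul, e3] at e2
  push_cast at e1 e2 hm0 hl0 hi0 ⊢
  have f1 : ((i + 1).choose (m + 1) : ZMod p) = (i + 1) * i.choose m * ((m : ZMod p) + 1)⁻¹ := by
    field_simp
    linear_combination -e1
  have f2 : ((p - 2 - i + 1).choose (l + 1) : ZMod p) =
      -(i + 1) * (p - 2 - i).choose l * ((l : ZMod p) + 1)⁻¹ := by
    field_simp
    linear_combination -e2
  rw [f1, f2]
  field_simp

/-- After the binomial expansions the sum over n gives C(p-1, m+l-1), a sign if m + l ≤ p and 0
otherwise. Replacing l by p - l turns that condition into m ≤ l, and all signs cancel except the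
overall one. -/
theorem nestLe_index121_prime_eq_double_sum (a b : ℕ) :
    nestLe (invPow p) (index121 a b) 1 p =
      -∑ m ∈ Finset.Ico 1 p, ∑ l ∈ Finset.Ico 1 p,
        if m ≤ l then ((m : ZMod p) ^ (a + 1))⁻¹ * ((l : ZMod p) ^ (b + 1))⁻¹ else 0 := by
  have h1 : ∀ n ∈ Finset.Ico 1 p, starHarmonic p a n * starHarmonic p b (p - n) *
      ((n : ZMod p) ^ 2)⁻¹ = ∑ m ∈ Finset.Ico 1 p, ∑ l ∈ Finset.Ico 1 p,
        (-1) ^ (m + l) * ((m : ZMod p) ^ a)⁻¹ * ((l : ZMod p) ^ b)⁻¹ *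
          ((n.choose m : ZMod p) * ((p - n).choose l : ZMod p) * ((n : ZMod p) ^ 2)⁻¹) := by
    intro n hn
    rw [Finset.mem_Ico] at hn
    rw [starHarmonic_eq_sum_choose a n (by omega) (by omega),
      starHarmonic_eq_sum_choose b (p - n) (by omega) (by omega), Finset.sum_mul_sum,
      Finset.sum_mul]
    refine Finset.sum_congr rfl fun m _ => ?_
    rw [Finset.sum_mul]
    refine Finset.sum_congr rfl fun l _ => ?_
    ring
  rw [nestLe_index121_prime, Finset.sum_congr rfl h1, Finset.sum_comm, Finset.mul_sum,
    ← Finset.sum_neg_distrib]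
  refine Finset.sum_congr rfl fun m hm => ?_
  rw [Finset.sum_comm, Finset.mul_sum, ← Finset.sum_neg_distrib]
  refine Finset.sum_bij' (fun l _ => p - l) (fun l _ => p - l) ?_ ?_ ?_ ?_ ?_
  · intro m hm; rw [Finset.mem_Ico] at hm ⊢; omega
  · intro m hm; rw [Finset.mem_Ico] at hm ⊢; omega
  · intro m hm; rw [Finset.mem_Ico] at hm; omega
  · intro m hm; rw [Finset.mem_Ico] at hm; omega
  · intro l hl
    rw [← Finset.mul_sum, sum_choose_mul_choose_inv_sq hm hl]
    rw [Finset.mem_Ico] at hm hl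
    have hm0 := ZMod.natCast_ne_zero_of_lt hm.1 hm.2
    have hl0 := ZMod.natCast_ne_zero_of_lt hl.1 hl.2
    by_cases h : m + l ≤ p
    · rw [if_pos (by omega), ZMod.choose_prime_sub_one (by omega), ZMod.natCast_self_sub hl.2.le]
      have e1 : (-1 : ZMod p) ^ (m + l) = -(-1) ^ (m + l - 1) := by
        rw [← pow_sub_one_mul (by omega : m + l ≠ 0)]
        ring
      have e2 : (-1 : ZMod p) ^ (m + l - 1) * (-1) ^ (m + l - 1) = 1 := by rw [← mul_pow]; simp
      have e3 : (-1 : ZMod p) ^ b * (-1) ^ b = 1 := by rw [← mul_pow]; simp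
      rw [e1, neg_pow (l : ZMod p), mul_inv, mul_inv, ← inv_pow (-1 : ZMod p), inv_neg, inv_one]
      field_simp
      linear_combination ((m : ZMod p) * m ^ a * l * l ^ b * (-1) ^ b) * e2
    · rw [if_neg (by omega), Nat.choose_eq_zero_of_lt (by omega)]
      simp

/-- Negation of the upper index, as p - 1 - a ≡ -(a + 1). -/
theorem ZMod.choose_prime_sub (a j : ℕ) (h : a + j < p) :
    ((p - 1 - a).choose j : ZMod p) = (-1) ^ j * ((a + j).choose j : ZMod p) := by
  induction j with
  | zero => simp
  | succ j ih =>
    have h0 := ZMod.natCast_ne_zero_of_lt (Nat.succ_pos j) (show j + 1 < p by omega)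
    have e1 := congrArg (Nat.cast : ℕ → ZMod p) (Nat.choose_succ_right_eq (p - 1 - a) j)
    have e2 := congrArg (Nat.cast : ℕ → ZMod p) (Nat.add_one_mul_choose_eq (a + j) j)
    rw [Nat.cast_mul, Nat.cast_mul, ih (by omega),
      show p - 1 - a - j = p - (a + j + 1) by omega, ZMod.natCast_self_sub (by omega)] at e1
    rw [Nat.cast_mul, Nat.cast_mul] at e2
    apply mul_right_cancel₀ h0
    rw [e1, ← add_assoc, pow_succ]
    linear_combination -(-1) ^ j * e2

/-- A rational number is integral at `p` if its denominator is prime to `p`. -/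
def RatIntegralAt (p : ℕ) (q : ℚ) : Prop := (q.den : ZMod p) ≠ 0

theorem RatIntegralAt.add {q r : ℚ} (hq : RatIntegralAt p q) (hr : RatIntegralAt p r) :
    RatIntegralAt p (q + r) := by
  have h := mul_ne_zero hq hr
  rw [← Nat.cast_mul, Ne, ZMod.natCast_eq_zero_iff] at h
  rw [RatIntegralAt, Ne, ZMod.natCast_eq_zero_iff]
  exact fun h' => h (h'.trans (Rat.add_den_dvd q r))

theorem RatIntegralAt.mul {q r : ℚ} (hq : RatIntegralAt p q) (hr : RatIntegralAt p r) :
    RatIntegralAt p (q * r) := by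
  have h := mul_ne_zero hq hr
  rw [← Nat.cast_mul, Ne, ZMod.natCast_eq_zero_iff] at h
  rw [RatIntegralAt, Ne, ZMod.natCast_eq_zero_iff]
  exact fun h' => h (h'.trans (Rat.mul_den_dvd q r))

theorem RatIntegralAt.cast_mul {q r : ℚ} (hq : RatIntegralAt p q) (hr : RatIntegralAt p r) :
    ((q * r : ℚ) : ZMod p) = q * r :=
  Rat.cast_mul_of_ne_zero hq hr

theorem ratIntegralAt_natCast (n : ℕ) : RatIntegralAt p (n : ℚ) := by
  simp [RatIntegralAt]

theorem ratIntegralAt_intCast (n : ℤ) : RatIntegralAt p (n : ℚ) := by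
  simp [RatIntegralAt]

theorem ratIntegralAt_natCast_inv {n : ℕ} (h : (n : ZMod p) ≠ 0) : RatIntegralAt p (n : ℚ)⁻¹ := by
  rcases Nat.eq_zero_or_pos n with rfl | hn
  · simp at h
  · rw [RatIntegralAt, Rat.inv_natCast_den_of_pos hn]
    exact h

theorem Rat.cast_natCast_inv_zmod {n : ℕ} (h : (n : ZMod p) ≠ 0) :
    (((n : ℚ)⁻¹ : ℚ) : ZMod p) = (n : ZMod p)⁻¹ := by
  have hn : (n : ℚ) ≠ 0 := by
    rintro hn
    rw [Nat.cast_eq_zero] at hn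
    simp [hn] at h
  rw [eq_comm, inv_eq_iff_eq_inv, eq_comm]
  apply inv_eq_of_mul_eq_one_left
  rw [← Rat.cast_natCast (α := ZMod p) n,
    ← (ratIntegralAt_natCast n).cast_mul (ratIntegralAt_natCast_inv h),
    mul_inv_cancel₀ hn, Rat.cast_one]

theorem RatIntegralAt.sum {ι : Type*} (s : Finset ι) (f : ι → ℚ)
    (h : ∀ i ∈ s, RatIntegralAt p (f i)) :
    RatIntegralAt p (∑ i ∈ s, f i) ∧ ((∑ i ∈ s, f i : ℚ) : ZMod p) = ∑ i ∈ s, (f i : ZMod p) := by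
  classical
  induction s using Finset.induction_on with
  | empty => simp [RatIntegralAt]
  | insert i s hi ih =>
    have h1 := h i (Finset.mem_insert_self i s)
    obtain ⟨h2, h3⟩ := ih fun j hj => h j (Finset.mem_insert_of_mem hj)
    rw [Finset.sum_insert hi, Finset.sum_insert hi]
    exact ⟨h1.add h2, by rw [Rat.cast_add_of_ne_zero h1 h2, h3]⟩

/-- The defining recursion divides only by the integers n - k + 1 ≤ n + 1 < p. -/
theorem ratIntegralAt_bernoulli' (n : ℕ) (h : n + 1 < p) : RatIntegralAt p (bernoulli' n) := by
  induction n using Nat.strong_induction_on with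
  | _ n ih =>
    rw [bernoulli'_def, sub_eq_add_neg, ← neg_one_mul]
    refine RatIntegralAt.add (by simpa using ratIntegralAt_natCast 1)
      (RatIntegralAt.mul (by simpa using ratIntegralAt_intCast (-1)) (RatIntegralAt.sum _ _ ?_).1)
    intro k hk
    rw [Finset.mem_range] at hk
    refine RatIntegralAt.mul ?_ (ih k hk (by omega))
    rw [div_eq_mul_inv]
    refine (ratIntegralAt_natCast _).mul ?_
    rw [show (n : ℚ) - k + 1 = ((n - k + 1 : ℕ) : ℚ) by push_cast [Nat.cast_sub hk.le]; ring]
    exact ratIntegralAt_natCast_inv (ZMod.natCast_ne_zero_of_lt (by omega) (by omega))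

theorem ratIntegralAt_bernoulli (n : ℕ) (h : n + 1 < p) : RatIntegralAt p (bernoulli n) := by
  rw [bernoulli]
  refine RatIntegralAt.mul ?_ (ratIntegralAt_bernoulli' n h)
  have := ratIntegralAt_intCast (p := p) ((-1) ^ n)
  push_cast at this
  exact this

/-- Faulhaber's formula. The cast from ℚ to `ZMod p` respects sums and products only for p-integral
terms, which k + 1 < p guarantees. -/
theorem ZMod.sum_range_pow (l k : ℕ) (hk : k + 1 < p) :
    ∑ m ∈ Finset.range l, (m : ZMod p) ^ k =
      ∑ i ∈ Finset.range (k + 1), (bernoulli i : ZMod p) * ((k + 1).choose i : ZMod p) *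
        (l : ZMod p) ^ (k + 1 - i) * ((k + 1 : ℕ) : ZMod p)⁻¹ := by
  have hk0 := ZMod.natCast_ne_zero_of_lt (Nat.succ_pos k) hk
  have h := congrArg (Rat.cast : ℚ → ZMod p) (_root_.sum_range_pow l k)
  have hB : ∀ i ∈ Finset.range (k + 1), RatIntegralAt p (bernoulli i) := fun i hi =>
    ratIntegralAt_bernoulli i (by rw [Finset.mem_range] at hi; omega)
  have hl : ∑ m ∈ Finset.range l, (m : ℚ) ^ k = ((∑ m ∈ Finset.range l, m ^ k : ℕ) : ℚ) := by
    push_cast; rfl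
  have hr : ∀ i, bernoulli i * ((k + 1).choose i : ℚ) * (l : ℚ) ^ (k + 1 - i) / ((k : ℚ) + 1) =
      bernoulli i * (((k + 1).choose i * l ^ (k + 1 - i) : ℕ) : ℚ) * ((k + 1 : ℕ) : ℚ)⁻¹ := by
    intro i
    push_cast
    ring
  simp only [hr] at h
  have hi : ∀ i ∈ Finset.range (k + 1), RatIntegralAt p
      (bernoulli i * (((k + 1).choose i * l ^ (k + 1 - i) : ℕ) : ℚ) * ((k + 1 : ℕ) : ℚ)⁻¹) :=
    fun i hi => ((hB i hi).mul (ratIntegralAt_natCast _)).mul (ratIntegralAt_natCast_inv hk0)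
  rw [hl, Rat.cast_natCast, (RatIntegralAt.sum _ _ hi).2] at h
  push_cast at h
  push_cast
  rw [h]
  refine Finset.sum_congr rfl fun i hi => ?_
  have e1 := ((hB i hi).mul (ratIntegralAt_natCast
    ((k + 1).choose i * l ^ (k + 1 - i)))).cast_mul (ratIntegralAt_natCast_inv hk0)
  have e2 := (hB i hi).cast_mul (ratIntegralAt_natCast ((k + 1).choose i * l ^ (k + 1 - i)))
  rw [e2, Rat.cast_natCast_inv_zmod hk0, Rat.cast_natCast] at e1
  push_cast at e1
  rw [e1]
  ring

/-- Fermat turns inverse powers into positive ones, Faulhaber evaluates the sum over m < l as a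
polynomial in l, and the sum over l keeps only exponents divisible by p - 1. The diagonal m = l
contributes exponent p - 3 - a - b, hence 0. -/
theorem double_sum_inv_pow_eq_bernoulli (a b : ℕ) (h : a + b + 3 < p) :
    (∑ m ∈ Finset.Ico 1 p, ∑ l ∈ Finset.Ico 1 p,
        if m ≤ l then ((m : ZMod p) ^ (a + 1))⁻¹ * ((l : ZMod p) ^ (b + 1))⁻¹ else 0) =
      -(-1) ^ b * ((a + b + 1).choose a : ZMod p) * ((a + 1 : ℕ) : ZMod p)⁻¹ *
        (bernoulli (p - (a + b + 2)) : ZMod p) := by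
  have ha0 := ZMod.natCast_ne_zero_of_lt (p := p) (Nat.succ_pos a) (by omega)
  have hin : ∀ l ∈ Finset.Ico 1 p, (∑ m ∈ Finset.Ico 1 p,
      if m ≤ l then ((m : ZMod p) ^ (a + 1))⁻¹ * ((l : ZMod p) ^ (b + 1))⁻¹ else 0) =
      (∑ i ∈ Finset.range (p - 2 - a + 1), (bernoulli i : ZMod p) *
        ((p - 1 - a).choose i : ZMod p) * ((p - 1 - a : ℕ) : ZMod p)⁻¹ *
          (l : ZMod p) ^ (p - 1 - a - i + (p - 2 - b))) + (l : ZMod p) ^ (p - 3 - a - b) := by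
    intro l hl
    rw [Finset.mem_Ico] at hl
    have h1 : (∑ m ∈ Finset.Ico 1 p,
        if m ≤ l then ((m : ZMod p) ^ (a + 1))⁻¹ * ((l : ZMod p) ^ (b + 1))⁻¹ else 0) =
        (∑ m ∈ Finset.Ico 1 (l + 1), (m : ZMod p) ^ (p - 2 - a)) * (l : ZMod p) ^ (p - 2 - b) := by
      rw [← Finset.sum_filter, Finset.sum_mul]
      refine Finset.sum_congr ?_ fun m hm => ?_
      · ext; simp only [Finset.mem_filter, Finset.mem_Ico]; omega
      · rw [Finset.mem_Ico] at hm
        rw [ZMod.inv_pow_eq_pow hm.1 (by omega) (by omega), ZMod.inv_pow_eq_pow hl.1 hl.2 (by omega)]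
        congr 2 <;> omega
    have h2 : ∑ m ∈ Finset.Ico 1 l, (m : ZMod p) ^ (p - 2 - a) =
        ∑ m ∈ Finset.range l, (m : ZMod p) ^ (p - 2 - a) := by
      rw [Finset.range_eq_Ico, Finset.sum_eq_sum_Ico_succ_bot hl.1, Nat.cast_zero,
        zero_pow (by omega), zero_add]
    rw [h1, Finset.sum_Ico_succ_top hl.1, h2, ZMod.sum_range_pow l _ (by omega), add_mul,
      Finset.sum_mul, ← pow_add]
    congr 1
    · refine Finset.sum_congr rfl fun i hi => ?_
      rw [pow_add, show p - 2 - a + 1 = p - 1 - a by omega]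
      ring
    · rw [show p - 2 - a + (p - 2 - b) = p - 1 + (p - 3 - a - b) by omega, pow_add,
        ZMod.pow_card_sub_one_eq_one (ZMod.natCast_ne_zero_of_lt hl.1 hl.2), one_mul]
  rw [Finset.sum_comm, Finset.sum_congr rfl hin, Finset.sum_add_distrib, Finset.sum_comm,
    ZMod.sum_Ico_pow, if_neg (Nat.not_dvd_of_pos_of_lt (by omega) (by omega)), add_zero]
  simp only [← Finset.mul_sum, ZMod.sum_Ico_pow]
  -- The exponent 2p - 3 - a - b - i lies strictly between 0 and 2(p-1), so it is divisible by p - 1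
  -- only when it equals p - 1, that is i = p - (a+b+2).
  rw [Finset.sum_eq_single (p - (a + b + 2))]
  · rw [if_pos ⟨1, by omega⟩, ← Nat.choose_symm (by omega),
      show p - 1 - a - (p - (a + b + 2)) = b + 1 by omega, ZMod.choose_prime_sub a (b + 1) (by omega),
      show p - 1 - a = p - (a + 1) by omega, ZMod.natCast_self_sub (by omega),
      ← Nat.choose_symm (show b + 1 ≤ a + (b + 1) by omega), Nat.add_sub_cancel, ← add_assoc,
      pow_succ, inv_neg]
    ring
  · intro i hi hi'
    rw [Finset.mem_range] at hi
    rw [if_neg, mul_zero]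
    rintro ⟨c, hc⟩
    rcases c with _ | _ | c
    · omega
    · omega
    · have : (p - 1) * (c + 1 + 1) = (p - 1) * c + (p - 1) + (p - 1) := by ring
      omega
  · intro hi
    rw [Finset.mem_range] at hi
    omega

theorem ratMod_eq_cast (q : ℚ) : ratMod p q = (q : ZMod p) := by
  rw [ratMod, Rat.cast_def, div_eq_mul_inv]

theorem nestLe_index121_prime_eq_bernoulli (a b : ℕ) (h : a + b + 3 < p) :
    nestLe (invPow p) (index121 a b) 1 p = (-1) ^ b * ((a + b + 2).choose (a + 1) : ZMod p) *
      ratMod p (bernoulli (p - (a + b + 2)) / ((a + b + 2 : ℕ) : ℚ)) := by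
  have ha0 := ZMod.natCast_ne_zero_of_lt (p := p) (Nat.succ_pos a) (by omega)
  have hn0 := ZMod.natCast_ne_zero_of_lt (p := p) (m := a + b + 2) (by omega) (by omega)
  have hc := congrArg (Nat.cast : ℕ → ZMod p) (Nat.add_one_mul_choose_eq (a + b + 1) a)
  rw [Nat.cast_mul, Nat.cast_mul] at hc
  rw [nestLe_index121_prime_eq_double_sum, double_sum_inv_pow_eq_bernoulli a b h, ratMod_eq_cast,
    div_eq_mul_inv, (ratIntegralAt_bernoulli _ (by omega)).cast_mul
      (ratIntegralAt_natCast_inv hn0), Rat.cast_natCast_inv_zmod hn0]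
  field_simp
  linear_combination (bernoulli (p - (a + b + 2)) : ZMod p) * hc

end FiniteEvaluation

/-! ### Passage to the ring 𝒜₁, discarding finitely many primes -/

theorem ARing.mk_eq_mk_of_lt {n : ℕ} {x y : ∀ p : Nat.Primes, ZMod ((p : ℕ) ^ n)} (B : ℕ)
    (h : ∀ p : Nat.Primes, B < (p : ℕ) → x p = y p) : ARing.mk n x = ARing.mk n y := by
  rw [ARing.mk, ARing.mk, Ideal.Quotient.eq]
  change {p | (x - y) p ≠ 0}.Finite
  have hfin : {p : Nat.Primes | (p : ℕ) ≤ B}.Finite :=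
    Set.Finite.preimage Subtype.val_injective.injOn (Set.finite_Iic B)
  refine hfin.subset fun p hp => ?_
  by_contra hB
  exact hp (by simp [h p (not_le.1 hB)])

theorem ARing.mk_mul (n : ℕ) (x y : ∀ p : Nat.Primes, ZMod ((p : ℕ) ^ n)) :
    ARing.mk n x * ARing.mk n y = ARing.mk n (x * y) :=
  (map_mul (Ideal.Quotient.mk (finSuppIdeal n)) x y).symm

theorem sign_choose_mul_frakZA (a b : ℕ) :
    (-1) ^ b * (Nat.choose (a + b + 2) (a + 1) : ARing 1) * frakZA 1 ⟨a + b + 2, Nat.succ_pos _⟩ =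
      ARing.mk 1 fun p => (-1) ^ b * ((a + b + 2).choose (a + 1) : ZMod ((p : ℕ) ^ 1)) *
        ratMod ((p : ℕ) ^ 1) (bernoulli ((p : ℕ) - (a + b + 2)) / ((a + b + 2 : ℕ) : ℚ)) := by
  have h : ((-1) ^ b * (Nat.choose (a + b + 2) (a + 1) : ARing 1)) =
      ARing.mk 1 fun p => (-1) ^ b * ((a + b + 2).choose (a + 1) : ZMod ((p : ℕ) ^ 1)) := by
    change _ = Ideal.Quotient.mk (finSuppIdeal 1) ((-1) ^ b * ((a + b + 2).choose (a + 1)))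
    simp
  rw [h]
  change ARing.mk 1 _ * ARing.mk 1 _ = _
  rw [ARing.mk_mul]
  congr 1
  funext p
  have e : (p : ℕ) ^ (1 - 1) * ((p : ℕ) - 1) + 1 = p := by
    have := p.2.two_le
    simp only [Nat.sub_self, pow_zero, one_mul]
    omega
  simp only [Pi.mul_apply, e, PNat.mk_coe]
  congr 3
  push_cast
  ring

theorem zetaStarA_index121 (a b : ℕ) :
    zetaStarA 1 (index121 a b) =
      (-1) ^ b * (Nat.choose (a + b + 2) (a + 1) : ARing 1) *
        frakZA 1 ⟨a + b + 2, Nat.succ_pos _⟩ := by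
  rw [sign_choose_mul_frakZA, zetaStarA]
  refine ARing.mk_eq_mk_of_lt (a + b + 3) fun p hB => ?_
  have hI : Finset.Icc 1 ((p : ℕ) - 1) = Finset.Ico 1 (p : ℕ) := by
    ext
    have := p.2.two_le
    simp only [Finset.mem_Icc, Finset.mem_Ico]
    omega
  -- The modulus in the definition is p ^ 1, not p; a free modulus q equal to p carries the identity
  -- over by substitution.
  have key : ∀ q : ℕ, q = p → nestLe (invPow q) (index121 a b) 1 p =
      (-1) ^ b * ((a + b + 2).choose (a + 1) : ZMod q) *
        ratMod q (bernoulli ((p : ℕ) - (a + b + 2)) / ((a + b + 2 : ℕ) : ℚ)) := by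
    rintro q rfl
    have : Fact (Nat.Prime (p : ℕ)) := ⟨p.2⟩
    exact nestLe_index121_prime_eq_bernoulli a b hB
  rw [hI, ← key _ (pow_one _), ← sum_filter_monotone_eq_nestLe]
  rfl

theorem zetaA_index121 (a b : ℕ) :
    zetaA 1 (index121 a b) =
      (-1) ^ b * (Nat.choose (a + b + 2) (a + 1) : ARing 1) *
        frakZA 1 ⟨a + b + 2, Nat.succ_pos _⟩ := by
  rw [sign_choose_mul_frakZA, zetaA]
  refine ARing.mk_eq_mk_of_lt (a + b + 3) fun p hB => ?_
  have key : ∀ q : ℕ, q = p → nestLt (invPow q) (index121 a b) 0 p =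
      (-1) ^ b * ((a + b + 2).choose (a + 1) : ZMod q) *
        ratMod q (bernoulli ((p : ℕ) - (a + b + 2)) / ((a + b + 2 : ℕ) : ℚ)) := by
    rintro q rfl
    have : Fact (Nat.Prime (p : ℕ)) := ⟨p.2⟩
    rw [nestLt_index121_prime a b (by omega) (by omega)]
    exact nestLe_index121_prime_eq_bernoulli a b hB
  rw [← key _ (pow_one _), ← sum_filter_strictMono_eq_nestLt]
  rfl

end FMZV

namespace FMZV

/-! ### Shuffling with e₁ and existence of the regularization -/

section ShuffleAlgebra

/-- The element of `ℚ⟨e₀, e₁⟩` given by a word. -/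
noncomputable def word (w : List (Fin 2)) : NCPoly := wordBasis (FreeMonoid.ofList w)

theorem word_eq_symm (w : List (Fin 2)) : word w =
    FreeAlgebra.equivMonoidAlgebraFreeMonoid.symm
      (MonoidAlgebra.single (FreeMonoid.ofList w) (1 : ℚ)) := by
  simp [word, wordBasis, FreeAlgebra.basisFreeMonoid]

theorem letter_eq_symm (u : Fin 2) : letter u =
    FreeAlgebra.equivMonoidAlgebraFreeMonoid.symm
      (MonoidAlgebra.single (FreeMonoid.of u) (1 : ℚ)) := by
  rw [eq_comm, AlgEquiv.symm_apply_eq]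
  simp [letter, FreeAlgebra.equivMonoidAlgebraFreeMonoid]

@[simp]
theorem word_nil : word [] = 1 := by
  rw [word_eq_symm, FreeMonoid.ofList_nil, ← MonoidAlgebra.one_def, map_one]

theorem word_cons (u : Fin 2) (w : List (Fin 2)) : word (u :: w) = letter u * word w := by
  rw [word_eq_symm, letter_eq_symm, word_eq_symm, ← map_mul, MonoidAlgebra.single_mul_single,
    mul_one, FreeMonoid.ofList_cons]

theorem word_append (v w : List (Fin 2)) : word (v ++ w) = word v * word w := by
  induction v with
  | nil => simp
  | cons u v ih => rw [List.cons_append, word_cons, ih, word_cons, mul_assoc]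

theorem word_singleton (u : Fin 2) : word [u] = letter u := by
  rw [word_cons, word_nil, mul_one]

theorem word_replicate (n : ℕ) (u : Fin 2) : word (List.replicate n u) = letter u ^ n := by
  induction n with
  | zero => simp
  | succ n ih => rw [List.replicate_succ, word_cons, ih, pow_succ']

theorem linearMap_ext_word {M : Type*} [AddCommMonoid M] [Module ℚ M] {f g : NCPoly →ₗ[ℚ] M}
    (h : ∀ w, f (word w) = g (word w)) : f = g :=
  wordBasis.ext fun w => h (FreeMonoid.toList w)

theorem shuffle_word (v w : List (Fin 2)) : shuffle (word v) (word w) = shuffleWord v w := by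
  simp [shuffle, word, Module.Basis.constr_basis]

theorem shuffleWord_nil_left (w : List (Fin 2)) : shuffleWord [] w = word w := by
  simp [shuffleWord, word]

theorem shuffleWord_nil_right (w : List (Fin 2)) : shuffleWord w [] = word w := by
  cases w <;> simp [shuffleWord, word]

theorem shuffle_one (x : NCPoly) : shuffle x 1 = x := by
  have : shuffle.flip 1 = LinearMap.id := linearMap_ext_word fun w => by
    rw [LinearMap.flip_apply, ← word_nil, shuffle_word, shuffleWord_nil_right, LinearMap.id_apply]
  exact LinearMap.congr_fun this x

theorem shuffle_letter_mul (u : Fin 2) (x : NCPoly) (n : ℕ) :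
    shuffle (letter u * x) (letter 1 ^ (n + 1)) =
      letter u * shuffle x (letter 1 ^ (n + 1)) + letter 1 * shuffle (letter u * x) (letter 1 ^ n) := by
  have : shuffle.flip (letter 1 ^ (n + 1)) ∘ₗ LinearMap.mulLeft ℚ (letter u) =
      LinearMap.mulLeft ℚ (letter u) ∘ₗ shuffle.flip (letter 1 ^ (n + 1)) +
      LinearMap.mulLeft ℚ (letter 1) ∘ₗ shuffle.flip (letter 1 ^ n) ∘ₗ
        LinearMap.mulLeft ℚ (letter u) := linearMap_ext_word fun w => by
    simp only [LinearMap.comp_apply, LinearMap.add_apply, LinearMap.flip_apply,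
      LinearMap.mulLeft_apply, ← word_cons, ← word_replicate, shuffle_word, List.replicate_succ]
    rw [shuffleWord]
  exact LinearMap.congr_fun this x

/-- The shuffle product with the letter `e₁`. -/
noncomputable def shuffleE1 : NCPoly →ₗ[ℚ] NCPoly := shuffle.flip (letter 1)

theorem shuffleE1_apply (x : NCPoly) : shuffleE1 x = shuffle x (letter 1) := rfl

theorem shuffleE1_one : shuffleE1 1 = letter 1 := by
  rw [shuffleE1_apply, ← word_nil, ← word_singleton, shuffle_word, shuffleWord_nil_left]

theorem shuffleE1_letter_mul (u : Fin 2) (x : NCPoly) :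
    shuffleE1 (letter u * x) = letter u * shuffleE1 x + letter 1 * (letter u * x) := by
  have h := shuffle_letter_mul u x 0
  rwa [zero_add, pow_one, pow_zero, shuffle_one] at h

/-- The shuffle recursion read from the last letter. The polylogarithms are differentiated at this
end of the word. -/
theorem shuffleE1_mul_letter (u : Fin 2) (x : NCPoly) :
    shuffleE1 (x * letter u) = shuffleE1 x * letter u + x * letter u * letter 1 := by
  have : shuffleE1 ∘ₗ LinearMap.mulRight ℚ (letter u) =
      LinearMap.mulRight ℚ (letter u) ∘ₗ shuffleE1 +
      LinearMap.mulRight ℚ (letter 1) ∘ₗ LinearMap.mulRight ℚ (letter u) :=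
    linearMap_ext_word fun w => by
      simp only [LinearMap.comp_apply, LinearMap.add_apply, LinearMap.mulRight_apply]
      induction w with
      | nil =>
        have := shuffleE1_letter_mul u 1
        rw [mul_one, shuffleE1_one] at this
        rw [word_nil, one_mul, this, shuffleE1_one, add_comm]
      | cons v w ih =>
        rw [word_cons, mul_assoc, shuffleE1_letter_mul, ih, shuffleE1_letter_mul]
        noncomm_ring
  exact LinearMap.congr_fun this x

/-- The words e₁^n behave as divided powers. Knowing this for every left factor x replaces
associativity and commutativity of the full shuffle product. -/
theorem shuffleE1_shuffle_pow (x : NCPoly) (n : ℕ) :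
    shuffleE1 (shuffle x (letter 1 ^ n)) = ((n : ℚ) + 1) • shuffle x (letter 1 ^ (n + 1)) := by
  induction n generalizing x with
  | zero => simp [shuffle_one, shuffleE1_apply]
  | succ n ihn =>
    have : shuffleE1 ∘ₗ shuffle.flip (letter 1 ^ (n + 1)) =
        (((n + 1 : ℕ) : ℚ) + 1) • shuffle.flip (letter 1 ^ (n + 2)) :=
      linearMap_ext_word fun w => by
        simp only [LinearMap.comp_apply, LinearMap.smul_apply, LinearMap.flip_apply]
        induction w with
        | nil =>
          have h : ∀ m : ℕ, shuffleE1 (letter 1 ^ m) = ((m : ℚ) + 1) • letter 1 ^ (m + 1) := by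
            intro m
            induction m with
            | zero => simp [shuffleE1_one]
            | succ m ih =>
              rw [pow_succ', shuffleE1_letter_mul, ih, mul_smul_comm, ← pow_succ', ← pow_succ',
                ← pow_succ']
              push_cast
              module
          rw [← word_replicate, ← word_replicate, shuffle_word, shuffle_word,
            shuffleWord_nil_left, shuffleWord_nil_left, word_replicate, word_replicate, h]
        | cons u w ih =>
          rw [word_cons, shuffle_letter_mul, map_add, shuffleE1_letter_mul, ih,
            shuffleE1_letter_mul, ihn, shuffle_letter_mul u _ (n + 1),
            shuffle_letter_mul u _ n]
          push_cast
          simp only [mul_add, mul_smul_comm]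
          module
    exact LinearMap.congr_fun this x

theorem shuffle_shufflePowE1 (x : NCPoly) (i : ℕ) :
    shuffle x (shufflePowE1 i) = (shuffleE1 ^ i) x := by
  have h : ∀ i, shufflePowE1 i = (i.factorial : ℚ) • letter 1 ^ i := by
    intro i
    induction i with
    | zero => simp [shufflePowE1]
    | succ i ih =>
      have h1 : ∀ n : ℕ, shuffle (letter 1) (letter 1 ^ n) = ((n : ℚ) + 1) • letter 1 ^ (n + 1) := by
        intro n
        induction n with
        | zero => simp [shuffle_one]
        | succ n ihn =>
          have := shuffle_letter_mul 1 1 n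
          rw [mul_one, ihn] at this
          rw [this, ← word_nil, ← word_replicate, shuffle_word, shuffleWord_nil_left,
            word_replicate, mul_smul_comm, ← pow_succ']
          push_cast
          module
      rw [shufflePowE1, ih, map_smul, h1, smul_smul, Nat.factorial_succ]
      push_cast
      rw [mul_comm]
  induction i with
  | zero => simp [shufflePowE1, shuffle_one]
  | succ i ih =>
    rw [pow_succ', Module.End.mul_apply, ← ih, h, h, map_smul, map_smul, map_smul,
      shuffleE1_shuffle_pow, smul_smul, Nat.factorial_succ]
    push_cast
    rw [mul_comm]

theorem isShuffleExpansion_iff (a : NCPoly) (c : ℕ →₀ NCPoly) :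
    IsShuffleExpansion a c ↔ (∀ i, c i ∈ H0) ∧ a = c.sum fun i x => (shuffleE1 ^ i) x := by
  simp only [IsShuffleExpansion, shuffle_shufflePowE1]

/-- The elements which admit an expansion `∑ᵢ aᵢ ш e₁^{ш i}` with all `aᵢ` in `ℌ⁰`. -/
noncomputable def shuffleExpandable : Submodule ℚ NCPoly :=
  ⨆ i : ℕ, H0.map (shuffleE1 ^ i)

theorem exists_isShuffleExpansion {a : NCPoly} (h : a ∈ shuffleExpandable) :
    ∃ c, IsShuffleExpansion a c := by
  simp only [isShuffleExpansion_iff]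
  refine Submodule.iSup_induction _ (motive := fun a => ∃ c : ℕ →₀ NCPoly, (∀ i, c i ∈ H0) ∧
    a = c.sum fun i x => (shuffleE1 ^ i) x) h ?_ ?_ ?_
  · rintro i _ ⟨y, hy, rfl⟩
    refine ⟨Finsupp.single i y, fun j => ?_, ?_⟩
    · rw [Finsupp.single_apply]
      split_ifs
      · exact hy
      · exact H0.zero_mem
    · exact (Finsupp.sum_single_index (h := fun i x => (shuffleE1 ^ i) x) (map_zero _)).symm
  · exact ⟨0, fun _ => H0.zero_mem, by simp⟩
  · rintro x y ⟨c, hc, rfl⟩ ⟨d, hd, rfl⟩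
    refine ⟨c + d, fun i => H0.add_mem (hc i) (hd i), ?_⟩
    rw [Finsupp.sum_add_index' (fun _ => map_zero _) fun _ _ _ => map_add _ _ _]

theorem shuffleE1_mem_shuffleExpandable {a : NCPoly} (h : a ∈ shuffleExpandable) :
    shuffleE1 a ∈ shuffleExpandable := by
  refine Submodule.iSup_induction _ (motive := fun a => shuffleE1 a ∈ shuffleExpandable) h ?_ ?_ ?_
  · rintro i _ ⟨y, hy, rfl⟩
    refine Submodule.mem_iSup_of_mem (i + 1) ⟨y, hy, ?_⟩
    rw [pow_succ', Module.End.mul_apply]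
  · rw [map_zero]; exact Submodule.zero_mem _
  · intro x y hx hy
    rw [map_add]
    exact Submodule.add_mem _ hx hy

theorem mem_shuffleExpandable_of_mem_H0 {a : NCPoly} (h : a ∈ H0) : a ∈ shuffleExpandable :=
  Submodule.mem_iSup_of_mem 0 ⟨a, h, by simp⟩

theorem shuffleE1_mul_pow (x : NCPoly) (b : ℕ) :
    shuffleE1 (x * letter 1 ^ b) =
      shuffleE1 x * letter 1 ^ b + (b : ℚ) • (x * letter 1 ^ (b + 1)) := by
  induction b with
  | zero => simp
  | succ b ih =>
    rw [pow_succ, ← mul_assoc, shuffleE1_mul_letter, ih, pow_succ _ (b + 1), pow_succ _ b]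
    simp only [add_mul, smul_mul_assoc, mul_assoc]
    push_cast
    module

theorem pow_mem_shuffleExpandable (b : ℕ) : letter 1 ^ b ∈ shuffleExpandable := by
  induction b with
  | zero => exact mem_shuffleExpandable_of_mem_H0 (Submodule.mem_sup_left (by simp))
  | succ b ih =>
    have h := shuffleE1_mem_shuffleExpandable ih
    have e := shuffleE1_mul_pow 1 b
    rw [one_mul, one_mul, shuffleE1_one, ← pow_succ'] at e
    rw [e, show letter 1 ^ (b + 1) + (b : ℚ) • letter 1 ^ (b + 1) =
      ((b : ℚ) + 1) • letter 1 ^ (b + 1) by module] at h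
    exact (Submodule.smul_mem_iff _ (by positivity)).1 h

/-- Shuffling e₁ y e₀ e₁^b with e₁ gives (b+1) e₁ y e₀ e₁^(b+1) plus words with only b trailing
letters e₁. Solve for the first term; the induction is uniform in y because y changes. -/
theorem mul_pow_mem_shuffleExpandable (y : NCPoly) (b : ℕ) :
    letter 1 * y * letter 0 * letter 1 ^ b ∈ shuffleExpandable := by
  induction b generalizing y with
  | zero =>
    refine mem_shuffleExpandable_of_mem_H0 (Submodule.mem_sup_right ⟨y, ?_⟩)
    simp [mul_assoc]
  | succ b ih =>
    have h := shuffleE1_mem_shuffleExpandable (ih y)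
    have h2 := ih (shuffleE1 y + letter 1 * y)
    have e : ((b : ℚ) + 1) • (letter 1 * y * letter 0 * letter 1 ^ (b + 1)) =
        shuffleE1 (letter 1 * y * letter 0 * letter 1 ^ b) -
          letter 1 * (shuffleE1 y + letter 1 * y) * letter 0 * letter 1 ^ b := by
      rw [shuffleE1_mul_pow, shuffleE1_mul_letter, shuffleE1_letter_mul, pow_succ' _ b]
      simp only [add_mul, mul_add, mul_assoc]
      module
    exact (Submodule.smul_mem_iff _ (show (b : ℚ) + 1 ≠ 0 by positivity)).1
      (e ▸ Submodule.sub_mem _ h h2)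

theorem exists_eq_replicate_one (w : List (Fin 2)) :
    (∃ b, w = List.replicate b 1) ∨ ∃ v b, w = v ++ 0 :: List.replicate b 1 := by
  induction w using List.reverseRecOn with
  | nil => exact Or.inl ⟨0, rfl⟩
  | append_singleton w u ih =>
    fin_cases u
    · exact Or.inr ⟨w, 0, rfl⟩
    · rcases ih with ⟨b, rfl⟩ | ⟨v, b, rfl⟩
      · exact Or.inl ⟨b + 1, by rw [List.replicate_succ']; rfl⟩
      · exact Or.inr ⟨v, b + 1, by simp [List.replicate_succ']⟩

theorem word_one_cons_mem_shuffleExpandable (w : List (Fin 2)) :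
    word (1 :: w) ∈ shuffleExpandable := by
  rcases exists_eq_replicate_one w with ⟨b, rfl⟩ | ⟨v, b, rfl⟩
  · rw [← List.replicate_succ, word_replicate]
    exact pow_mem_shuffleExpandable _
  · have := mul_pow_mem_shuffleExpandable (word v) b
    rwa [← word_cons, ← word_singleton 0, ← word_append, ← word_replicate, ← word_append,
      List.append_assoc] at this

/-- The word of letters of `e_k`. -/
def indexWord : Index → List (Fin 2)
  | [] => []
  | k :: ks => 1 :: (List.replicate ((k : ℕ) - 1) 0 ++ indexWord ks)

theorem eIndex_eq_word (k : Index) : eIndex k = word (indexWord k) := by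
  induction k with
  | nil => simp [eIndex, indexWord]
  | cons k ks ih =>
    rw [eIndex] at ih
    rw [eIndex, List.map_cons, List.prod_cons, ih, indexWord, word_cons, word_append,
      word_replicate, mul_assoc]

theorem readWord_indexWord (k : Index) : readWord (indexWord k) = (0, k) := by
  have h : ∀ (j : ℕ) (w : List (Fin 2)),
      readWord (List.replicate j 0 ++ w) = ((readWord w).1 + j, (readWord w).2) := by
    intro j w
    induction j with
    | zero => simp
    | succ j ih =>
      rw [List.replicate_succ, List.cons_append, readWord, if_pos rfl, ih]
      simp [add_assoc]
  induction k with
  | nil => rfl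
  | cons k ks ih =>
    rw [indexWord, readWord, if_neg (by decide), h, ih]
    simp only [zero_add, Prod.mk.injEq, List.cons.injEq, and_true, true_and]
    exact PNat.succPNat_natPred k

theorem exists_indexWord_eq (w : List (Fin 2)) :
    ∃ j k, w = List.replicate j 0 ++ indexWord k := by
  induction w with
  | nil => exact ⟨0, [], rfl⟩
  | cons u w ih =>
    obtain ⟨j, k, rfl⟩ := ih
    fin_cases u
    · exact ⟨j + 1, k, rfl⟩
    · exact ⟨0, Nat.succPNat j :: k, by simp [indexWord]⟩

theorem exists_isShuffleExpansion_eIndex (k : Index) : ∃ c, IsShuffleExpansion (eIndex k) c := by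
  apply exists_isShuffleExpansion
  rw [eIndex_eq_word]
  cases k with
  | nil => simpa [indexWord] using pow_mem_shuffleExpandable 0
  | cons k ks => exact word_one_cons_mem_shuffleExpandable _

/-- `regShuffle` picks some expansion. That its leading term does not matter follows later from
uniqueness of asymptotic expansions, not from algebra. -/
theorem exists_mzvSh_eq (k : Index) :
    ∃ c, IsShuffleExpansion (eIndex k) c ∧ mzvSh k = ZMap (c 0) := by
  have h := exists_isShuffleExpansion_eIndex k
  refine ⟨h.choose, h.choose_spec, ?_⟩
  rw [mzvSh, regShuffle, dif_pos h]

theorem ZMap_word (w : List (Fin 2)) : ZMap (word w) = mzvZ (readWord w).2 := by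
  simp [ZMap, word, Module.Basis.constr_basis]

end ShuffleAlgebra

end FMZV

namespace FMZV

/-! ### Multiple polylogarithms as formal power series -/

section PolylogSeries

/-- The coefficients of the multiple polylogarithm of a word, read from its last letter. -/
noncomputable def wordCoeff : List (Fin 2) → ℕ → ℝ
  | [], n => if n = 0 then 1 else 0
  | u :: w, n => if u = 0 then wordCoeff w n / n else (∑ m ∈ Finset.range n, wordCoeff w m) / n

/-- The generating series of the multiple polylogarithms, extended linearly to `ℚ⟨e₀, e₁⟩`. -/
noncomputable def polylogSeries : NCPoly →ₗ[ℚ] PowerSeries ℝ :=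
  wordBasis.constr ℚ fun w => PowerSeries.mk (wordCoeff (FreeMonoid.toList w).reverse)

theorem polylogSeries_word (w : List (Fin 2)) :
    polylogSeries (word w) = PowerSeries.mk (wordCoeff w.reverse) := by
  simp [polylogSeries, word, Module.Basis.constr_basis]

theorem coeff_polylogSeries_word (w : List (Fin 2)) (n : ℕ) :
    PowerSeries.coeff n (polylogSeries (word w)) = wordCoeff w.reverse n := by
  rw [polylogSeries_word, PowerSeries.coeff_mk]

theorem polylogSeries_one : polylogSeries 1 = 1 := by
  ext n
  rw [← word_nil, coeff_polylogSeries_word, PowerSeries.coeff_one]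
  rfl

theorem polylogSeries_induction {P : NCPoly → Prop} (hw : ∀ w, P (word w))
    (hadd : ∀ x y, P x → P y → P (x + y)) (hsmul : ∀ (q : ℚ) x, P x → P (q • x)) (x : NCPoly) :
    P x := by
  have hx : x ∈ Submodule.span ℚ (Set.range wordBasis) := by
    rw [wordBasis.span_eq]; exact Submodule.mem_top
  induction hx using Submodule.span_induction with
  | mem x h => obtain ⟨w, rfl⟩ := h; exact hw (FreeMonoid.toList w)
  | zero => simpa using hsmul 0 _ (hw [])
  | add x y _ _ hx hy => exact hadd x y hx hy
  | smul q x _ hx => exact hsmul q x hx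

theorem coeff_polylogSeries_smul (n : ℕ) (q : ℚ) (x : NCPoly) :
    PowerSeries.coeff n (polylogSeries (q • x)) = q * PowerSeries.coeff n (polylogSeries x) := by
  rw [map_smul]
  rw [← algebraMap_smul ℝ q (polylogSeries x), PowerSeries.coeff_smul]
  simp

theorem coeff_polylogSeries_mul_zero (x : NCPoly) (n : ℕ) :
    PowerSeries.coeff n (polylogSeries (x * letter 0)) =
      PowerSeries.coeff n (polylogSeries x) / n := by
  induction x using polylogSeries_induction with
  | hw w =>
    rw [← word_singleton, ← word_append, coeff_polylogSeries_word, coeff_polylogSeries_word]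
    simp [wordCoeff]
  | hadd x y hx hy => rw [add_mul, map_add, map_add, hx, hy, map_add, map_add]; ring
  | hsmul q x hx =>
    rw [smul_mul_assoc, coeff_polylogSeries_smul, coeff_polylogSeries_smul, hx]; ring

theorem coeff_polylogSeries_mul_one (x : NCPoly) (n : ℕ) :
    PowerSeries.coeff n (polylogSeries (x * letter 1)) =
      (∑ m ∈ Finset.range n, PowerSeries.coeff m (polylogSeries x)) / n := by
  induction x using polylogSeries_induction with
  | hw w =>
    rw [← word_singleton, ← word_append, coeff_polylogSeries_word]
    simp [wordCoeff, coeff_polylogSeries_word]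
  | hadd x y hx hy =>
    rw [add_mul, map_add, map_add, hx, hy, map_add, ← add_div, ← Finset.sum_add_distrib]
    simp only [map_add]
  | hsmul q x hx =>
    rw [smul_mul_assoc, coeff_polylogSeries_smul, hx]
    simp only [coeff_polylogSeries_smul]
    rw [← Finset.mul_sum]
    ring

theorem constantCoeff_polylogSeries_mul_letter (x : NCPoly) (u : Fin 2) :
    PowerSeries.constantCoeff (polylogSeries (x * letter u)) = 0 := by
  rw [← PowerSeries.coeff_zero_eq_constantCoeff_apply]
  fin_cases u
  · simp [coeff_polylogSeries_mul_zero]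
  · simp [coeff_polylogSeries_mul_one]

theorem derivative_polylogSeries_mul_one (x : NCPoly) :
    PowerSeries.derivative ℝ (polylogSeries (x * letter 1)) =
      polylogSeries x * PowerSeries.mk fun _ => (1 : ℝ) := by
  ext n
  rw [PowerSeries.coeff_derivative, coeff_polylogSeries_mul_one, PowerSeries.coeff_mul,
    Finset.Nat.sum_antidiagonal_eq_sum_range_succ_mk]
  have : ((n : ℝ) + 1) ≠ 0 := by positivity
  push_cast
  rw [div_mul_cancel₀ _ this]
  simp

/-- The constant coefficient has to vanish, because dividing coefficient 0 by n = 0 has erased it.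
-/
theorem X_mul_derivative_polylogSeries_mul_zero (x : NCPoly)
    (hx : PowerSeries.constantCoeff (polylogSeries x) = 0) :
    PowerSeries.X * PowerSeries.derivative ℝ (polylogSeries (x * letter 0)) = polylogSeries x := by
  ext n
  cases n with
  | zero => simpa using hx.symm
  | succ n =>
    rw [PowerSeries.coeff_succ_X_mul, PowerSeries.coeff_derivative, coeff_polylogSeries_mul_zero]
    have : ((n : ℝ) + 1) ≠ 0 := by positivity
    push_cast
    rw [div_mul_cancel₀ _ this]

/-- Both sides have zero constant term, and the Leibniz rule for the product with Li_1 reproduces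
the shuffle recursion at the last letter. The word must begin with e₁: a bare e₀ has series 0,
although its shuffle with e₁ does not. -/
theorem polylogSeries_shuffleE1_word (w : List (Fin 2)) :
    polylogSeries (shuffleE1 (word (1 :: w))) =
      polylogSeries (word (1 :: w)) * polylogSeries (letter 1) := by
  have hE : ∀ x, polylogSeries (shuffleE1 x) = polylogSeries x * polylogSeries (letter 1) →
      polylogSeries (shuffleE1 (x * letter 1)) =
        polylogSeries (x * letter 1) * polylogSeries (letter 1) := by
    intro x hx
    have h1 := derivative_polylogSeries_mul_one 1
    rw [one_mul, polylogSeries_one, one_mul] at h1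
    apply PowerSeries.derivative.ext
    · rw [shuffleE1_mul_letter, map_add, map_add, derivative_polylogSeries_mul_one,
        derivative_polylogSeries_mul_one, hx, Derivation.leibniz, derivative_polylogSeries_mul_one,
        h1]
      simp only [smul_eq_mul]
      ring
    · rw [shuffleE1_mul_letter, map_add, map_add, constantCoeff_polylogSeries_mul_letter,
        constantCoeff_polylogSeries_mul_letter, map_mul, constantCoeff_polylogSeries_mul_letter]
      ring
  have hZ : ∀ x, PowerSeries.constantCoeff (polylogSeries x) = 0 →
      polylogSeries (shuffleE1 x) = polylogSeries x * polylogSeries (letter 1) →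
      polylogSeries (shuffleE1 (x * letter 0)) =
        polylogSeries (x * letter 0) * polylogSeries (letter 1) := by
    intro x hx0 hx
    have h1 := derivative_polylogSeries_mul_one 1
    rw [one_mul, polylogSeries_one, one_mul] at h1
    have hx1 : PowerSeries.constantCoeff (polylogSeries (shuffleE1 x)) = 0 := by
      rw [hx, map_mul, hx0, zero_mul]
    apply PowerSeries.derivative.ext
    · apply mul_left_cancel₀ (PowerSeries.X_ne_zero (R := ℝ))
      rw [shuffleE1_mul_letter, map_add, map_add, mul_add,
        X_mul_derivative_polylogSeries_mul_zero _ hx1, derivative_polylogSeries_mul_one, hx,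
        Derivation.leibniz, h1]
      simp only [smul_eq_mul]
      rw [mul_add, show PowerSeries.X * (polylogSeries (letter 1) *
        PowerSeries.derivative ℝ (polylogSeries (x * letter 0))) = polylogSeries (letter 1) *
          (PowerSeries.X * PowerSeries.derivative ℝ (polylogSeries (x * letter 0))) by ring,
        X_mul_derivative_polylogSeries_mul_zero x hx0]
      ring
    · rw [shuffleE1_mul_letter, map_add, map_add, constantCoeff_polylogSeries_mul_letter,
        constantCoeff_polylogSeries_mul_letter, map_mul, constantCoeff_polylogSeries_mul_letter]
      ring
  have hc : ∀ w : List (Fin 2), PowerSeries.constantCoeff (polylogSeries (word (1 :: w))) = 0 := by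
    intro w
    obtain ⟨v, u, h⟩ : ∃ v u, 1 :: w = v ++ [u] := by
      rcases List.eq_nil_or_concat (1 :: w) with h | ⟨v, u, h⟩
      · simp at h
      · exact ⟨v, u, by simpa using h⟩
    rw [h, word_append, word_singleton, constantCoeff_polylogSeries_mul_letter]
  induction w using List.reverseRecOn with
  | nil =>
    rw [word_singleton]
    simpa only [one_mul] using hE 1 (by rw [shuffleE1_one, polylogSeries_one, one_mul])
  | append_singleton w u ih =>
    rw [← List.cons_append, word_append, word_singleton]
    fin_cases u
    · exact hZ _ (hc w) ih
    · exact hE _ ih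

/-- `ℚ + e₁ ℚ⟨e₀, e₁⟩`. -/
noncomputable def H1 : Submodule ℚ NCPoly := 1 ⊔ LinearMap.range (LinearMap.mulLeft ℚ (letter 1))

theorem H0_le_H1 : H0 ≤ H1 := by
  refine sup_le_sup_left ?_ _
  rintro _ ⟨y, rfl⟩
  exact ⟨y * letter 0, by simp⟩

theorem shuffleE1_mem_H1 {x : NCPoly} (hx : x ∈ H1) : shuffleE1 x ∈ H1 := by
  obtain ⟨y, hy, z, hz, rfl⟩ := Submodule.mem_sup.1 hx
  obtain ⟨q, rfl⟩ := Submodule.mem_one.1 hy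
  obtain ⟨z, rfl⟩ := hz
  rw [map_add, Algebra.algebraMap_eq_smul_one, map_smul, shuffleE1_one]
  refine Submodule.mem_sup_right (Submodule.add_mem _ ⟨q • 1, by simp⟩
    ⟨shuffleE1 z + letter 1 * z, ?_⟩)
  rw [LinearMap.mulLeft_apply, LinearMap.mulLeft_apply, shuffleE1_letter_mul, mul_add]

theorem polylogSeries_shuffleE1 {x : NCPoly} (hx : x ∈ H1) :
    polylogSeries (shuffleE1 x) = polylogSeries x * polylogSeries (letter 1) := by
  obtain ⟨y, hy, z, hz, rfl⟩ := Submodule.mem_sup.1 hx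
  obtain ⟨q, rfl⟩ := Submodule.mem_one.1 hy
  obtain ⟨z, rfl⟩ := hz
  have h : ∀ z, polylogSeries (shuffleE1 (letter 1 * z)) =
      polylogSeries (letter 1 * z) * polylogSeries (letter 1) := by
    intro z
    induction z using polylogSeries_induction with
    | hw w => rw [← word_cons, polylogSeries_shuffleE1_word]
    | hadd x y hx hy => simp only [mul_add, map_add, hx, hy, add_mul]
    | hsmul q x hx => simp only [mul_smul_comm, map_smul, hx, smul_mul_assoc]
  rw [map_add, map_add, LinearMap.mulLeft_apply, h, map_add, add_mul,
    Algebra.algebraMap_eq_smul_one, map_smul, map_smul, shuffleE1_one, map_smul, polylogSeries_one,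
    smul_mul_assoc, one_mul]

theorem polylogSeries_shuffleE1_pow {x : NCPoly} (hx : x ∈ H1) (i : ℕ) :
    polylogSeries ((shuffleE1 ^ i) x) = polylogSeries x * polylogSeries (letter 1) ^ i := by
  suffices h : (shuffleE1 ^ i) x ∈ H1 ∧
      polylogSeries ((shuffleE1 ^ i) x) = polylogSeries x * polylogSeries (letter 1) ^ i from h.2
  induction i with
  | zero => simpa using hx
  | succ i ih =>
    rw [pow_succ', Module.End.mul_apply, polylogSeries_shuffleE1 ih.1, ih.2, pow_succ, mul_assoc]
    exact ⟨shuffleE1_mem_H1 ih.1, rfl⟩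

end PolylogSeries

/-! ### Multiple polylogarithms as functions on (-1, 1) -/

section Evaluation

/-- Convergence of a power series on the open unit interval. -/
def ConvergesOnUnit (f : PowerSeries ℝ) : Prop :=
  ∀ t : ℝ, |t| < 1 → Summable fun n => PowerSeries.coeff n f * t ^ n

/-- The sum of a power series at a point. -/
noncomputable def evalSeries (f : PowerSeries ℝ) (t : ℝ) : ℝ := ∑' n, PowerSeries.coeff n f * t ^ n

variable {f g : PowerSeries ℝ}

theorem convergesOnUnit_one : ConvergesOnUnit 1 := fun t _ =>
  summable_of_ne_finset_zero (s := {0}) fun n hn => by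
    rw [PowerSeries.coeff_one, if_neg (by simpa using hn), zero_mul]

theorem evalSeries_one (t : ℝ) : evalSeries 1 t = 1 := by
  rw [evalSeries, tsum_eq_single 0]
  · simp
  · intro n hn
    rw [PowerSeries.coeff_one, if_neg hn, zero_mul]

theorem coeff_mul_mul_pow_eq_sum (f g : PowerSeries ℝ) (t : ℝ) (n : ℕ) :
    PowerSeries.coeff n (f * g) * t ^ n = ∑ kl ∈ Finset.HasAntidiagonal.antidiagonal n,
      (PowerSeries.coeff kl.1 f * t ^ kl.1) * (PowerSeries.coeff kl.2 g * t ^ kl.2) := by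
  rw [PowerSeries.coeff_mul, Finset.sum_mul]
  refine Finset.sum_congr rfl fun kl h => ?_
  rw [← Finset.HasAntidiagonal.mem_antidiagonal.1 h, pow_add]
  ring

theorem ConvergesOnUnit.mul (hf : ConvergesOnUnit f) (hg : ConvergesOnUnit g) :
    ConvergesOnUnit (f * g) := fun t ht => by
  simp only [coeff_mul_mul_pow_eq_sum]
  exact (summable_norm_sum_mul_antidiagonal_of_summable_norm (hf t ht).norm (hg t ht).norm).of_norm

theorem ConvergesOnUnit.pow (hf : ConvergesOnUnit f) (i : ℕ) : ConvergesOnUnit (f ^ i) := by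
  induction i with
  | zero => simpa using convergesOnUnit_one
  | succ i ih => rw [pow_succ]; exact ih.mul hf

theorem ConvergesOnUnit.evalSeries_mul (hf : ConvergesOnUnit f) (hg : ConvergesOnUnit g) {t : ℝ}
    (ht : |t| < 1) : evalSeries (f * g) t = evalSeries f t * evalSeries g t := by
  simp only [evalSeries, coeff_mul_mul_pow_eq_sum]
  exact (tsum_mul_tsum_eq_tsum_sum_antidiagonal_of_summable_norm
    (hf t ht).norm (hg t ht).norm).symm

theorem ConvergesOnUnit.evalSeries_pow (hf : ConvergesOnUnit f) (i : ℕ) {t : ℝ} (ht : |t| < 1) :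
    evalSeries (f ^ i) t = evalSeries f t ^ i := by
  induction i with
  | zero => rw [pow_zero, pow_zero, evalSeries_one]
  | succ i ih => rw [pow_succ, (hf.pow i).evalSeries_mul hf ht, ih, pow_succ]

theorem convergesOnUnit_of_bounded {C : ℝ} (h : ∀ n, |PowerSeries.coeff n f| ≤ C) :
    ConvergesOnUnit f := fun t ht => by
  refine Summable.of_norm_bounded ((summable_geometric_of_lt_one (abs_nonneg t) ht).mul_left C)
    fun n => ?_
  rw [norm_mul, norm_pow, Real.norm_eq_abs, Real.norm_eq_abs]
  exact mul_le_mul_of_nonneg_right (h n) (by positivity)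

theorem hasDerivAt_evalSeries_of_bounded {C : ℝ} (h : ∀ n, |PowerSeries.coeff n f| ≤ C) {t : ℝ}
    (ht : |t| < 1) :
    HasDerivAt (evalSeries f) (∑' n : ℕ, PowerSeries.coeff n f * (n * t ^ (n - 1))) t := by
  obtain ⟨r, hr, hr1⟩ := exists_between ht
  have hr0 : 0 < r := (abs_nonneg t).trans_lt hr
  have hu : Summable fun n : ℕ => C * (n * r ^ (n - 1)) := by
    have := (summable_pow_mul_geometric_of_norm_lt_one 1
      (show ‖r‖ < 1 by rwa [Real.norm_eq_abs, abs_of_pos hr0])).mul_left (C * r⁻¹)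
    refine this.congr fun n => ?_
    rcases n with _ | n
    · simp
    · rw [Nat.add_sub_cancel, pow_succ]
      field_simp
      ring
  refine hasDerivAt_tsum_of_isPreconnected (t := Metric.ball 0 r)
    (g := fun n t => PowerSeries.coeff n f * t ^ n)
    (g' := fun n t => PowerSeries.coeff n f * (n * t ^ (n - 1))) (y₀ := t) hu Metric.isOpen_ball
    (convex_ball 0 r).isPreconnected ?_ ?_ ?_ (convergesOnUnit_of_bounded h t ht) ?_
  · intro n y _
    exact (hasDerivAt_pow n y).const_mul _
  · intro n y hy
    rw [mem_ball_zero_iff, Real.norm_eq_abs] at hy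
    rw [norm_mul, norm_mul, norm_pow, Real.norm_eq_abs, Real.norm_natCast, Real.norm_eq_abs]
    refine mul_le_mul (h n) ?_ (by positivity) ((abs_nonneg _).trans (h 0))
    gcongr
  · simpa using hr
  · simpa using hr

theorem wordCoeff_mem_Icc (w : List (Fin 2)) (n : ℕ) : wordCoeff w n ∈ Set.Icc (0 : ℝ) 1 := by
  induction w generalizing n with
  | nil => rw [wordCoeff]; split_ifs <;> simp
  | cons u w ih =>
    rcases Nat.eq_zero_or_pos n with rfl | hn
    · simp [wordCoeff]
    have hn' : (1 : ℝ) ≤ n := by exact_mod_cast hn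
    rw [wordCoeff]
    split_ifs
    · exact ⟨div_nonneg (ih n).1 (by positivity),
        div_le_one_of_le₀ ((ih n).2.trans hn') (by positivity)⟩
    · refine ⟨div_nonneg (Finset.sum_nonneg fun m _ => (ih m).1) (by positivity),
        div_le_one_of_le₀ ?_ (by positivity)⟩
      calc ∑ m ∈ Finset.range n, wordCoeff w m ≤ ∑ m ∈ Finset.range n, (1 : ℝ) :=
            Finset.sum_le_sum fun m _ => (ih m).2
        _ = n := by simp

theorem exists_bound_polylogSeries (x : NCPoly) :
    ∃ C, ∀ n, |PowerSeries.coeff n (polylogSeries x)| ≤ C := by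
  induction x using polylogSeries_induction with
  | hw w =>
    refine ⟨1, fun n => ?_⟩
    have := wordCoeff_mem_Icc w.reverse n
    rw [coeff_polylogSeries_word, abs_of_nonneg this.1]
    exact this.2
  | hadd x y hx hy =>
    obtain ⟨C, hC⟩ := hx
    obtain ⟨D, hD⟩ := hy
    refine ⟨C + D, fun n => ?_⟩
    rw [map_add, map_add]
    exact (abs_add_le _ _).trans (add_le_add (hC n) (hD n))
  | hsmul q x hx =>
    obtain ⟨C, hC⟩ := hx
    refine ⟨|(q : ℝ)| * C, fun n => ?_⟩
    rw [coeff_polylogSeries_smul, abs_mul]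
    exact mul_le_mul_of_nonneg_left (hC n) (abs_nonneg _)

theorem convergesOnUnit_polylogSeries (x : NCPoly) : ConvergesOnUnit (polylogSeries x) :=
  (exists_bound_polylogSeries x).elim fun _ h => convergesOnUnit_of_bounded h

/-- The multiple polylogarithm attached to an element of `ℚ⟨e₀, e₁⟩`. -/
noncomputable def polylog (x : NCPoly) : ℝ → ℝ := evalSeries (polylogSeries x)

theorem polylog_add (x y : NCPoly) {t : ℝ} (ht : |t| < 1) :
    polylog (x + y) t = polylog x t + polylog y t := by
  simp only [polylog, evalSeries, map_add, add_mul]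
  exact (convergesOnUnit_polylogSeries x t ht).tsum_add (convergesOnUnit_polylogSeries y t ht)

theorem polylog_smul (q : ℚ) (x : NCPoly) (t : ℝ) : polylog (q • x) t = q * polylog x t := by
  simp only [polylog, evalSeries, coeff_polylogSeries_smul, mul_assoc, tsum_mul_left]

theorem polylog_zero (t : ℝ) : polylog 0 t = 0 := by simp [polylog, evalSeries]

theorem polylog_one (t : ℝ) : polylog 1 t = 1 := by
  rw [polylog, polylogSeries_one, evalSeries_one]

theorem polylog_sum {ι : Type*} (s : Finset ι) (x : ι → NCPoly) {t : ℝ} (ht : |t| < 1) :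
    polylog (∑ i ∈ s, x i) t = ∑ i ∈ s, polylog (x i) t := by
  classical
  induction s using Finset.induction_on with
  | empty => simp [polylog_zero]
  | insert i s hi ih => rw [Finset.sum_insert hi, Finset.sum_insert hi, polylog_add _ _ ht, ih]

theorem polylog_letter_one {t : ℝ} (ht : |t| < 1) : polylog (letter 1) t = -Real.log (1 - t) := by
  rw [← (Real.hasSum_pow_div_log_of_abs_lt_one ht).tsum_eq, polylog, evalSeries,
    (convergesOnUnit_polylogSeries _ t ht).tsum_eq_zero_add]
  have h : ∀ n, PowerSeries.coeff n (polylogSeries (letter 1)) = if n = 0 then 0 else 1 / (n : ℝ) := by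
    intro n
    rw [← one_mul (letter 1), coeff_polylogSeries_mul_one, polylogSeries_one]
    rcases n with _ | n
    · simp
    · rw [Finset.sum_range_succ']
      simp [PowerSeries.coeff_one]
  rw [h 0, if_pos rfl, zero_mul, zero_add]
  refine tsum_congr fun n => ?_
  rw [h, if_neg (Nat.succ_ne_zero n)]
  push_cast
  ring

theorem polylog_shuffleE1_pow {x : NCPoly} (hx : x ∈ H1) (i : ℕ) {t : ℝ} (ht : |t| < 1) :
    polylog ((shuffleE1 ^ i) x) t = polylog x t * (-Real.log (1 - t)) ^ i := by
  rw [polylog, polylogSeries_shuffleE1_pow hx,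
    (convergesOnUnit_polylogSeries _).evalSeries_mul ((convergesOnUnit_polylogSeries _).pow i) ht,
    (convergesOnUnit_polylogSeries _).evalSeries_pow i ht, ← polylog_letter_one ht]
  rfl

theorem polylog_zero_right (x : NCPoly) :
    polylog x 0 = PowerSeries.constantCoeff (polylogSeries x) := by
  rw [polylog, evalSeries, tsum_eq_single 0]
  · simp
  · intro n hn
    simp [hn]

theorem hasDerivAt_polylog_mul_zero (x : NCPoly)
    (hx : PowerSeries.constantCoeff (polylogSeries x) = 0) {t : ℝ} (ht0 : t ≠ 0) (ht : |t| < 1) :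
    HasDerivAt (polylog (x * letter 0)) (polylog x t / t) t := by
  obtain ⟨C, hC⟩ := exists_bound_polylogSeries (x * letter 0)
  refine (hasDerivAt_evalSeries_of_bounded hC ht).congr_deriv (Eq.symm ?_)
  rw [div_eq_iff ht0, ← tsum_mul_right, polylog, evalSeries]
  refine tsum_congr fun n => ?_
  rcases n with _ | n
  · simpa using hx
  · rw [coeff_polylogSeries_mul_zero, Nat.add_sub_cancel, pow_succ]
    field_simp

theorem hasDerivAt_polylog_mul_one (x : NCPoly) {t : ℝ} (ht : |t| < 1) :
    HasDerivAt (polylog (x * letter 1)) (polylog x t / (1 - t)) t := by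
  obtain ⟨C, hC⟩ := exists_bound_polylogSeries (x * letter 1)
  have hd := hasDerivAt_evalSeries_of_bounded hC ht
  have e : ∑' n : ℕ, PowerSeries.coeff n (polylogSeries (x * letter 1)) * (n * t ^ (n - 1)) =
      evalSeries (polylogSeries x * PowerSeries.mk fun _ => (1 : ℝ)) t := by
    rw [← derivative_polylogSeries_mul_one, evalSeries]
    have hs : Summable fun n : ℕ =>
        PowerSeries.coeff n (polylogSeries (x * letter 1)) * (n * t ^ (n - 1)) := by
      rw [← summable_nat_add_iff 1]
      have hg : ConvergesOnUnit (PowerSeries.mk fun _ => (1 : ℝ)) :=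
        convergesOnUnit_of_bounded (C := 1) fun n => by simp
      have := (convergesOnUnit_polylogSeries x).mul hg t ht
      rw [← derivative_polylogSeries_mul_one] at this
      refine this.congr fun n => ?_
      rw [PowerSeries.coeff_derivative, Nat.add_sub_cancel]
      push_cast
      ring
    rw [hs.tsum_eq_zero_add]
    simp only [Nat.cast_zero, zero_mul, mul_zero, zero_add]
    refine tsum_congr fun n => ?_
    rw [PowerSeries.coeff_derivative, Nat.add_sub_cancel]
    push_cast
    ring
  have hg : ConvergesOnUnit (PowerSeries.mk fun _ => (1 : ℝ)) :=
    convergesOnUnit_of_bounded (C := 1) fun n => by simp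
  rw [e, (convergesOnUnit_polylogSeries x).evalSeries_mul hg ht] at hd
  refine hd.congr_deriv (Eq.symm ?_)
  rw [div_eq_mul_inv, ← tsum_geometric_of_abs_lt_one ht, polylog]
  congr 1
  simp [evalSeries]

end Evaluation

end FMZV

namespace FMZV

/-! ### Multiple zeta values as sums of polylogarithm coefficients -/

section NestedSeries

/-- For a nonempty index the n-th coefficient of Li_k collects the terms with largest variable n_r =
n, so partial sums of coefficients are truncated multiple zeta sums. -/
theorem sum_range_wordCoeff_indexWord (k : Index) (N : ℕ) (hN : 0 < N) :
    ∑ n ∈ Finset.range N, wordCoeff (indexWord k).reverse n =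
      nestLt (fun (j : ℕ+) (n : ℕ) => 1 / (n : ℝ) ^ (j : ℕ)) k 0 N := by
  have hrep : ∀ (j : ℕ) (w : List (Fin 2)) (n : ℕ),
      wordCoeff (List.replicate j 0 ++ w) n = wordCoeff w n / (n : ℝ) ^ j := by
    intro j w n
    induction j with
    | zero => simp
    | succ j ih =>
      rw [List.replicate_succ, List.cons_append, wordCoeff, if_pos rfl, ih, pow_succ, div_div]
  have happ : ∀ (ks : Index) (k : ℕ+), indexWord (ks ++ [k]) =
      indexWord ks ++ 1 :: List.replicate ((k : ℕ) - 1) 0 := by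
    intro ks k
    induction ks with
    | nil => simp [indexWord]
    | cons l ks ih => simp [indexWord, ih]
  induction k using List.reverseRecOn generalizing N with
  | nil =>
    obtain ⟨N, rfl⟩ : ∃ M, N = M + 1 := ⟨N - 1, by omega⟩
    rw [Finset.sum_range_succ']
    simp [indexWord, wordCoeff, nestLt]
  | append_singleton ks k ih =>
    rw [nestLt_append_cons, happ, List.reverse_append, List.reverse_cons, List.reverse_replicate,
      Finset.range_eq_Ico, Finset.sum_eq_sum_Ico_succ_bot hN]
    have h0 : wordCoeff (List.replicate ((k : ℕ) - 1) 0 ++ [1] ++ (indexWord ks).reverse) 0 = 0 := by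
      rw [List.append_assoc, hrep]
      simp [wordCoeff]
    rw [h0, zero_add]
    refine Finset.sum_congr (by ext; simp [Nat.succ_le_iff]) fun n hn => ?_
    rw [Finset.mem_Ioo] at hn
    rw [List.append_assoc, hrep, List.singleton_append, wordCoeff, if_neg (by decide), ih n hn.1,
      div_div, ← pow_succ', Nat.sub_add_cancel k.pos, nestLt]
    ring

/-- All terms are nonnegative and the boxes [0,N)^r exhaust the tuples, so convergence of the
truncations already gives unconditional summability. -/
theorem mzv_eq_of_tendsto {k : Index} {c : ℝ}
    (h : Filter.Tendsto (fun N => nestLt (fun (j : ℕ+) (n : ℕ) => 1 / (n : ℝ) ^ (j : ℕ)) k 0 N)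
      Filter.atTop (nhds c)) : mzv k = c := by
  classical
  let f : (Fin k.length → ℕ) → ℝ := fun m =>
    if StrictMono m ∧ ∀ i, 0 < m i then ∏ i, 1 / (m i : ℝ) ^ (k.get i : ℕ) else 0
  let e : {m : Fin k.length → ℕ+ // StrictMono m} → (Fin k.length → ℕ) := fun m i => m.1 i
  have he : Function.Injective e := fun m m' hm =>
    Subtype.ext (funext fun i => PNat.coe_injective (congrFun hm i))
  have hf0 : ∀ m, 0 ≤ f m := fun m => by
    simp only [f]
    split_ifs
    · positivity
    · exact le_rfl
  let S : ℕ → Finset (Fin k.length → ℕ) := fun N => Fintype.piFinset fun _ => Finset.range N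
  have hSmono : Monotone S := fun M N hMN =>
    Fintype.piFinset_subset _ _ fun _ => Finset.range_subset_range.2 hMN
  have hSex : ∀ m, ∃ N, m ∈ S N := fun m =>
    ⟨Finset.univ.sup m + 1, Fintype.mem_piFinset.2 fun i =>
      Finset.mem_range.2 (Nat.lt_succ_of_le (Finset.le_sup (Finset.mem_univ i)))⟩
  have hsum : ∀ N, ∑ m ∈ S N, f m =
      nestLt (fun (j : ℕ+) (n : ℕ) => 1 / (n : ℝ) ^ (j : ℕ)) k 0 N := by
    intro N
    rw [← sum_filter_strictMono_eq_nestLt, ← Finset.sum_filter]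
    refine Finset.sum_congr ?_ fun _ _ => rfl
    ext m
    simp only [S, Finset.mem_filter, Fintype.mem_piFinset, Finset.mem_range, Finset.mem_Ioo]
    exact ⟨fun h => ⟨fun i => ⟨h.2.2 i, h.1 i⟩, h.2.1⟩, fun h => ⟨fun i => (h.1 i).2, h.2,
      fun i => (h.1 i).1⟩⟩
  have hlim : Filter.Tendsto (fun N => ∑ m ∈ S N, f m) Filter.atTop (nhds c) := by
    simpa only [hsum] using h
  have hle : ∀ N, ∑ m ∈ S N, f m ≤ c := fun N =>
    Monotone.ge_of_tendsto (fun M N hMN => Finset.sum_le_sum_of_subset_of_nonneg (hSmono hMN)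
      fun m _ _ => hf0 m) hlim N
  have hsm : Summable f := by
    refine summable_of_sum_le hf0 (c := c) fun u => ?_
    choose g hg using hSex
    refine le_trans (Finset.sum_le_sum_of_subset_of_nonneg (t := S (u.sup g)) ?_
      fun m _ _ => hf0 m) (hle _)
    intro m hm
    exact hSmono (Finset.le_sup hm) (hg m)
  have hfc : HasSum f c := by
    have := hsm.hasSum.comp (Filter.tendsto_atTop_finset_of_monotone hSmono hSex)
    rw [tendsto_nhds_unique hlim this]
    exact hsm.hasSum
  rw [← he.hasSum_iff] at hfc
  · rw [mzv, ← hfc.tsum_eq]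
    refine tsum_congr fun m => ?_
    have : StrictMono (e m) ∧ ∀ i, 0 < e m i := ⟨fun i j hij => m.2 hij, fun i => (m.1 i).pos⟩
    simp only [Function.comp_apply, f, if_pos this]
    rfl
  · intro m hm
    simp only [f]
    rw [if_neg]
    rintro ⟨h1, h2⟩
    exact hm ⟨⟨fun i => ⟨m i, h2 i⟩, fun i j hij => h1 hij⟩, rfl⟩

theorem mzv_eq_tsum {k : Index} (h : Summable (wordCoeff (indexWord k).reverse)) :
    mzv k = ∑' n, wordCoeff (indexWord k).reverse n := by
  refine mzv_eq_of_tendsto (h.hasSum.tendsto_sum_nat.congr' ?_)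
  filter_upwards [Filter.eventually_gt_atTop 0] with N hN
  exact sum_range_wordCoeff_indexWord k N hN

end NestedSeries

/-! ### Coefficient bounds and the rate of convergence at t = 1 -/

section CoefficientBounds

theorem sum_range_inv_sqrt_le (n : ℕ) :
    ∑ m ∈ Finset.range (n + 1), 1 / √(m : ℝ) ≤ 2 * √(n : ℝ) := by
  induction n with
  | zero => simp
  | succ n ih =>
    rw [Finset.sum_range_succ]
    have h1 : (0 : ℝ) < √((n + 1 : ℕ) : ℝ) := Real.sqrt_pos.2 (by positivity)
    have h2 := Real.sq_sqrt (show (0 : ℝ) ≤ ((n + 1 : ℕ) : ℝ) by positivity)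
    have h3 := Real.sq_sqrt (show (0 : ℝ) ≤ (n : ℝ) by positivity)
    have h4 := Real.sqrt_nonneg (n : ℝ)
    have : 1 / √((n + 1 : ℕ) : ℝ) ≤ 2 * √((n + 1 : ℕ) : ℝ) - 2 * √(n : ℝ) := by
      rw [div_le_iff₀ h1]
      push_cast at *
      nlinarith [sq_nonneg (√((n : ℝ) + 1) - √(n : ℝ))]
    linarith

/-- The bound n^(-1/2) is a crude substitute for log(n)^k / n; it is stable under prepending either
letter, since ∑_{m<n} m^(-1/2) ≤ 2 n^(1/2). -/
theorem exists_wordCoeff_le (u : Fin 2) (w : List (Fin 2)) :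
    ∃ C, 0 ≤ C ∧ ∀ n, wordCoeff (u :: w) n ≤ C / √(n : ℝ) := by
  induction w generalizing u with
  | nil =>
    refine ⟨1, zero_le_one, fun n => ?_⟩
    rcases Nat.eq_zero_or_pos n with rfl | hn
    · simp [wordCoeff]
    have hn1 : (1 : ℝ) ≤ n := by exact_mod_cast hn
    rw [wordCoeff]
    split_ifs
    · rw [wordCoeff, if_neg hn.ne', zero_div]
      positivity
    · have : ∑ m ∈ Finset.range n, wordCoeff [] m = 1 := by
        obtain ⟨N, rfl⟩ : ∃ M, n = M + 1 := ⟨n - 1, by omega⟩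
        rw [Finset.sum_range_succ']
        simp [wordCoeff]
      rw [this]
      exact one_div_le_one_div_of_le (Real.sqrt_pos.2 (by positivity))
        (Real.sqrt_le_iff.2 ⟨by positivity, by nlinarith⟩)
  | cons v w ih =>
    obtain ⟨C, hC0, hC⟩ := ih v
    refine ⟨2 * C, by positivity, fun n => ?_⟩
    rcases Nat.eq_zero_or_pos n with rfl | hn
    · simp [wordCoeff]
    have hn1 : (1 : ℝ) ≤ n := by exact_mod_cast hn
    have hs : (0 : ℝ) < √(n : ℝ) := Real.sqrt_pos.2 (by positivity)
    rw [wordCoeff]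
    split_ifs
    · calc wordCoeff (v :: w) n / n ≤ wordCoeff (v :: w) n / 1 :=
            div_le_div_of_nonneg_left (wordCoeff_mem_Icc _ _).1 one_pos hn1
        _ ≤ C / √(n : ℝ) := by rw [div_one]; exact hC n
        _ ≤ 2 * C / √(n : ℝ) := by gcongr; linarith
    · obtain ⟨N, rfl⟩ : ∃ M, n = M + 1 := ⟨n - 1, by omega⟩
      rw [div_le_div_iff₀ (by positivity) hs]
      have h1 : ∑ m ∈ Finset.range (N + 1), wordCoeff (v :: w) m ≤ C * (2 * √((N + 1 : ℕ) : ℝ)) := by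
        calc ∑ m ∈ Finset.range (N + 1), wordCoeff (v :: w) m
            ≤ ∑ m ∈ Finset.range (N + 1), C * (1 / √(m : ℝ)) :=
              Finset.sum_le_sum fun m _ => (hC m).trans (by rw [mul_one_div])
          _ ≤ C * (2 * √(N : ℝ)) := by
              rw [← Finset.mul_sum]
              exact mul_le_mul_of_nonneg_left (sum_range_inv_sqrt_le N) hC0
          _ ≤ C * (2 * √((N + 1 : ℕ) : ℝ)) := by
              gcongr
              exact Nat.le_succ N
      have h2 := Real.mul_self_sqrt (show (0 : ℝ) ≤ ((N + 1 : ℕ) : ℝ) by positivity)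
      nlinarith

theorem exists_wordCoeff_zero_cons_le (u : Fin 2) (w : List (Fin 2)) :
    ∃ C, 0 ≤ C ∧ ∀ n : ℕ, wordCoeff (0 :: u :: w) n ≤ C * ((n : ℝ) ^ (3 / 2 : ℝ))⁻¹ := by
  obtain ⟨C, hC0, hC⟩ := exists_wordCoeff_le u w
  refine ⟨C, hC0, fun n => ?_⟩
  rcases Nat.eq_zero_or_pos n with rfl | hn
  · simp [wordCoeff]
  have hn0 : (0 : ℝ) < n := by exact_mod_cast hn
  rw [wordCoeff, if_pos rfl, show (3 / 2 : ℝ) = 1 + 1 / 2 by norm_num, Real.rpow_add hn0,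
    Real.rpow_one, ← Real.sqrt_eq_rpow, ← div_eq_mul_inv, mul_comm (n : ℝ), ← div_div]
  exact div_le_div_of_nonneg_right (hC n) hn0.le

theorem summable_wordCoeff_zero_cons (u : Fin 2) (w : List (Fin 2)) :
    Summable (wordCoeff (0 :: u :: w)) := by
  obtain ⟨C, hC0, hC⟩ := exists_wordCoeff_zero_cons_le u w
  exact Summable.of_nonneg_of_le (fun n => (wordCoeff_mem_Icc _ n).1) hC
    ((Real.summable_nat_rpow_inv.2 (by norm_num)).mul_left C)

/-- Abel's theorem with a power saving, needed because errors must beat every power of log(1-t). -/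
theorem exists_tsum_wordCoeff_sub_le (u : Fin 2) (w : List (Fin 2)) :
    ∃ C, ∀ t : ℝ, 0 ≤ t → t < 1 →
      |(∑' n, wordCoeff (0 :: u :: w) n * t ^ n) - ∑' n, wordCoeff (0 :: u :: w) n| ≤
        C * (1 - t) ^ (1 / 4 : ℝ) := by
  obtain ⟨C, hC0, hC⟩ := exists_wordCoeff_zero_cons_le u w
  have hsum := summable_wordCoeff_zero_cons u w
  have hS : Summable fun n : ℕ => C * ((n : ℝ) ^ (5 / 4 : ℝ))⁻¹ :=
    (Real.summable_nat_rpow_inv.2 (by norm_num)).mul_left C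
  refine ⟨∑' n : ℕ, C * ((n : ℝ) ^ (5 / 4 : ℝ))⁻¹, fun t ht0 ht1 => ?_⟩
  have hst : Summable fun n => wordCoeff (0 :: u :: w) n * t ^ n :=
    Summable.of_nonneg_of_le
      (fun n => mul_nonneg (wordCoeff_mem_Icc _ n).1 (pow_nonneg ht0 n))
      (fun n => mul_le_of_le_one_right (wordCoeff_mem_Icc _ n).1 (pow_le_one₀ ht0 ht1.le)) hsum
  rw [← hst.tsum_sub hsum, ← tsum_mul_right]
  have hbd : ∀ n, |wordCoeff (0 :: u :: w) n * t ^ n - wordCoeff (0 :: u :: w) n| ≤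
      C * ((n : ℝ) ^ (5 / 4 : ℝ))⁻¹ * (1 - t) ^ (1 / 4 : ℝ) := by
    intro n
    rcases Nat.eq_zero_or_pos n with rfl | hn
    · simp [wordCoeff]
    have hn0 : (0 : ℝ) < n := by exact_mod_cast hn
    have ht' : 0 < 1 - t := by linarith
    have hp1 : t ^ n ≤ 1 := pow_le_one₀ ht0 ht1.le
    have hp0 : 0 ≤ t ^ n := pow_nonneg ht0 n
    -- Interpolate between the bounds n(1-t) and 1. The exponent 1/4 spends n^(1/4) of the decay
    -- n^(-3/2) and leaves the summable n^(-5/4).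
    have h1 : 1 - t ^ n ≤ (n * (1 - t)) ^ (1 / 4 : ℝ) := by
      have hb : 1 - t ^ n ≤ n * (1 - t) := by
        have := one_add_mul_le_pow (show (-2 : ℝ) ≤ t - 1 by linarith) n
        rw [show 1 + (t - 1) = t by ring] at this
        linarith
      rcases le_total 1 ((n : ℝ) * (1 - t)) with hc | hc
      · exact (show 1 - t ^ n ≤ 1 by linarith).trans (Real.one_le_rpow hc (by norm_num))
      · refine hb.trans ?_
        have := Real.rpow_le_rpow_of_exponent_ge (mul_pos hn0 ht') hc
          (show (1 / 4 : ℝ) ≤ 1 by norm_num)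
        rwa [Real.rpow_one] at this
    rw [show wordCoeff (0 :: u :: w) n * t ^ n - wordCoeff (0 :: u :: w) n =
      -(wordCoeff (0 :: u :: w) n * (1 - t ^ n)) by ring, abs_neg,
      abs_of_nonneg (mul_nonneg (wordCoeff_mem_Icc _ n).1 (by linarith))]
    calc wordCoeff (0 :: u :: w) n * (1 - t ^ n)
        ≤ C * ((n : ℝ) ^ (3 / 2 : ℝ))⁻¹ * (n * (1 - t)) ^ (1 / 4 : ℝ) :=
          mul_le_mul (hC n) h1 (by linarith) (by positivity)
      _ = C * ((n : ℝ) ^ (5 / 4 : ℝ))⁻¹ * (1 - t) ^ (1 / 4 : ℝ) := by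
          rw [Real.mul_rpow hn0.le ht'.le, show (3 / 2 : ℝ) = 5 / 4 + 1 / 4 by norm_num,
            Real.rpow_add hn0]
          field_simp
  rw [← Real.norm_eq_abs]
  exact tsum_of_norm_bounded (hS.mul_right _).hasSum hbd

end CoefficientBounds

end FMZV

namespace FMZV

/-! ### Asymptotic expansions in powers of -log(1 - t) -/

section LogExpansion

/-- `F t = P (-log (1 - t)) + o((log (1 - t)) ^ (-N))` for all `N` as `t → 1` from the left. -/
def HasLogExpansion (F : ℝ → ℝ) (P : Polynomial ℝ) : Prop :=
  ∀ N : ℕ, Filter.Tendsto (fun t => (F t - P.eval (-Real.log (1 - t))) * (-Real.log (1 - t)) ^ N)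
    (nhdsWithin 1 (Set.Iio 1)) (nhds 0)

theorem tendsto_one_sub_nhdsGT_zero :
    Filter.Tendsto (fun t : ℝ => 1 - t) (nhdsWithin 1 (Set.Iio 1)) (nhdsWithin 0 (Set.Ioi 0)) := by
  refine tendsto_nhdsWithin_iff.2 ⟨?_, ?_⟩
  · have : Filter.Tendsto (fun t : ℝ => 1 - t) (nhds 1) (nhds (1 - 1)) :=
      (continuous_const.sub continuous_id).tendsto 1
    rw [sub_self] at this
    exact this.mono_left nhdsWithin_le_nhds
  · filter_upwards [self_mem_nhdsWithin] with t ht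
    exact sub_pos.2 (Set.mem_Iio.1 ht)

theorem tendsto_neg_log_one_sub_atTop :
    Filter.Tendsto (fun t : ℝ => -Real.log (1 - t)) (nhdsWithin 1 (Set.Iio 1)) Filter.atTop :=
  Filter.tendsto_neg_atBot_atTop.comp
    (Real.tendsto_log_nhdsGT_zero.comp tendsto_one_sub_nhdsGT_zero)

theorem tendsto_rpow_mul_log_pow {δ : ℝ} (hδ : 0 < δ) (N : ℕ) :
    Filter.Tendsto (fun t : ℝ => (1 - t) ^ δ * (-Real.log (1 - t)) ^ N)
      (nhdsWithin 1 (Set.Iio 1)) (nhds 0) := by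
  have h0 : Filter.Tendsto (fun x : ℝ => x ^ δ * (-Real.log x) ^ N) (nhdsWithin 0 (Set.Ioi 0))
      (nhds 0) := by
    have hd : 0 < δ / (N + 1) := by positivity
    have h1 := ((tendsto_log_mul_rpow_nhdsGT_zero hd).neg.pow N)
    have h2 : Filter.Tendsto (fun x : ℝ => x ^ (δ / (N + 1))) (nhdsWithin 0 (Set.Ioi 0))
        (nhds 0) := by
      have := (Real.continuousAt_rpow_const 0 (δ / (N + 1)) (Or.inr hd.le)).tendsto
      rw [Real.zero_rpow hd.ne'] at this
      exact this.mono_left nhdsWithin_le_nhds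
    have h3 := h2.mul h1
    rw [zero_mul] at h3
    refine h3.congr' ?_
    filter_upwards [self_mem_nhdsWithin] with x hx
    have hx0 : (0 : ℝ) < x := hx
    have e : x ^ δ = x ^ (δ / (N + 1)) * (x ^ (δ / (N + 1))) ^ N := by
      rw [← pow_succ', ← Real.rpow_mul_natCast hx0.le]
      congr 1
      push_cast
      field_simp
    rw [e, mul_assoc, ← mul_pow]
    congr 2
    ring
  exact h0.comp tendsto_one_sub_nhdsGT_zero

theorem HasLogExpansion.of_bound {F : ℝ → ℝ} {P : Polynomial ℝ} {C δ : ℝ} (hδ : 0 < δ)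
    (h : ∀ᶠ t in nhdsWithin 1 (Set.Iio 1),
      |F t - P.eval (-Real.log (1 - t))| ≤ C * (1 - t) ^ δ) : HasLogExpansion F P := by
  intro N
  have h1 := (tendsto_rpow_mul_log_pow hδ N).const_mul C
  rw [mul_zero] at h1
  refine squeeze_zero_norm' ?_ h1
  filter_upwards [h, tendsto_neg_log_one_sub_atTop.eventually_ge_atTop 0] with t ht hl
  rw [norm_mul, norm_pow, Real.norm_eq_abs, Real.norm_eq_abs, abs_of_nonneg hl, ← mul_assoc]
  exact mul_le_mul_of_nonneg_right ht (by positivity)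

theorem HasLogExpansion.congr {F G : ℝ → ℝ} {P : Polynomial ℝ} (hF : HasLogExpansion F P)
    (h : ∀ᶠ t in nhdsWithin 1 (Set.Iio 1), F t = G t) : HasLogExpansion G P := fun N =>
  (hF N).congr' (h.mono fun t ht => by rw [ht])

theorem hasLogExpansion_eval (P : Polynomial ℝ) :
    HasLogExpansion (fun t => P.eval (-Real.log (1 - t))) P := fun N => by
  simp

theorem HasLogExpansion.add {F G : ℝ → ℝ} {P Q : Polynomial ℝ} (hF : HasLogExpansion F P)
    (hG : HasLogExpansion G Q) : HasLogExpansion (fun t => F t + G t) (P + Q) := fun N => by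
  have := (hF N).add (hG N)
  rw [add_zero] at this
  refine this.congr fun t => ?_
  rw [Polynomial.eval_add]
  ring

theorem HasLogExpansion.const_mul {F : ℝ → ℝ} {P : Polynomial ℝ} (hF : HasLogExpansion F P)
    (c : ℝ) : HasLogExpansion (fun t => c * F t) (Polynomial.C c * P) := fun N => by
  have := (hF N).const_mul c
  rw [mul_zero] at this
  refine this.congr fun t => ?_
  rw [Polynomial.eval_mul, Polynomial.eval_C]
  ring

theorem HasLogExpansion.sum {ι : Type*} (s : Finset ι) {F : ι → ℝ → ℝ} {P : ι → Polynomial ℝ}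
    (h : ∀ i ∈ s, HasLogExpansion (F i) (P i)) :
    HasLogExpansion (fun t => ∑ i ∈ s, F i t) (∑ i ∈ s, P i) := by
  classical
  induction s using Finset.induction_on with
  | empty => simpa using hasLogExpansion_eval 0
  | insert i s hi ih =>
    have := (h i (Finset.mem_insert_self i s)).add
      (ih fun j hj => h j (Finset.mem_insert_of_mem hj))
    simpa only [Finset.sum_insert hi] using this

/-- Errors smaller than every power of the logarithm stay so after multiplication by a polynomial in
it; this is what makes expansions multiplicative. -/
theorem tendsto_eval_mul_of_forall_pow {E : ℝ → ℝ} (hE : ∀ N : ℕ, Filter.Tendsto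
    (fun t => E t * (-Real.log (1 - t)) ^ N) (nhdsWithin 1 (Set.Iio 1)) (nhds 0))
    (P : Polynomial ℝ) (N : ℕ) : Filter.Tendsto
      (fun t => E t * P.eval (-Real.log (1 - t)) * (-Real.log (1 - t)) ^ N)
      (nhdsWithin 1 (Set.Iio 1)) (nhds 0) := by
  induction P using Polynomial.induction_on' with
  | add p q hp hq =>
    have := hp.add hq
    rw [add_zero] at this
    refine this.congr fun t => ?_
    rw [Polynomial.eval_add]
    ring
  | monomial n a =>
    have := (hE (n + N)).const_mul a
    rw [mul_zero] at this
    refine this.congr fun t => ?_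
    rw [Polynomial.eval_monomial, pow_add]
    ring

theorem HasLogExpansion.mul {F G : ℝ → ℝ} {P Q : Polynomial ℝ} (hF : HasLogExpansion F P)
    (hG : HasLogExpansion G Q) : HasLogExpansion (fun t => F t * G t) (P * Q) := fun N => by
  have h0 : Filter.Tendsto (fun t => F t - P.eval (-Real.log (1 - t)))
      (nhdsWithin 1 (Set.Iio 1)) (nhds 0) := by simpa using hF 0
  have h1 := h0.mul (hG N)
  have h2 := tendsto_eval_mul_of_forall_pow hF Q N
  have h3 := tendsto_eval_mul_of_forall_pow hG P N
  have := (h1.add h2).add h3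
  rw [zero_mul, add_zero, add_zero] at this
  refine this.congr fun t => ?_
  rw [Polynomial.eval_mul]
  ring

theorem HasLogExpansion.eval {F : ℝ → ℝ} {P : Polynomial ℝ} (hF : HasLogExpansion F P)
    (Q : Polynomial ℝ) : HasLogExpansion (fun t => Q.eval (F t)) (Q.comp P) := by
  have hpow : ∀ n : ℕ, HasLogExpansion (fun t => F t ^ n) (P ^ n) := by
    intro n
    induction n with
    | zero => simpa using hasLogExpansion_eval 1
    | succ n ih => simpa only [pow_succ] using ih.mul hF
  induction Q using Polynomial.induction_on' with
  | add p q hp hq => simpa only [Polynomial.eval_add, Polynomial.add_comp] using hp.add hq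
  | monomial n a =>
    simpa only [Polynomial.eval_monomial, Polynomial.monomial_comp] using (hpow n).const_mul a

/-- The difference of the polynomials tends to 0 as its argument tends to infinity, so it is neither
a nonzero constant nor of positive degree. -/
theorem HasLogExpansion.unique {F : ℝ → ℝ} {P Q : Polynomial ℝ} (hP : HasLogExpansion F P)
    (hQ : HasLogExpansion F Q) : P = Q := by
  have h := (hQ 0).sub (hP 0)
  simp only [pow_zero, mul_one, sub_self, sub_sub_sub_cancel_left] at h
  by_contra hne
  have hne' : P - Q ≠ 0 := sub_ne_zero.2 hne
  rcases le_or_gt (P - Q).degree 0 with hd | hd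
  · rw [Polynomial.degree_le_zero_iff] at hd
    have h' : Filter.Tendsto (fun _ : ℝ => (P - Q).coeff 0) (nhdsWithin (1 : ℝ) (Set.Iio 1))
        (nhds 0) := by
      refine h.congr fun t => ?_
      rw [← Polynomial.eval_sub, hd, Polynomial.eval_C, Polynomial.coeff_C_zero]
    have := tendsto_nhds_unique h' tendsto_const_nhds
    rw [← this, Polynomial.C_0] at hd
    exact hne' hd
  · have h1 := (Polynomial.abs_tendsto_atTop (P - Q) hd).comp tendsto_neg_log_one_sub_atTop
    refine not_tendsto_nhds_of_tendsto_atTop h1 |0| (h.abs.congr fun t => ?_)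
    rw [← Polynomial.eval_sub]
    rfl

end LogExpansion

/-! ### Shuffle regularized values as constant terms -/

section Regularization

/-- A word from e₁ to e₀ belongs to an admissible index, so its series converges at t = 1 to the
multiple zeta value, with a power saving; the expansion is a constant. -/
theorem hasLogExpansion_polylog_word (u : Fin 2) (w : List (Fin 2)) (hu : u = 1) :
    HasLogExpansion (polylog (word (u :: w) * letter 0))
      (Polynomial.C ((ZMap (word (u :: w) * letter 0) : MZVAlg) : ℝ)) := by
  subst hu
  have hrev : ∃ v l, (1 :: w).reverse = v :: l := by
    rcases h : (1 :: w).reverse with _ | ⟨v, l⟩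
    · simp at h
    · exact ⟨v, l, rfl⟩
  obtain ⟨v, l, hvl⟩ := hrev
  obtain ⟨j, k, hk⟩ := exists_indexWord_eq (1 :: (w ++ [0]))
  obtain rfl : j = 0 := by
    rcases j with _ | j
    · rfl
    · rw [List.replicate_succ, List.cons_append] at hk
      exact absurd (List.cons.inj hk).1 (by decide)
  rw [List.replicate_zero, List.nil_append] at hk
  have hk' : (indexWord k).reverse = 0 :: v :: l := by
    rw [← hk, ← List.cons_append, List.reverse_append, hvl]
    rfl
  have hadm : k.Admissible := by
    intro hne
    by_contra hlt
    have h1 : k.getLast hne = 1 := PNat.coe_injective (by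
      have := (k.getLast hne).pos
      have h2 : ((k.getLast hne : ℕ+) : ℕ) < 2 := by
        rw [not_le] at hlt
        exact_mod_cast hlt
      rw [PNat.one_coe]
      omega)
    have happ : ∀ ks : Index, indexWord (ks ++ [1]) = indexWord ks ++ [1] := by
      intro ks
      induction ks with
      | nil => rfl
      | cons l ks ih => simp [indexWord, ih]
    rw [← List.dropLast_append_getLast hne, h1, happ, List.reverse_append] at hk'
    exact absurd (List.cons.inj hk').1 (by decide)
  have hx : word (1 :: w) * letter 0 = word (indexWord k) := by
    rw [← hk, ← word_singleton 0, ← word_append, List.cons_append]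
  have hsm : Summable (wordCoeff (indexWord k).reverse) := by
    rw [hk']; exact summable_wordCoeff_zero_cons v l
  have hZ : ((ZMap (word (1 :: w) * letter 0) : MZVAlg) : ℝ) =
      ∑' n, wordCoeff (0 :: v :: l) n := by
    rw [hx, ZMap_word, readWord_indexWord, mzvZ, dif_pos hadm]
    change mzv k = _
    rw [mzv_eq_tsum hsm, hk']
  obtain ⟨C, hC⟩ := exists_tsum_wordCoeff_sub_le v l
  refine HasLogExpansion.of_bound (C := C) (δ := 1 / 4) (by norm_num) ?_
  filter_upwards [self_mem_nhdsWithin, mem_nhdsWithin_of_mem_nhds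
    (Ioi_mem_nhds (show (0 : ℝ) < 1 by norm_num))] with t ht1 ht0
  rw [Polynomial.eval_C, hZ, hx, polylog, evalSeries]
  simp only [coeff_polylogSeries_word, hk']
  exact hC t (le_of_lt ht0) ht1

theorem eventually_abs_lt_one : ∀ᶠ t : ℝ in nhdsWithin 1 (Set.Iio 1), |t| < 1 := by
  filter_upwards [self_mem_nhdsWithin, mem_nhdsWithin_of_mem_nhds
    (Ioi_mem_nhds (show (0 : ℝ) < 1 by norm_num))] with t ht1 ht0
  rw [abs_of_pos ht0]
  exact ht1

theorem hasLogExpansion_polylog_of_mem_H0 {x : NCPoly} (hx : x ∈ H0) :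
    HasLogExpansion (polylog x) (Polynomial.C ((ZMap x : MZVAlg) : ℝ)) := by
  obtain ⟨y, hy, z, hz, rfl⟩ := Submodule.mem_sup.1 hx
  obtain ⟨q, rfl⟩ := Submodule.mem_one.1 hy
  obtain ⟨z, rfl⟩ := hz
  have hadd : ∀ x y, HasLogExpansion (polylog x) (Polynomial.C ((ZMap x : MZVAlg) : ℝ)) →
      HasLogExpansion (polylog y) (Polynomial.C ((ZMap y : MZVAlg) : ℝ)) →
      HasLogExpansion (polylog (x + y)) (Polynomial.C ((ZMap (x + y) : MZVAlg) : ℝ)) := by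
    intro x y hx hy
    have := (hx.add hy).congr (G := polylog (x + y)) (eventually_abs_lt_one.mono fun t ht =>
      (polylog_add x y ht).symm)
    rwa [← Polynomial.C_add, ← Subalgebra.coe_add, ← map_add] at this
  have hsmul : ∀ (q : ℚ) x, HasLogExpansion (polylog x) (Polynomial.C ((ZMap x : MZVAlg) : ℝ)) →
      HasLogExpansion (polylog (q • x)) (Polynomial.C ((ZMap (q • x) : MZVAlg) : ℝ)) := by
    intro q x hx
    have := (hx.const_mul (q : ℝ)).congr (G := polylog (q • x)) (Filter.Eventually.of_forall
      fun t => (polylog_smul q x t).symm)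
    rwa [← Polynomial.C_mul, show (q : ℝ) * ((ZMap x : MZVAlg) : ℝ) =
      ((ZMap (q • x) : MZVAlg) : ℝ) by
        rw [map_smul, Subalgebra.coe_smul, ← algebraMap_smul ℝ q ((ZMap x : MZVAlg) : ℝ)]
        simp] at this
  refine hadd _ _ ?_ ?_
  · rw [Algebra.algebraMap_eq_smul_one]
    refine hsmul _ _ ?_
    have hadm : Index.Admissible [] := fun h => absurd rfl h
    have h1 : ((ZMap 1 : MZVAlg) : ℝ) = 1 := by
      rw [← word_nil, ZMap_word]
      change ((mzvZ [] : MZVAlg) : ℝ) = 1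
      rw [mzvZ, dif_pos hadm]
      change mzv [] = 1
      rw [mzv_eq_of_tendsto (c := 1)]
      exact tendsto_const_nhds
    rw [h1]
    refine (hasLogExpansion_eval (Polynomial.C 1)).congr (Filter.Eventually.of_forall fun t => ?_)
    rw [polylog_one, Polynomial.eval_C]
  · simp only [LinearMap.comp_apply, LinearMap.mulLeft_apply, LinearMap.mulRight_apply]
    clear hx hy
    induction z using polylogSeries_induction with
    | hw w => rw [← mul_assoc, ← word_cons]; exact hasLogExpansion_polylog_word 1 w rfl
    | hadd x y hx hy =>
      rw [add_mul, mul_add]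
      exact hadd _ _ hx hy
    | hsmul q x hx =>
      rw [smul_mul_assoc, mul_smul_comm]
      exact hsmul _ _ hx

/-- The constant term of the expansion of `Li_k` at `1` is the shuffle regularized value. -/
theorem exists_hasLogExpansion_eIndex (k : Index) :
    ∃ P, HasLogExpansion (polylog (eIndex k)) P ∧ P.coeff 0 = ((mzvSh k : MZVAlg) : ℝ) := by
  obtain ⟨c, hc, hk⟩ := exists_mzvSh_eq k
  obtain ⟨hc0, hce⟩ := (isShuffleExpansion_iff _ _).1 hc
  -- Shuffling i times with e₁ multiplies by (-log(1-t))^i, so the term c_i contributes Z(c_i) X^i,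
  -- and the constant term is Z(c_0).
  refine ⟨∑ i ∈ c.support, Polynomial.C ((ZMap (c i) : MZVAlg) : ℝ) * Polynomial.X ^ i, ?_, ?_⟩
  · have : ∀ i ∈ c.support, HasLogExpansion
        (fun t => polylog (c i) t * (-Real.log (1 - t)) ^ i)
        (Polynomial.C ((ZMap (c i) : MZVAlg) : ℝ) * Polynomial.X ^ i) := by
      intro i _
      refine (hasLogExpansion_polylog_of_mem_H0 (hc0 i)).mul
        ((hasLogExpansion_eval (Polynomial.X ^ i)).congr (Filter.Eventually.of_forall fun t => ?_))
      simp
    refine (HasLogExpansion.sum _ this).congr (eventually_abs_lt_one.mono fun t ht => ?_)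
    rw [hce, Finsupp.sum, polylog_sum _ _ ht]
    exact Finset.sum_congr rfl fun i _ =>
      (polylog_shuffleE1_pow (H0_le_H1 (hc0 i)) i ht).symm
  · rw [hk, Polynomial.finsetSum_coeff]
    simp only [Polynomial.coeff_C_mul, Polynomial.coeff_X_pow]
    rw [Finset.sum_eq_single 0]
    · simp
    · intro i _ hi
      rw [if_neg hi.symm, mul_zero]
    · intro h
      rw [Finsupp.notMem_support_iff.1 h]
      simp

end Regularization

end FMZV

namespace FMZV

/-! ### Duality between ({1}^(s-1), 2) and (s + 1) by a connected sum -/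

section Duality

theorem hasSum_of_hasSum_fiberwise {α β : Type*} {f : α → β → ℝ} (hf : ∀ a b, 0 ≤ f a b)
    {g : β → ℝ} {h : α → ℝ} {c : ℝ} (hg : ∀ b, HasSum (fun a => f a b) (g b)) (hc : HasSum g c)
    (hh : ∀ a, HasSum (f a) (h a)) : HasSum h c := by
  have hs : Summable (fun p : β × α => f p.2 p.1) := by
    refine (summable_prod_of_nonneg fun p => hf _ _).2 ⟨fun b => (hg b).summable, ?_⟩
    simpa only [(hg _).tsum_eq] using hc.summable
  have h1 : HasSum (fun p : β × α => f p.2 p.1) c := by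
    rw [← (hs.hasSum.prod_fiberwise hg).unique hc]
    exact hs.hasSum
  have h2 : HasSum (fun p : α × β => f p.1 p.2) c := ((Equiv.prodComm β α).hasSum_iff (f := fun p : α × β => f p.1 p.2)).1 h1
  exact h2.prod_fiberwise hh

/-- The sum telescopes, each term being a difference of consecutive values of 1/(m C(n+m,n)); the
boundary term vanishes because C(N+m,N) ≥ N + 1. The inverse binomial is the connector of the two
sides of the duality. -/
theorem hasSum_inv_mul_choose (m k : ℕ) (hm : 0 < m) :
    HasSum (fun n : ℕ => if k < n then (1 / (n : ℝ)) * (1 / ((n + m).choose n : ℝ)) else 0)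
      ((1 / (m : ℝ)) * (1 / ((k + m).choose k : ℝ))) := by
  have hm0 : (0 : ℝ) < m := by exact_mod_cast hm
  have hpos : ∀ n : ℕ, (0 : ℝ) < ((n + m).choose n : ℝ) := fun n => by
    exact_mod_cast Nat.choose_pos (Nat.le_add_right n m)
  have hstep : ∀ n : ℕ, (1 / ((n + 1 : ℕ) : ℝ)) * (1 / ((n + 1 + m).choose (n + 1) : ℝ)) =
      (1 / (m : ℝ)) * (1 / ((n + m).choose n : ℝ)) -
        (1 / (m : ℝ)) * (1 / ((n + 1 + m).choose (n + 1) : ℝ)) := by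
    intro n
    have h := congrArg (Nat.cast : ℕ → ℝ) (Nat.add_one_mul_choose_eq (n + m) n)
    rw [show n + m + 1 = n + 1 + m by ring] at h
    have h1 := hpos n
    have h2 := hpos (n + 1)
    push_cast at h ⊢
    field_simp
    linear_combination h
  have hsum : ∀ N, ∑ n ∈ Finset.range (N + 1),
      (if k < n then (1 / (n : ℝ)) * (1 / ((n + m).choose n : ℝ)) else 0) =
      if k ≤ N then (1 / (m : ℝ)) * (1 / ((k + m).choose k : ℝ)) -
        (1 / (m : ℝ)) * (1 / ((N + m).choose N : ℝ)) else 0 := by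
    intro N
    induction N with
    | zero =>
      rcases k with _ | k
      · simp
      · simp
    | succ N ih =>
      rw [Finset.sum_range_succ, ih]
      rcases lt_trichotomy k (N + 1) with h | rfl | h
      · rw [if_pos (by omega), if_pos h, if_pos h.le, hstep]
        ring
      · rw [if_neg (by omega), if_neg (by omega), if_pos le_rfl]
        ring
      · rw [if_neg (by omega), if_neg (by omega), if_neg (by omega), add_zero]
  refine (hasSum_iff_tendsto_nat_of_nonneg (fun n => ?_) _).2 ?_
  · split_ifs
    · positivity
    · exact le_rfl
  · rw [← Filter.tendsto_add_atTop_iff_nat 1]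
    have h0 : Filter.Tendsto (fun N : ℕ => (1 / (m : ℝ)) * (1 / ((N + m).choose N : ℝ)))
        Filter.atTop (nhds 0) := by
      have hb : Filter.Tendsto (fun N : ℕ => (1 / (m : ℝ)) * (1 / ((N : ℝ) + 1))) Filter.atTop
          (nhds 0) := by
        simpa using tendsto_one_div_add_atTop_nhds_zero_nat.const_mul (1 / (m : ℝ))
      refine squeeze_zero (fun N => by positivity) (fun N => ?_) hb
      have : N + 1 ≤ (N + m).choose N := by
        rw [← Nat.choose_succ_self_right N]
        exact Nat.choose_le_choose N (by omega)
      have h1 : ((N : ℝ) + 1) ≤ ((N + m).choose N : ℝ) := by exact_mod_cast this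
      gcongr
    have h1 := h0.const_sub ((1 / (m : ℝ)) * (1 / ((k + m).choose k : ℝ)))
    rw [sub_zero] at h1
    refine h1.congr' ?_
    filter_upwards [Filter.eventually_ge_atTop k] with N hN
    rw [hsum, if_pos hN]

/-- Summing over the largest variable moves the connector one step down and trades one letter e₁ for
one factor 1/m. -/
theorem hasSum_wordCoeff_replicate_div_choose (s m : ℕ) (hm : 0 < m) :
    HasSum (fun n : ℕ => wordCoeff (List.replicate s 1) n * (1 / ((n + m).choose n : ℝ)))
      (1 / (m : ℝ) ^ s) := by
  induction s with
  | zero =>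
    have := hasSum_single (f := fun n : ℕ => wordCoeff (List.replicate 0 1) n *
      (1 / ((n + m).choose n : ℝ))) 0 (fun n hn => by simp [wordCoeff, hn])
    simpa [wordCoeff] using this
  | succ s ih =>
    have h1 := ih.mul_left (1 / (m : ℝ))
    rw [← mul_comm (1 / (m : ℝ) ^ s), one_div_mul_one_div_rev, ← pow_succ'] at h1
    refine hasSum_of_hasSum_fiberwise (f := fun n k => wordCoeff (List.replicate s 1) k *
      if k < n then (1 / (n : ℝ)) * (1 / ((n + m).choose n : ℝ)) else 0) ?_
      (fun k => (hasSum_inv_mul_choose m k hm).mul_left _) (h1.congr_fun ?_) ?_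
    · intro n k
      refine mul_nonneg (wordCoeff_mem_Icc _ k).1 ?_
      split_ifs
      · positivity
      · exact le_rfl
    · intro k
      ring
    · intro n
      rw [List.replicate_succ, wordCoeff, if_neg (by decide)]
      have := hasSum_sum_of_ne_finset_zero (L := SummationFilter.unconditional ℕ) (s := Finset.range n)
        (f := fun k => wordCoeff (List.replicate s 1) k *
          if k < n then (1 / (n : ℝ)) * (1 / ((n + m).choose n : ℝ)) else 0) fun k hk => by
            rw [if_neg (by simpa using hk), mul_zero]
      convert this using 1
      rw [Finset.sum_div, Finset.sum_mul]
      refine Finset.sum_congr rfl fun k hk => ?_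
      rw [if_pos (Finset.mem_range.1 hk)]
      ring

/-- The zeta value `∑ n⁻ᵏ`. -/
noncomputable def zetaNat (k : ℕ) : ℝ := ∑' n : ℕ, 1 / (n : ℝ) ^ k

theorem hasSum_zetaNat {k : ℕ} (hk : 2 ≤ k) : HasSum (fun n : ℕ => 1 / (n : ℝ) ^ k) (zetaNat k) :=
  (Real.summable_one_div_nat_pow.2 hk).hasSum

/-- Write the factor 1/n of the last letter e₀ as ∑_{m>0} 1/(m C(n+m,n)), which is
`hasSum_inv_mul_choose` with the roles of n and m exchanged. Summing over n first then leaves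
1/m^(s+1). -/
theorem hasSum_wordCoeff_zero_cons_replicate (s : ℕ) (hs : 0 < s) :
    HasSum (wordCoeff (0 :: List.replicate s 1)) (zetaNat (s + 1)) := by
  refine hasSum_of_hasSum_fiberwise (f := fun (n m : ℕ) => if 0 < m then
    (1 / (m : ℝ)) * (wordCoeff (List.replicate s 1) n * (1 / ((n + m).choose n : ℝ))) else 0)
    (g := fun m : ℕ => 1 / (m : ℝ) ^ (s + 1)) ?_ ?_ (hasSum_zetaNat (by omega)) ?_
  · intro n m
    split_ifs
    · exact mul_nonneg (by positivity) (mul_nonneg (wordCoeff_mem_Icc _ n).1 (by positivity))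
    · exact le_rfl
  · intro m
    rcases Nat.eq_zero_or_pos m with rfl | hm
    · simp
    · simp only [if_pos hm]
      have := (hasSum_wordCoeff_replicate_div_choose s m hm).mul_left (1 / (m : ℝ))
      rwa [one_div_mul_one_div_rev, ← pow_succ] at this
  · intro n
    rcases Nat.eq_zero_or_pos n with rfl | hn
    · obtain ⟨s, rfl⟩ : ∃ r, s = r + 1 := ⟨s - 1, by omega⟩
      have : (fun m : ℕ => if 0 < m then (1 / (m : ℝ)) *
          (wordCoeff (List.replicate (s + 1) 1) 0 * (1 / ((0 + m).choose 0 : ℝ))) else 0) =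
          fun _ => 0 := by
        funext m
        simp [List.replicate_succ, wordCoeff]
      simp only [this]
      simp [wordCoeff]
    · have := (hasSum_inv_mul_choose n 0 hn).mul_left (wordCoeff (List.replicate s 1) n)
      rw [wordCoeff, if_pos rfl]
      rw [zero_add, Nat.choose_zero_right, Nat.cast_one, div_one, mul_one, mul_one_div] at this
      refine this.congr_fun fun m => ?_
      split_ifs
      · rw [add_comm n m, ← Nat.choose_symm (Nat.le_add_right m n), Nat.add_sub_cancel_left]
        ring
      · rw [mul_zero]

theorem mzv_singleton (k : ℕ+) (hk : 2 ≤ (k : ℕ)) : mzv [k] = zetaNat k := by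
  apply mzv_eq_of_tendsto
  refine (hasSum_zetaNat hk).tendsto_sum_nat.congr' ?_
  filter_upwards [Filter.eventually_gt_atTop 0] with N hN
  rw [Finset.range_eq_Ico, Finset.sum_eq_sum_Ico_succ_bot hN]
  simp only [nestLt, mul_one, Nat.cast_zero]
  rw [zero_pow (by omega), div_zero, zero_add]
  exact Finset.sum_congr (by ext; simp [Nat.succ_le_iff]) fun _ _ => rfl

theorem coe_mzvZ_singleton (k : ℕ+) (hk : 2 ≤ (k : ℕ)) : ((mzvZ [k] : MZVAlg) : ℝ) = zetaNat k := by
  have hadm : Index.Admissible [k] := fun _ => by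
    rw [List.getLast_singleton]
    exact hk
  rw [mzvZ, dif_pos hadm]
  exact mzv_singleton k hk

end Duality

/-! ### Regularized values of ({1}^a, 2, {1}^b) -/

section HeightOne

theorem eIndex_append (k l : Index) : eIndex (k ++ l) = eIndex k * eIndex l := by
  simp [eIndex]

theorem eIndex_replicate_one (n : ℕ) : eIndex (List.replicate n 1) = letter 1 ^ n := by
  simp [eIndex]

theorem eIndex_index121 (a b : ℕ) :
    eIndex (index121 a b) = letter 1 ^ (a + 1) * letter 0 * letter 1 ^ b := by
  rw [index121, eIndex_append, eIndex_replicate_one]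
  simp [eIndex, pow_succ, mul_assoc]

theorem shuffleE1_pow_one (n : ℕ) : (shuffleE1 ^ n) 1 = (n.factorial : ℚ) • letter 1 ^ n := by
  induction n with
  | zero => simp
  | succ n ih =>
    have e := shuffleE1_mul_pow 1 n
    rw [one_mul, one_mul, shuffleE1_one, ← pow_succ'] at e
    rw [pow_succ', Module.End.mul_apply, ih, map_smul, e, Nat.factorial_succ]
    push_cast
    module

theorem one_mem_H1 : (1 : NCPoly) ∈ H1 := Submodule.mem_sup_left (by simp)

theorem letter_one_mul_mem_H1 (x : NCPoly) : letter 1 * x ∈ H1 := Submodule.mem_sup_right ⟨x, rfl⟩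

theorem polylog_letter_one_pow (n : ℕ) {t : ℝ} (ht : |t| < 1) :
    polylog (letter 1 ^ n) t = (-Real.log (1 - t)) ^ n / n.factorial := by
  have h := polylog_shuffleE1_pow one_mem_H1 n ht
  rw [shuffleE1_pow_one, polylog_smul, polylog_one, one_mul] at h
  rw [← h]
  push_cast
  field_simp

/-- By uniqueness any expansion of Li_k, however obtained, computes the regularized value. -/
theorem mzvSh_eq_of_hasLogExpansion {k : Index} {P : Polynomial ℝ}
    (h : HasLogExpansion (polylog (eIndex k)) P) : ((mzvSh k : MZVAlg) : ℝ) = P.coeff 0 := by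
  obtain ⟨Q, hQ, h0⟩ := exists_hasLogExpansion_eIndex k
  rw [← h0, hQ.unique h]

theorem mzvSh_nil : mzvSh [] = 1 := by
  have h : HasLogExpansion (polylog (eIndex [])) 1 :=
    (hasLogExpansion_eval 1).congr (Filter.Eventually.of_forall fun t => by
      simp [eIndex, polylog_one])
  exact Subtype.ext (by simpa using mzvSh_eq_of_hasLogExpansion h)

theorem mzvSh_replicate_one (n : ℕ) (hn : 0 < n) : mzvSh (List.replicate n 1) = 0 := by
  have h : HasLogExpansion (polylog (eIndex (List.replicate n 1)))
      (Polynomial.C (1 / (n.factorial : ℝ)) * Polynomial.X ^ n) :=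
    (hasLogExpansion_eval _).congr (eventually_abs_lt_one.mono fun t ht => by
      rw [eIndex_replicate_one, polylog_letter_one_pow n ht]
      simp
      ring)
  exact Subtype.ext (by simpa [Polynomial.coeff_X_pow, hn.ne] using mzvSh_eq_of_hasLogExpansion h)

theorem HasLogExpansion.shuffleE1 {x : NCPoly} (hx : x ∈ H1) {P : Polynomial ℝ}
    (h : HasLogExpansion (polylog x) P) :
    HasLogExpansion (polylog (shuffleE1 x)) (P * Polynomial.X) := by
  refine (h.mul (hasLogExpansion_eval Polynomial.X)).congr
    (eventually_abs_lt_one.mono fun t ht => ?_)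
  have := polylog_shuffleE1_pow hx 1 ht
  rw [pow_one, pow_one] at this
  rw [this, Polynomial.eval_X]

theorem HasLogExpansion.polylog_add_smul {x y : NCPoly} {P Q : Polynomial ℝ}
    (hx : HasLogExpansion (polylog x) P) (hy : HasLogExpansion (polylog y) Q) (p q : ℚ) :
    HasLogExpansion (polylog (p • x + q • y))
      (Polynomial.C (p : ℝ) * P + Polynomial.C (q : ℝ) * Q) :=
  ((hx.const_mul p).add (hy.const_mul q)).congr (eventually_abs_lt_one.mono fun t ht => by
    rw [polylog_add _ _ ht, polylog_smul, polylog_smul])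

/-- The shuffle of e₁ with e₁^(a+1) e₀ e₁^b has an expansion divisible by X, hence constant term 0;
the shuffle itself is (b+1) e₁^(a+1) e₀ e₁^(b+1) + (a+2) e₁^(a+2) e₀ e₁^b. -/
theorem mzvSh_index121_succ (a b : ℕ) :
    ((b : ℝ) + 1) * ((mzvSh (index121 a (b + 1)) : MZVAlg) : ℝ) =
      -(((a : ℝ) + 2) * ((mzvSh (index121 (a + 1) b) : MZVAlg) : ℝ)) := by
  obtain ⟨P, hP, hP0⟩ := exists_hasLogExpansion_eIndex (index121 a (b + 1))
  obtain ⟨Q, hQ, hQ0⟩ := exists_hasLogExpansion_eIndex (index121 (a + 1) b)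
  obtain ⟨R, hR, -⟩ := exists_hasLogExpansion_eIndex (index121 a b)
  have hmem : eIndex (index121 a b) ∈ H1 := by
    rw [eIndex_index121, pow_succ', mul_assoc, mul_assoc]
    exact letter_one_mul_mem_H1 _
  have h1 : shuffleE1 (letter 1 ^ (a + 1)) = ((a : ℚ) + 2) • letter 1 ^ (a + 2) := by
    have e := shuffleE1_mul_pow 1 (a + 1)
    rw [one_mul, one_mul, shuffleE1_one, ← pow_succ'] at e
    rw [e]
    push_cast
    module
  have he : shuffleE1 (eIndex (index121 a b)) = ((b : ℚ) + 1) • eIndex (index121 a (b + 1)) +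
      ((a : ℚ) + 2) • eIndex (index121 (a + 1) b) := by
    rw [eIndex_index121, eIndex_index121, eIndex_index121, shuffleE1_mul_pow, shuffleE1_mul_letter,
      h1, add_mul, mul_assoc _ (letter 1) (letter 1 ^ b), ← pow_succ']
    simp only [smul_mul_assoc]
    module
  have h2 := (hR.shuffleE1 hmem).unique (he ▸ hP.polylog_add_smul hQ _ _)
  have h3 := congrArg (fun p : Polynomial ℝ => p.coeff 0) h2
  simp only [Polynomial.mul_coeff_zero, Polynomial.coeff_X_zero, mul_zero, Polynomial.coeff_add,
    Polynomial.coeff_C_zero, hP0, hQ0] at h3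
  push_cast at h3
  linear_combination -h3

theorem polylog_letter_one_pow_mul_zero_expansion (n : ℕ) :
    HasLogExpansion (polylog (letter 1 ^ (n + 1) * letter 0))
      (Polynomial.C (zetaNat (n + 2))) := by
  obtain ⟨C, hC⟩ := exists_tsum_wordCoeff_sub_le 1 (List.replicate n 1)
  refine HasLogExpansion.of_bound (C := C) (δ := 1 / 4) (by norm_num) ?_
  filter_upwards [self_mem_nhdsWithin, mem_nhdsWithin_of_mem_nhds
    (Ioi_mem_nhds (show (0 : ℝ) < 1 by norm_num))] with t ht1 ht0
  rw [Polynomial.eval_C, ← (hasSum_wordCoeff_zero_cons_replicate (n + 1) (Nat.succ_pos n)).tsum_eq,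
    ← word_replicate, ← word_singleton, ← word_append, polylog, evalSeries]
  simp only [coeff_polylogSeries_word, List.reverse_append, List.reverse_replicate,
    List.reverse_singleton, List.singleton_append]
  exact hC t (le_of_lt ht0) ht1

/-- The recursion moves ones across the 2 at constant weight, down to b = 0, where duality gives
ζ(a+2). -/
theorem coe_mzvSh_index121 (a b : ℕ) :
    ((mzvSh (index121 a b) : MZVAlg) : ℝ) =
      (-1) ^ b * ((a + b + 1).choose b : ℝ) * zetaNat (a + b + 2) := by
  induction b generalizing a with
  | zero =>
    have h := polylog_letter_one_pow_mul_zero_expansion a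
    rw [← mul_one (letter 1 ^ (a + 1) * letter 0), ← pow_zero (letter 1), ← eIndex_index121] at h
    simpa using mzvSh_eq_of_hasLogExpansion h
  | succ b ih =>
    have h := mzvSh_index121_succ a b
    rw [ih] at h
    have hc := congrArg (Nat.cast : ℕ → ℝ) (Nat.choose_succ_right_eq (a + (b + 1) + 1) b)
    rw [Nat.cast_mul, Nat.cast_mul, show a + (b + 1) + 1 - b = a + 2 by omega] at hc
    have hb : ((b : ℝ) + 1) ≠ 0 := by positivity
    apply mul_left_cancel₀ hb
    rw [h, show a + 1 + b + 1 = a + (b + 1) + 1 by ring, show a + 1 + b + 2 = a + (b + 1) + 2 by ring,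
      pow_succ]
    push_cast at hc ⊢
    linear_combination (-1) ^ b * zetaNat (a + (b + 1) + 2) * hc

theorem mzvSh_index121 (a b : ℕ) (k : ℕ+) (hk : (k : ℕ) = a + b + 2) :
    mzvSh (index121 a b) = (-1) ^ b * ((a + b + 1).choose b : MZVAlg) * mzvZ [k] := by
  apply Subtype.ext
  rw [coe_mzvSh_index121]
  push_cast
  rw [coe_mzvZ_singleton k (by omega), hk]

end HeightOne

end FMZV

namespace FMZV

/-! ### Merging and cutting indices -/

section Merges

variable {R : Type*}

/-- The sum of `f` over all indices `k₁ □ ⋯ □ k_r`. -/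
def starSum [AddCommMonoid R] (f : Index → R) (k : Index) : R := (k.merges.map f).sum

theorem starSum_nil [AddCommMonoid R] (f : Index → R) : starSum f [] = f [] := by
  simp [starSum, Index.merges]

theorem starSum_singleton [AddCommMonoid R] (f : Index → R) (k : ℕ+) :
    starSum f [k] = f [k] := by
  simp [starSum, Index.merges, Index.mergesAux]

theorem starSum_cons_cons [AddCommMonoid R] (f : Index → R) (k l : ℕ+) (ks : Index) :
    starSum f (k :: l :: ks) = starSum (fun m => f (k :: m)) (l :: ks) + starSum f ((k + l) :: ks) := by
  simp [starSum, Index.merges, Index.mergesAux, Function.comp_def]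

theorem starSum_add [AddCommMonoid R] (f g : Index → R) (k : Index) :
    starSum (fun m => f m + g m) k = starSum f k + starSum g k := by
  simp only [starSum, List.sum_map_add]

theorem starSum_mul_left [CommRing R] (c : R) (f : Index → R) (k : Index) :
    starSum (fun m => c * f m) k = c * starSum f k := by
  simp only [starSum, List.sum_map_mul_left]

theorem map_starSum {S : Type*} [AddCommMonoid R] [AddCommMonoid S] {F : Type*} [FunLike F R S]
    [AddMonoidHomClass F R S] (φ : F) (f : Index → R) (k : Index) :
    φ (starSum f k) = starSum (fun m => φ (f m)) k := by
  simp [starSum, map_list_sum, Function.comp_def]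

theorem wt_of_mem_merges {k m : Index} (h : m ∈ k.merges) : m.wt = k.wt := by
  cases k with
  | nil => rw [Index.merges, List.mem_singleton] at h; rw [h]
  | cons k ks =>
    rw [Index.merges] at h
    induction ks generalizing k m with
    | nil => rw [Index.mergesAux, List.mem_singleton] at h; rw [h]
    | cons l ks ih =>
      rw [Index.mergesAux, List.mem_append, List.mem_map] at h
      rcases h with ⟨m, hm, rfl⟩ | h
      · have := ih _ hm
        simp only [Index.wt, List.map_cons, List.sum_cons] at this ⊢
        rw [this]
      · rw [ih _ h]
        simp [Index.wt, add_assoc]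

theorem starSum_congr [AddCommMonoid R] {f g : Index → R} {k : Index}
    (h : ∀ m ∈ k.merges, f m = g m) : starSum f k = starSum g k := by
  rw [starSum, starSum, List.map_congr_left h]

/-- The merge recursion at the right end, needed since symmetric values reverse a part of the index.
-/
theorem starSum_append_pair [AddCommMonoid R] (f : Index → R) (ks : Index) (k l : ℕ+) :
    starSum f (ks ++ [k, l]) =
      starSum (fun m => f (m ++ [l])) (ks ++ [k]) + starSum f (ks ++ [k + l]) := by
  cases ks with
  | nil => simp [starSum_cons_cons, starSum_singleton]
  | cons j ks =>
    induction ks generalizing j f with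
    | nil =>
      simp only [List.cons_append, List.nil_append, starSum_cons_cons, starSum_singleton, add_assoc]
      abel
    | cons i ks ih =>
      have h1 := ih (fun m => f (j :: m)) i
      have h2 := ih f (j + i)
      simp only [List.cons_append] at h1 h2 ⊢
      rw [starSum_cons_cons, h1, h2, starSum_cons_cons _ j i, starSum_cons_cons _ j i]
      simp only [List.cons_append]
      abel

theorem starSum_reverse [AddCommMonoid R] (f : Index → R) (k : Index) :
    starSum (fun m => f m.reverse) k = starSum f k.reverse := by
  cases k with
  | nil => simp [starSum_nil]
  | cons k ks =>
    induction ks generalizing k f with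
    | nil => simp [starSum_singleton]
    | cons l ks ih =>
      have h1 := ih (fun m => f (m ++ [k])) l
      have h2 := ih f (k + l)
      rw [starSum_cons_cons]
      simp only [List.reverse_cons, List.append_assoc, List.cons_append, List.nil_append] at h1 h2 ⊢
      rw [h1, h2, starSum_append_pair, add_comm l k]

variable [CommRing R]

/-- The sum of `f (k₁, …, k_i) g (k_{i+1}, …, k_r)` over all `i`. -/
def cutSum (f g : Index → R) (k : Index) : R :=
  ∑ i ∈ Finset.range (k.length + 1), f (k.take i) * g (k.drop i)

theorem cutSum_nil (f g : Index → R) : cutSum f g [] = f [] * g [] := by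
  simp [cutSum]

theorem cutSum_cons (f g : Index → R) (k : ℕ+) (ks : Index) :
    cutSum f g (k :: ks) = f [] * g (k :: ks) + cutSum (fun m => f (k :: m)) g ks := by
  rw [cutSum, List.length_cons, Finset.sum_range_succ', add_comm]
  rfl

theorem cutSum_add_left (f f' g : Index → R) (k : Index) :
    cutSum (fun m => f m + f' m) g k = cutSum f g k + cutSum f' g k := by
  simp only [cutSum, add_mul, Finset.sum_add_distrib]

/-- A cut of a merged index falls on a surviving comma, so merging and then cutting is the same as
cutting and then merging both pieces. -/
theorem starSum_cutSum (f g : Index → R) (k : Index) :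
    starSum (cutSum f g) k = cutSum (starSum f) (starSum g) k := by
  cases k with
  | nil => simp [starSum_nil, cutSum_nil]
  | cons k ks =>
    induction ks generalizing k f with
    | nil => simp [starSum_singleton, cutSum_cons, cutSum_nil, starSum_nil]
    | cons l ks ih =>
      rw [starSum_cons_cons, ih f (k + l)]
      simp only [cutSum_cons]
      rw [starSum_add, starSum_mul_left, ih (fun m => f (k :: m)) l]
      simp only [cutSum_cons, starSum_cons_cons, starSum_nil, starSum_singleton, cutSum_add_left]
      ring

/-- The sum `∑ᵢ (-1)^{k_{i+1} + ⋯ + k_r} f (k₁, …, k_i) f (k_r, …, k_{i+1})`. -/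
def symSum (f : Index → R) (k : Index) : R :=
  cutSum f (fun m => (-1) ^ m.wt * f m.reverse) k

/-- Merging preserves the weight, hence the sign, and commutes with reversal. The star value is
therefore a symmetric sum of merged regularized values. -/
theorem starSum_symSum (f : Index → R) (k : Index) :
    starSum (symSum f) k = symSum (starSum f) k := by
  have h : starSum (fun m => (-1) ^ m.wt * f m.reverse) =
      fun m : Index => (-1) ^ m.wt * starSum f m.reverse := by
    funext k
    rw [starSum_congr (g := fun m => (-1) ^ k.wt * f m.reverse) fun m hm => by
      rw [wt_of_mem_merges hm], starSum_mul_left, starSum_reverse]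
  rw [symSum, ← h, ← starSum_cutSum]
  rfl

theorem map_symSum {S : Type*} [CommRing S] (φ : R →+* S) (f : Index → R) (k : Index) :
    φ (symSum f k) = symSum (fun m => φ (f m)) k := by
  simp [symSum, cutSum]

theorem reverse_index121 (a b : ℕ) : (index121 a b).reverse = index121 b a := by
  simp [index121]

theorem length_index121 (a b : ℕ) : (index121 a b).length = a + b + 1 := by
  simp [index121]
  omega

theorem wt_index121 (a b : ℕ) : (index121 a b).wt = a + b + 2 := by
  simp [index121, Index.wt]
  omega

/-- An interior cut leaves a nonempty run of ones on one of its sides, which f kills; only the empty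
and the full left piece survive. It is applied both to ζ^sh and to its merge sums. -/
theorem symSum_index121 (f : Index → R) (h0 : f [] = 1)
    (h1 : ∀ n, 0 < n → f (List.replicate n 1) = 0) (a b : ℕ) :
    symSum f (index121 a b) = f (index121 a b) + (-1) ^ (a + b) * f (index121 b a) := by
  rw [symSum, cutSum, length_index121, Finset.sum_range_succ, Finset.sum_range_succ',
    Finset.sum_eq_zero]
  · rw [← length_index121, List.take_length, List.drop_length, List.take_zero, List.drop_zero,
      reverse_index121, wt_index121, h0]
    simp [Index.wt, h0, pow_add]
    ring
  · intro i hi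
    rw [Finset.mem_range] at hi
    by_cases hia : i + 1 ≤ a
    · have : (index121 a b).take (i + 1) = List.replicate (i + 1) 1 := by
        rw [index121, List.take_append_of_le_length (by simpa using hia), List.take_replicate,
          min_eq_left hia]
      rw [this, h1 _ (Nat.succ_pos i), zero_mul]
    · have : (index121 a b).drop (i + 1) = List.replicate (a + b - i) 1 := by
        obtain ⟨j, rfl⟩ : ∃ j, i = a + j := ⟨i - a, by omega⟩
        have e : index121 a b = (List.replicate a 1 ++ [2]) ++ List.replicate b 1 := by
          simp [index121]
        rw [e, show a + j + 1 = (List.replicate a (1 : ℕ+) ++ [2]).length + j by simp; omega,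
          List.drop_length_add_append, List.drop_replicate]
        congr 1
        omega
      rw [this, List.reverse_replicate, h1 _ (by omega)]
      simp

end Merges

/-! ### Symmetric values modulo t and the non-star formula -/

section SymmetricReduction

theorem neg_one_pow_mul_self (R : Type*) [CommRing R] (a : ℕ) : (-1 : R) ^ a * (-1) ^ a = 1 := by
  rw [← mul_pow, neg_one_mul, neg_neg, one_pow]

theorem constantCoeff_reversedSeries (k : Index) :
    PowerSeries.constantCoeff (reversedSeries k) = mzvSh k.reverse := by
  rw [← PowerSeries.coeff_zero_eq_constantCoeff_apply, reversedSeries, PowerSeries.coeff_mk,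
    Finset.Nat.antidiagonalTuple_zero_right, Finset.sum_singleton]
  have : (List.ofFn fun j : Fin k.length => (⟨(k.get j : ℕ) + (0 : Fin k.length → ℕ) j,
      Nat.add_pos_left (k.get j).pos _⟩ : ℕ+)) = k := by
    conv_rhs => rw [← List.ofFn_get k]
    rfl
  rw [this]
  simp
  rfl

theorem constantCoeff_zetaHatSh (k : Index) :
    PowerSeries.constantCoeff (zetaHatSh k) = symSum mzvSh k := by
  rw [zetaHatSh, map_sum, symSum, cutSum]
  refine Finset.sum_congr rfl fun i _ => ?_
  rw [map_mul, map_mul, PowerSeries.constantCoeff_C, constantCoeff_reversedSeries, map_pow,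
    map_neg, map_one]
  ring

theorem SRing.proj_one_eq (f : PowerSeries MZVBar) :
    SRing.proj 1 f = SRing.proj 1 (PowerSeries.C (PowerSeries.constantCoeff f)) := by
  rw [SRing.proj, Ideal.Quotient.eq, pow_one, Ideal.mem_span_singleton, PowerSeries.X_dvd_iff]
  simp

/-- The reduction of `ζ^ш(k)` modulo `ζ(2)`. -/
noncomputable def mzvShBar (k : Index) : MZVBar :=
  Ideal.Quotient.mk (Ideal.span {mzvZ [2]}) (mzvSh k)

theorem constantCoeff_zetaHatS (k : Index) :
    PowerSeries.constantCoeff (zetaHatS k) = symSum mzvShBar k := by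
  rw [zetaHatS, ← PowerSeries.coeff_zero_eq_constantCoeff_apply, PowerSeries.coeff_map,
    PowerSeries.coeff_zero_eq_constantCoeff_apply, constantCoeff_zetaHatSh, map_symSum]
  rfl

theorem zetaS_one_eq (k : Index) :
    zetaS 1 k = SRing.proj 1 (PowerSeries.C (symSum mzvShBar k)) := by
  rw [zetaS, SRing.proj_one_eq, constantCoeff_zetaHatS]

theorem zetaStarS_one_eq (k : Index) :
    zetaStarS 1 k = SRing.proj 1 (PowerSeries.C (symSum (starSum mzvShBar) k)) := by
  have h : zetaStarHatS k = starSum zetaHatS k := rfl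
  rw [zetaStarS, SRing.proj_one_eq, h, map_starSum, ← starSum_symSum]
  simp only [constantCoeff_zetaHatS]

/-- The reduction of `ζ(k)` modulo `ζ(2)`. -/
noncomputable def zetaBar (k : ℕ+) : MZVBar :=
  Ideal.Quotient.mk (Ideal.span {mzvZ [2]}) (mzvZ [k])

theorem sign_choose_mul_frakZS (b m l : ℕ) (k : ℕ+) :
    (-1) ^ b * (Nat.choose m l : SRing 1) * frakZS 1 k =
      SRing.proj 1 (PowerSeries.C ((-1) ^ b * (Nat.choose m l : MZVBar) * zetaBar k)) := by
  simp only [map_mul, map_pow, map_neg, map_one, map_natCast]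
  rfl

theorem mzvShBar_index121 (a b : ℕ) (k : ℕ+) (hk : (k : ℕ) = a + b + 2) :
    mzvShBar (index121 a b) = (-1) ^ b * ((a + b + 1).choose b : MZVBar) * zetaBar k := by
  rw [mzvShBar, mzvSh_index121 a b k hk]
  simp only [map_mul, map_pow, map_neg, map_one, map_natCast]
  rfl

/-- The two surviving cuts carry the same sign (-1)^b and the binomials C(a+b+1,a+1) and C(a+b+1,a),
joined by Pascal's rule. -/
theorem zetaS_index121 (a b : ℕ) (k : ℕ+) (hk : (k : ℕ) = a + b + 2) :
    zetaS 1 (index121 a b) =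
      (-1) ^ b * (Nat.choose (a + b + 2) (a + 1) : SRing 1) * frakZS 1 k := by
  rw [zetaS_one_eq, sign_choose_mul_frakZS, symSum_index121]
  · congr 2
    rw [mzvShBar_index121 a b k hk, mzvShBar_index121 b a k (by omega), Nat.choose_succ_succ',
      Nat.cast_add, ← Nat.choose_symm (show a + 1 ≤ a + b + 1 by omega),
      show a + b + 1 - (a + 1) = b by omega, add_comm b a, pow_add]
    have h := neg_one_pow_mul_self MZVBar a
    linear_combination ((-1) ^ b * ((a + b + 1).choose a : MZVBar) * zetaBar k) * h
  · rw [mzvShBar, mzvSh_nil, map_one]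
  · intro n hn
    rw [mzvShBar, mzvSh_replicate_one n hn, map_zero]

end SymmetricReduction

/-! ### Words of the merge sums -/

section StarWords

/-- The element `e₀ + e₁`. -/
noncomputable def letterSum : NCPoly := letter 0 + letter 1

/-- A plus turns the e₁ that opens the next block into e₀, so comma and plus together give e₀ + e₁
at each junction. -/
theorem starSum_eIndex_cons (k : ℕ+) (ks : Index) :
    starSum eIndex (k :: ks) = letter 1 * letter 0 ^ ((k : ℕ) - 1) *
      (ks.map fun l : ℕ+ => letterSum * letter 0 ^ ((l : ℕ) - 1)).prod := by
  induction ks generalizing k with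
  | nil => simp [starSum_singleton, eIndex]
  | cons l ks ih =>
    have h : starSum (fun m => eIndex (k :: m)) (l :: ks) =
        letter 1 * letter 0 ^ ((k : ℕ) - 1) * starSum eIndex (l :: ks) := by
      have := map_starSum (AddMonoidHom.mulLeft (letter 1 * letter 0 ^ ((k : ℕ) - 1)))
        eIndex (l :: ks)
      rw [AddMonoidHom.coe_mulLeft] at this
      rw [this]
      rfl
    rw [starSum_cons_cons, h, ih, ih, List.map_cons, List.prod_cons, letterSum, PNat.add_coe,
      show (k : ℕ) + l - 1 = ((k : ℕ) - 1) + 1 + ((l : ℕ) - 1) by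
        have := k.pos; have := l.pos; omega, pow_add, pow_add, pow_one]
    noncomm_ring

theorem starSum_eIndex_replicate_one (n : ℕ) :
    starSum eIndex (List.replicate (n + 1) 1) = letter 1 * letterSum ^ n := by
  rw [List.replicate_succ, starSum_eIndex_cons]
  simp

theorem starSum_eIndex_index121 (a b : ℕ) :
    starSum eIndex (index121 a b) = letter 1 * letterSum ^ a * letter 0 * letterSum ^ b := by
  rw [index121]
  cases a with
  | zero =>
    rw [List.replicate_zero, List.nil_append, starSum_eIndex_cons]
    simp
  | succ a =>
    rw [List.replicate_succ, List.cons_append, starSum_eIndex_cons]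
    simp [pow_succ, mul_assoc]

theorem exists_hasLogExpansion_starSum (k : Index) :
    ∃ P, HasLogExpansion (polylog (starSum eIndex k)) P ∧
      P.coeff 0 = ((starSum mzvSh k : MZVAlg) : ℝ) := by
  have key : ∀ L : List Index, ∃ P, HasLogExpansion (polylog (L.map eIndex).sum) P ∧
      P.coeff 0 = (((L.map mzvSh).sum : MZVAlg) : ℝ) := by
    intro L
    induction L with
    | nil =>
      refine ⟨0, (hasLogExpansion_eval 0).congr (Filter.Eventually.of_forall fun t => ?_), by simp⟩
      simp [polylog_zero]
    | cons m L ih =>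
      obtain ⟨P, hP, hP0⟩ := exists_hasLogExpansion_eIndex m
      obtain ⟨Q, hQ, hQ0⟩ := ih
      refine ⟨P + Q, (hP.add hQ).congr (eventually_abs_lt_one.mono fun t ht => ?_), ?_⟩
      · rw [List.map_cons, List.sum_cons, polylog_add _ _ ht]
      · rw [Polynomial.coeff_add, hP0, hQ0, List.map_cons, List.sum_cons, Subalgebra.coe_add]
  exact key k.merges

theorem coe_starSum_mzvSh_eq {k : Index} {P : Polynomial ℝ}
    (h : HasLogExpansion (polylog (starSum eIndex k)) P) :
    ((starSum mzvSh k : MZVAlg) : ℝ) = P.coeff 0 := by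
  obtain ⟨Q, hQ, h0⟩ := exists_hasLogExpansion_starSum k
  rw [← h0, hQ.unique h]

end StarWords

end FMZV

namespace FMZV

/-! ### Calculus on (0, 1) with the kernel log(1/u)^a / a! -/

section Calculus

open Filter Topology MeasureTheory

/-- The arbitrary filter covers an initial condition at the excluded endpoint (`𝓝[>] 0`) as well as
one at an interior point (`pure 1`). -/
theorem eqOn_of_hasDerivAt_of_tendsto {f g f' : ℝ → ℝ} {s : Set ℝ} (hs : IsOpen s)
    (hs' : IsPreconnected s) (hf : ∀ x ∈ s, HasDerivAt f (f' x) x)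
    (hg : ∀ x ∈ s, HasDerivAt g (f' x) x) {l : Filter ℝ} [l.NeBot] (hl : ∀ᶠ x in l, x ∈ s) {c : ℝ}
    (hfc : Tendsto f l (𝓝 c)) (hgc : Tendsto g l (𝓝 c)) : Set.EqOn f g s := by
  have hd : ∀ x ∈ s, HasDerivAt (fun x => f x - g x) 0 x := fun x hx =>
    ((hf x hx).sub (hg x hx)).congr_deriv (sub_self _)
  obtain ⟨d, hd'⟩ := hs.exists_is_const_of_deriv_eq_zero hs'
    (fun x hx => (hd x hx).differentiableAt.differentiableWithinAt) (fun x hx => (hd x hx).deriv)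
  have h0 : Tendsto (fun x => f x - g x) l (𝓝 0) := by simpa using hfc.sub hgc
  have h1 : Tendsto (fun x => f x - g x) l (𝓝 d) :=
    tendsto_const_nhds.congr' (hl.mono fun x hx => (hd' x hx).symm)
  have hd0 := tendsto_nhds_unique h1 h0
  intro x hx
  have := hd' x hx
  linarith

theorem integral_Ioo_eq_sub_of_hasDerivAt {f f' : ℝ → ℝ} {c d : ℝ}
    (hf : ∀ x ∈ Set.Ioo (0 : ℝ) 1, HasDerivAt f (f' x) x) (hi : IntegrableOn f' (Set.Ioo 0 1))
    (h0 : Tendsto f (𝓝[>] 0) (𝓝 c)) (h1 : Tendsto f (𝓝[<] 1) (𝓝 d)) :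
    ∫ x in Set.Ioo (0 : ℝ) 1, f' x = d - c := by
  rw [← integral_Ioc_eq_integral_Ioo, ← intervalIntegral.integral_of_le zero_le_one]
  exact intervalIntegral.integral_eq_sub_of_hasDerivAt_of_tendsto zero_lt_one hf
    ((intervalIntegrable_iff_integrableOn_Ioo_of_le zero_le_one).2 hi) h0 h1

theorem integrableOn_Ioo_rpow {r : ℝ} (hr : -1 < r) :
    IntegrableOn (fun u : ℝ => u ^ r) (Set.Ioo 0 1) :=
  (intervalIntegrable_iff_integrableOn_Ioo_of_le zero_le_one).1
    (intervalIntegral.intervalIntegrable_rpow' hr)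

/-- `log(1/u)^a / a!`, the density of the iterated integral of `du/u`. -/
noncomputable def logKernel (a : ℕ) (u : ℝ) : ℝ := (-Real.log u) ^ a / a.factorial

theorem measurable_logKernel (a : ℕ) : Measurable (logKernel a) := by
  unfold logKernel
  fun_prop

theorem logKernel_nonneg (a : ℕ) {u : ℝ} (h0 : 0 < u) (h1 : u < 1) : 0 ≤ logKernel a u := by
  have := Real.log_neg h0 h1
  unfold logKernel
  have : 0 ≤ -Real.log u := by linarith
  positivity

theorem logKernel_zero (u : ℝ) : logKernel 0 u = 1 := by simp [logKernel]

theorem logKernel_succ_one (a : ℕ) : logKernel (a + 1) 1 = 0 := by simp [logKernel]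

theorem hasDerivAt_logKernel_succ (a : ℕ) {u : ℝ} (hu : u ≠ 0) :
    HasDerivAt (logKernel (a + 1)) (-(logKernel a u / u)) u := by
  have h := (((Real.hasDerivAt_log hu).neg).pow (a + 1)).div_const ((a + 1).factorial : ℝ)
  refine h.congr_deriv ?_
  simp only [logKernel, Nat.factorial_succ]
  have : (a.factorial : ℝ) ≠ 0 := by positivity
  push_cast
  simp only [Pi.neg_apply]
  field_simp

theorem exists_logKernel_le (a : ℕ) :
    ∃ C, ∀ u ∈ Set.Ioo (0 : ℝ) 1, logKernel a u ≤ C * u ^ (-(1 / 4) : ℝ) := by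
  refine ⟨(4 * (a + 1)) ^ a, fun u hu => ?_⟩
  obtain ⟨h0, h1⟩ := hu
  -- Each logarithm costs at most a factor u^(-t)/t; with this t the total exponent a·t stays below
  -- 1/4.
  set t : ℝ := 1 / (4 * (a + 1)) with ht
  have ht0 : 0 < t := by positivity
  have hl : 0 ≤ -Real.log u := by linarith [Real.log_neg h0 h1]
  have h2 : -Real.log u ≤ 4 * (a + 1) * u ^ (-t) := by
    have h3 := (neg_le_abs _).trans (Real.abs_log_mul_self_rpow_lt u t h0 h1.le ht0).le
    rw [ht, one_div_one_div, ← ht] at h3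
    rw [Real.rpow_neg h0.le, ← div_eq_mul_inv, le_div_iff₀ (by positivity)]
    linarith
  calc logKernel a u ≤ (-Real.log u) ^ a := by
        unfold logKernel
        exact div_le_self (by positivity) (by exact_mod_cast Nat.one_le_iff_ne_zero.2 a.factorial_ne_zero)
    _ ≤ (4 * (a + 1) * u ^ (-t)) ^ a := by gcongr
    _ = (4 * (a + 1)) ^ a * u ^ (-t * a) := by
        rw [mul_pow, ← Real.rpow_natCast (u ^ (-t)), ← Real.rpow_mul h0.le]
    _ ≤ (4 * (a + 1)) ^ a * u ^ (-(1 / 4) : ℝ) := by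
        gcongr ?_ * ?_
        refine Real.rpow_le_rpow_of_exponent_ge h0 h1.le ?_
        rw [ht, neg_mul, neg_le_neg_iff, one_div_mul_eq_div, div_le_iff₀ (by positivity)]
        linarith

/-- The weight u^(-1/2) is the singularity that the inverted remainder acquires at u = 0 in
`abs_halfLinePolylog_sub_le`. -/
theorem integrableOn_logKernel_mul_rpow (a : ℕ) :
    IntegrableOn (fun u => logKernel a u * u ^ (-(1 / 2) : ℝ)) (Set.Ioo 0 1) := by
  obtain ⟨C, hC⟩ := exists_logKernel_le a
  refine Integrable.mono' ((integrableOn_Ioo_rpow (r := -(3 / 4)) (by norm_num)).const_mul C)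
    ((measurable_logKernel a).mul (by fun_prop)).aestronglyMeasurable
    ((ae_restrict_mem measurableSet_Ioo).mono fun u hu => ?_)
  have h0 := hu.1
  rw [Real.norm_of_nonneg (mul_nonneg (logKernel_nonneg a hu.1 hu.2) (by positivity))]
  calc _ ≤ C * u ^ (-(1 / 4) : ℝ) * u ^ (-(1 / 2) : ℝ) := by gcongr; exact hC u hu
    _ = C * u ^ (-(3 / 4) : ℝ) := by
      rw [mul_assoc, ← Real.rpow_add h0]; norm_num

theorem one_le_rpow_neg_half {u : ℝ} (h0 : 0 < u) (h1 : u < 1) : 1 ≤ u ^ (-(1 / 2) : ℝ) :=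
  Real.one_le_rpow_of_pos_of_le_one_of_nonpos h0 h1.le (by norm_num)

theorem integrableOn_logKernel_mul_of_bounded (a : ℕ) {h : ℝ → ℝ} {C : ℝ}
    (hm : ContinuousOn h (Set.Ioo 0 1))
    (hh : ∀ u ∈ Set.Ioo (0 : ℝ) 1, |h u| ≤ C * u ^ (-(1 / 2) : ℝ)) :
    IntegrableOn (fun u => logKernel a u * h u) (Set.Ioo 0 1) := by
  refine Integrable.mono' ((integrableOn_logKernel_mul_rpow a).const_mul C)
    ((measurable_logKernel a).aestronglyMeasurable.mul
      (hm.aestronglyMeasurable measurableSet_Ioo))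
    ((ae_restrict_mem measurableSet_Ioo).mono fun u hu => ?_)
  rw [norm_mul, Real.norm_of_nonneg (logKernel_nonneg a hu.1 hu.2), Real.norm_eq_abs,
    mul_left_comm]
  exact mul_le_mul_of_nonneg_left (hh u hu) (logKernel_nonneg a hu.1 hu.2)

theorem integrableOn_logKernel (a : ℕ) : IntegrableOn (logKernel a) (Set.Ioo 0 1) := by
  have := integrableOn_logKernel_mul_of_bounded a (h := fun _ => 1) (C := 1) continuousOn_const
    (fun u hu => by simpa using one_le_rpow_neg_half hu.1 hu.2)
  simpa using this

theorem tendsto_logKernel_mul_self (a : ℕ) :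
    Tendsto (fun u => logKernel a u * u) (𝓝[>] 0) (𝓝 0) := by
  obtain ⟨C, hC⟩ := exists_logKernel_le a
  have h : Tendsto (fun u : ℝ => C * u ^ (3 / 4 : ℝ)) (𝓝[>] 0) (𝓝 0) := by
    have : Tendsto (fun u : ℝ => C * u ^ (3 / 4 : ℝ)) (𝓝 0) (𝓝 (C * 0 ^ (3 / 4 : ℝ))) :=
      (((Real.continuous_rpow_const (by norm_num)).tendsto 0).const_mul C)
    rw [Real.zero_rpow (by norm_num), mul_zero] at this
    exact this.mono_left nhdsWithin_le_nhds
  have hmem : ∀ᶠ u : ℝ in 𝓝[>] 0, u ∈ Set.Ioo (0 : ℝ) 1 := Ioo_mem_nhdsGT zero_lt_one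
  refine tendsto_of_tendsto_of_tendsto_of_le_of_le' tendsto_const_nhds h
    (hmem.mono fun u hu => mul_nonneg (logKernel_nonneg a hu.1 hu.2) hu.1.le)
    (hmem.mono fun u hu => ?_)
  have h0 := hu.1
  calc _ ≤ C * u ^ (-(1 / 4) : ℝ) * u := by gcongr; exact hC u hu
    _ = C * (u ^ (-(1 / 4) : ℝ) * u ^ (1 : ℝ)) := by rw [Real.rpow_one, mul_assoc]
    _ = C * u ^ (3 / 4 : ℝ) := by rw [← Real.rpow_add h0]; norm_num

theorem continuousAt_logKernel (a : ℕ) {u : ℝ} (hu : u ≠ 0) : ContinuousAt (logKernel a) u := by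
  unfold logKernel
  exact ((Real.continuousAt_log hu).neg.pow a).div_const _

end Calculus

end FMZV

namespace FMZV

/-! ### Polylogarithms on the half line y = t / (1 - t) -/

section InversePolylog

open Filter Topology

theorem continuousAt_polylog (x : NCPoly) {t : ℝ} (ht : |t| < 1) : ContinuousAt (polylog x) t := by
  obtain ⟨C, hC⟩ := exists_bound_polylogSeries x
  exact (hasDerivAt_evalSeries_of_bounded hC ht).continuousAt

theorem div_one_add_mem {y : ℝ} (hy : 0 ≤ y) : |y / (1 + y)| < 1 := by
  rw [abs_of_nonneg (by positivity), div_lt_one (by positivity)]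
  linarith

theorem hasDerivAt_div_one_add {y : ℝ} (hy : 0 ≤ y) :
    HasDerivAt (fun y : ℝ => y / (1 + y)) (1 / (1 + y) ^ 2) y := by
  have h := (hasDerivAt_id y).div ((hasDerivAt_id y).const_add 1) (by simp; positivity)
  refine h.congr_deriv ?_
  simp

/-- The multiple polylogarithm in the coordinate `y = t / (1 - t)`. -/
noncomputable def halfLinePolylog (x : NCPoly) (y : ℝ) : ℝ := polylog x (y / (1 + y))

theorem continuousAt_halfLinePolylog (x : NCPoly) {y : ℝ} (hy : 0 ≤ y) :
    ContinuousAt (halfLinePolylog x) y :=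
  ContinuousAt.comp (f := fun y : ℝ => y / (1 + y)) (g := polylog x)
    (continuousAt_polylog x (div_one_add_mem hy)) (hasDerivAt_div_one_add hy).continuousAt

theorem hasDerivAt_halfLinePolylog_mul_zero (x : NCPoly)
    (hx : PowerSeries.constantCoeff (polylogSeries x) = 0) {y : ℝ} (hy : 0 < y) :
    HasDerivAt (halfLinePolylog (x * letter 0)) (halfLinePolylog x y / (y * (1 + y))) y := by
  have h := HasDerivAt.comp y (hasDerivAt_polylog_mul_zero x hx (t := y / (1 + y)) (by positivity)
    (div_one_add_mem hy.le)) (hasDerivAt_div_one_add hy.le)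
  refine h.congr_deriv ?_
  rw [halfLinePolylog]
  field_simp

theorem hasDerivAt_halfLinePolylog_mul_one (x : NCPoly) {y : ℝ} (hy : 0 < y) :
    HasDerivAt (halfLinePolylog (x * letter 1)) (halfLinePolylog x y / (1 + y)) y := by
  have h := HasDerivAt.comp y (hasDerivAt_polylog_mul_one x (div_one_add_mem hy.le))
    (hasDerivAt_div_one_add hy.le)
  refine h.congr_deriv ?_
  rw [halfLinePolylog, show 1 - y / (1 + y) = 1 / (1 + y) by field_simp; ring]
  field_simp

theorem halfLinePolylog_add (x z : NCPoly) {y : ℝ} (hy : 0 ≤ y) :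
    halfLinePolylog (x + z) y = halfLinePolylog x y + halfLinePolylog z y :=
  polylog_add x z (div_one_add_mem hy)

/-- In this coordinate the forms add up to 1/(y(1+y)) + 1/(1+y) = 1/y, which reduces the merge sums
to classical polylogarithms. -/
theorem hasDerivAt_halfLinePolylog_mul_letterSum (x : NCPoly)
    (hx : PowerSeries.constantCoeff (polylogSeries x) = 0) {y : ℝ} (hy : 0 < y) :
    HasDerivAt (halfLinePolylog (x * letterSum)) (halfLinePolylog x y / y) y := by
  have h := (hasDerivAt_halfLinePolylog_mul_zero x hx hy).add
    (hasDerivAt_halfLinePolylog_mul_one x hy)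
  refine (h.congr_of_eventuallyEq ?_).congr_deriv ?_
  · filter_upwards [lt_mem_nhds hy] with z hz
    rw [letterSum, mul_add, halfLinePolylog_add _ _ hz.le]
    rfl
  · field_simp

theorem constantCoeff_polylogSeries_mul_letterSum_pow {x : NCPoly}
    (hx : PowerSeries.constantCoeff (polylogSeries x) = 0) (n : ℕ) :
    PowerSeries.constantCoeff (polylogSeries (x * letterSum ^ n)) = 0 := by
  cases n with
  | zero => simpa using hx
  | succ n =>
    rw [pow_succ, ← mul_assoc, letterSum, mul_add, map_add, map_add,
      constantCoeff_polylogSeries_mul_letter, constantCoeff_polylogSeries_mul_letter, add_zero]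

theorem constantCoeff_polylogSeries_letter (u : Fin 2) :
    PowerSeries.constantCoeff (polylogSeries (letter u)) = 0 := by
  simpa using constantCoeff_polylogSeries_mul_letter 1 u

theorem halfLinePolylog_zero_right {x : NCPoly}
    (hx : PowerSeries.constantCoeff (polylogSeries x) = 0) : halfLinePolylog x 0 = 0 := by
  rw [halfLinePolylog, zero_div, polylog_zero_right, hx]

/-- The function `-Li_j(-y)`. -/
noncomputable def negPolylog : ℕ → ℝ → ℝ
  | 0, y => y / (1 + y)
  | j + 1, y => halfLinePolylog (letter 1 * letterSum ^ j) y

theorem negPolylog_zero_right (j : ℕ) : negPolylog j 0 = 0 := by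
  cases j with
  | zero => simp [negPolylog]
  | succ j =>
    exact halfLinePolylog_zero_right
      (constantCoeff_polylogSeries_mul_letterSum_pow (constantCoeff_polylogSeries_letter 1) j)

theorem continuousAt_negPolylog (j : ℕ) {y : ℝ} (hy : 0 ≤ y) : ContinuousAt (negPolylog j) y := by
  cases j with
  | zero => exact (hasDerivAt_div_one_add hy).continuousAt
  | succ j => exact continuousAt_halfLinePolylog _ hy

theorem negPolylog_one {y : ℝ} (hy : 0 ≤ y) : negPolylog 1 y = Real.log (1 + y) := by
  have h : polylog (letter 1) (y / (1 + y)) = _ := polylog_letter_one (div_one_add_mem hy)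
  rw [negPolylog, pow_zero, mul_one, halfLinePolylog, h,
    show 1 - y / (1 + y) = (1 + y)⁻¹ by field_simp; ring, Real.log_inv, neg_neg]

theorem hasDerivAt_negPolylog_succ (j : ℕ) {y : ℝ} (hy : 0 < y) :
    HasDerivAt (negPolylog (j + 1)) (negPolylog j y / y) y := by
  cases j with
  | zero =>
    have h := ((hasDerivAt_id y).const_add 1).log (by simp; positivity)
    refine (h.congr_of_eventuallyEq ?_).congr_deriv ?_
    · filter_upwards [lt_mem_nhds hy] with z hz using negPolylog_one hz.le
    · simp only [negPolylog, id]
      field_simp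
  | succ j =>
    refine (hasDerivAt_halfLinePolylog_mul_letterSum (letter 1 * letterSum ^ j)
      (constantCoeff_polylogSeries_mul_letterSum_pow (constantCoeff_polylogSeries_letter 1) j)
      hy).congr_of_eventuallyEq (Eventually.of_forall fun z => ?_)
    rw [negPolylog, pow_succ, mul_assoc]

theorem hasDerivAt_negPolylog_zero {y : ℝ} (hy : 0 ≤ y) :
    HasDerivAt (negPolylog 0) (1 / (1 + y) ^ 2) y := hasDerivAt_div_one_add hy

theorem monotoneOn_Ici_of_hasDerivAt {f f' : ℝ → ℝ} (hc : ∀ y, 0 ≤ y → ContinuousAt f y)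
    (hf : ∀ y, 0 < y → HasDerivAt f (f' y) y) (h0 : ∀ y, 0 < y → 0 ≤ f' y) :
    MonotoneOn f (Set.Ici 0) := by
  refine monotoneOn_of_deriv_nonneg (convex_Ici 0)
    (fun y hy => (hc y hy).continuousWithinAt) ?_ ?_ <;> rw [interior_Ici]
  · exact fun y hy => (hf y hy).differentiableAt.differentiableWithinAt
  · intro y hy
    rw [(hf y hy).deriv]
    exact h0 y hy

theorem monotoneOn_negPolylog (j : ℕ) : MonotoneOn (negPolylog j) (Set.Ici 0) := by
  induction j with
  | zero =>
    exact monotoneOn_Ici_of_hasDerivAt (fun y hy => continuousAt_negPolylog 0 hy)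
      (fun y hy => hasDerivAt_negPolylog_zero hy.le) (fun y hy => by positivity)
  | succ j ih =>
    refine monotoneOn_Ici_of_hasDerivAt (fun y hy => continuousAt_negPolylog _ hy)
      (fun y hy => hasDerivAt_negPolylog_succ j hy) (fun y hy => div_nonneg ?_ hy.le)
    rw [← negPolylog_zero_right j]
    exact ih Set.self_mem_Ici hy.le hy.le

theorem negPolylog_nonneg (j : ℕ) {y : ℝ} (hy : 0 ≤ y) : 0 ≤ negPolylog j y := by
  rw [← negPolylog_zero_right j]
  exact monotoneOn_negPolylog j Set.self_mem_Ici hy hy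

/-- The operator y d/dy lowers j by one and halves √y, so each step costs a factor 2; the base case
is 2√y ≤ (1+y)². Monotonicity yields the growth bound and the bound on increments at once. -/
theorem monotoneOn_sqrt_sub_negPolylog (j : ℕ) :
    MonotoneOn (fun y => 2 ^ j * √y - negPolylog j y) (Set.Ici 0) := by
  have hc : ∀ j : ℕ, ∀ y : ℝ, 0 ≤ y → ContinuousAt (fun y => 2 ^ j * √y - negPolylog j y) y :=
    fun j y hy => ContinuousAt.sub (by fun_prop) (continuousAt_negPolylog j hy)
  have hd : ∀ j : ℕ, ∀ y : ℝ, 0 < y → ∀ d, HasDerivAt (negPolylog j) d y →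
      HasDerivAt (fun y => 2 ^ j * √y - negPolylog j y) (2 ^ j * (1 / (2 * √y)) - d) y :=
    fun j y hy d h => (((Real.hasDerivAt_sqrt hy.ne').const_mul _).sub h)
  induction j with
  | zero =>
    refine monotoneOn_Ici_of_hasDerivAt (hc 0)
      (fun y hy => hd 0 y hy _ (hasDerivAt_negPolylog_zero hy.le)) (fun y hy => ?_)
    have hs := Real.sqrt_pos.2 hy
    have hs2 := Real.sq_sqrt hy.le
    rw [pow_zero, one_mul, sub_nonneg]
    refine one_div_le_one_div_of_le (by positivity) ?_
    nlinarith [sq_nonneg (√y - 1)]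
  | succ j ih =>
    refine monotoneOn_Ici_of_hasDerivAt (hc (j + 1))
      (fun y hy => hd (j + 1) y hy _ (hasDerivAt_negPolylog_succ j hy)) (fun y hy => ?_)
    have hs := Real.sqrt_pos.2 hy
    have h0 : 0 ≤ 2 ^ j * √y - negPolylog j y := by
      have := ih Set.self_mem_Ici hy.le hy.le
      simpa [negPolylog_zero_right] using this
    have : (2 : ℝ) ^ (j + 1) * (1 / (2 * √y)) = 2 ^ j * √y / y := by
      have hs2 := Real.sq_sqrt hy.le
      rw [pow_succ]
      field_simp
      linarith
    rw [this, ← sub_div]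
    exact div_nonneg h0 hy.le

theorem negPolylog_le (j : ℕ) {y : ℝ} (hy : 0 ≤ y) : negPolylog j y ≤ 2 ^ j * √y := by
  have := monotoneOn_sqrt_sub_negPolylog j Set.self_mem_Ici hy hy
  simp only [negPolylog_zero_right, Real.sqrt_zero] at this
  linarith

/-- The factor 1 - u compensates the pole of 1/(1-u) in the slope integrals. -/
theorem negPolylog_sub_mem {j : ℕ} {u y : ℝ} (hy : 0 ≤ y) (hu : u ∈ Set.Ioo (0 : ℝ) 1) :
    0 ≤ negPolylog j y - negPolylog j (u * y) ∧
      negPolylog j y - negPolylog j (u * y) ≤ 2 ^ j * √y * (1 - u) := by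
  obtain ⟨h0, h1⟩ := hu
  have huy : 0 ≤ u * y := by positivity
  have hle : u * y ≤ y := mul_le_of_le_one_left hy h1.le
  refine ⟨sub_nonneg.2 (monotoneOn_negPolylog j huy hy hle), ?_⟩
  have h := monotoneOn_sqrt_sub_negPolylog j huy hy hle
  simp only [Real.sqrt_mul h0.le] at h
  have hs : u ≤ √u := Real.le_sqrt_of_sq_le (by nlinarith)
  calc _ ≤ 2 ^ j * √y * (1 - √u) := by linarith
    _ ≤ _ := by gcongr

end InversePolylog

end FMZV

namespace FMZV

/-! ### Integral representation of the classical polylogarithms -/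

section KernelIntegrals

open Filter Topology MeasureTheory

theorem abs_integral_logKernel_mul_le (a : ℕ) {h : ℝ → ℝ} {C : ℝ}
    (hh : ∀ u ∈ Set.Ioo (0 : ℝ) 1, |h u| ≤ C * u ^ (-(1 / 2) : ℝ)) :
    |∫ u in Set.Ioo (0 : ℝ) 1, logKernel a u * h u| ≤
      C * ∫ u in Set.Ioo (0 : ℝ) 1, logKernel a u * u ^ (-(1 / 2) : ℝ) := by
  rw [← integral_const_mul, ← Real.norm_eq_abs]
  refine norm_integral_le_of_norm_le ((integrableOn_logKernel_mul_rpow a).const_mul C)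
    ((ae_restrict_mem measurableSet_Ioo).mono fun u hu => ?_)
  rw [norm_mul, Real.norm_of_nonneg (logKernel_nonneg a hu.1 hu.2), Real.norm_eq_abs,
    mul_left_comm]
  exact mul_le_mul_of_nonneg_left (hh u hu) (logKernel_nonneg a hu.1 hu.2)

theorem le_mul_rpow_neg_half {x C u : ℝ} (hC : 0 ≤ C) (hx : x ≤ C) (hu : u ∈ Set.Ioo (0 : ℝ) 1) :
    x ≤ C * u ^ (-(1 / 2) : ℝ) :=
  hx.trans (le_mul_of_one_le_right hC (one_le_rpow_neg_half hu.1 hu.2))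

theorem integrableOn_logKernel_mul_of_abs_le (a : ℕ) {h : ℝ → ℝ} {C : ℝ}
    (hm : ContinuousOn h (Set.Ioo 0 1)) (hh : ∀ u ∈ Set.Ioo (0 : ℝ) 1, |h u| ≤ C) :
    IntegrableOn (fun u => logKernel a u * h u) (Set.Ioo 0 1) := by
  have hC : 0 ≤ C := (abs_nonneg _).trans (hh (1 / 2) (by norm_num))
  exact integrableOn_logKernel_mul_of_bounded a hm
    fun u hu => le_mul_rpow_neg_half hC (hh u hu) hu

theorem hasDerivAt_integral_logKernel_mul (a : ℕ) {h h' : ℝ → ℝ → ℝ} {s : Set ℝ} {y C C' : ℝ}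
    (hs : s ∈ 𝓝 y) (hc : ∀ z ∈ s, ContinuousOn (h z) (Set.Ioo 0 1))
    (hc' : ContinuousOn (h' y) (Set.Ioo 0 1)) (hb : ∀ u ∈ Set.Ioo (0 : ℝ) 1, |h y u| ≤ C)
    (hb' : ∀ u ∈ Set.Ioo (0 : ℝ) 1, ∀ z ∈ s, |h' z u| ≤ C')
    (hd : ∀ u ∈ Set.Ioo (0 : ℝ) 1, ∀ z ∈ s, HasDerivAt (fun z => h z u) (h' z u) z) :
    HasDerivAt (fun z => ∫ u in Set.Ioo (0 : ℝ) 1, logKernel a u * h z u)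
      (∫ u in Set.Ioo (0 : ℝ) 1, logKernel a u * h' y u) y := by
  have hmem := ae_restrict_mem (μ := volume) (measurableSet_Ioo (a := (0 : ℝ)) (b := 1))
  refine (hasDerivAt_integral_of_dominated_loc_of_deriv_le
    (F := fun z u => logKernel a u * h z u) (F' := fun z u => logKernel a u * h' z u)
    (bound := fun u => logKernel a u * C') hs ?_ ?_ ?_ ?_ ?_ ?_).2
  · filter_upwards [hs] with z hz
    exact (measurable_logKernel a).aestronglyMeasurable.mul
      ((hc z hz).aestronglyMeasurable measurableSet_Ioo)
  · exact integrableOn_logKernel_mul_of_abs_le a (hc y (mem_of_mem_nhds hs)) hb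
  · exact (measurable_logKernel a).aestronglyMeasurable.mul
      (hc'.aestronglyMeasurable measurableSet_Ioo)
  · filter_upwards [hmem] with u hu z hz
    rw [norm_mul, Real.norm_of_nonneg (logKernel_nonneg a hu.1 hu.2), Real.norm_eq_abs]
    exact mul_le_mul_of_nonneg_left (hb' u hu z hz) (logKernel_nonneg a hu.1 hu.2)
  · exact (integrableOn_logKernel a).mul_const C'
  · filter_upwards [hmem] with u hu z hz
    exact (hd u hu z hz).const_mul _

theorem continuousOn_one_add_mul_inv {y : ℝ} (hy : 0 < y) (c : ℝ) (n : ℕ) :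
    ContinuousOn (fun u => c / (1 + u * y) ^ n) (Set.Ioo 0 1) := by
  refine ContinuousOn.div continuousOn_const (by fun_prop) fun u hu => ?_
  have := hu.1
  positivity

theorem abs_div_one_add_mul_pow_le {y u c : ℝ} (hy : 0 < y) (hu : 0 < u) (hc : 0 ≤ c) (n : ℕ) :
    |c / (1 + u * y) ^ n| ≤ c := by
  rw [abs_of_nonneg (by positivity)]
  exact div_le_self hc (one_le_pow₀ (by nlinarith [mul_pos hu hy]))

theorem hasDerivAt_integral_logKernel_mul_div (a : ℕ) {y : ℝ} (hy : 0 < y) :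
    HasDerivAt (fun y => ∫ u in Set.Ioo (0 : ℝ) 1, logKernel a u * (y / (1 + u * y)))
      (∫ u in Set.Ioo (0 : ℝ) 1, logKernel a u * (1 / (1 + u * y) ^ 2)) y := by
  refine hasDerivAt_integral_logKernel_mul a (Ioi_mem_nhds hy) (C := y) (C' := 1)
    (h := fun y u => y / (1 + u * y)) (h' := fun y u => 1 / (1 + u * y) ^ 2) ?_ ?_ ?_ ?_ ?_
  · intro z hz
    simpa using continuousOn_one_add_mul_inv hz z 1
  · exact continuousOn_one_add_mul_inv hy 1 2
  · intro u hu
    simpa using abs_div_one_add_mul_pow_le hy hu.1 hy.le 1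
  · exact fun u hu z hz => abs_div_one_add_mul_pow_le hz hu.1 zero_le_one 2
  · intro u hu z hz
    have hu0 := hu.1
    have hz0 : 0 < z := hz
    have h := (hasDerivAt_id z).div (((hasDerivAt_id z).const_mul u).const_add 1)
      (by simp; positivity)
    refine h.congr_deriv ?_
    simp only [id]
    congr 1
    ring

theorem tendsto_logKernel_mul_div_zero (a : ℕ) (y : ℝ) :
    Tendsto (fun u => logKernel a u * (u / (1 + u * y))) (𝓝[>] 0) (𝓝 0) := by
  have h1 : Tendsto (fun u : ℝ => 1 / (1 + u * y)) (𝓝[>] 0) (𝓝 1) := by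
    have : ContinuousAt (fun u : ℝ => 1 / (1 + u * y)) 0 :=
      ContinuousAt.div continuousAt_const (by fun_prop) (by simp)
    have h := this.tendsto
    simp only [zero_mul, add_zero, div_one] at h
    exact h.mono_left nhdsWithin_le_nhds
  have := (tendsto_logKernel_mul_self a).mul h1
  rw [zero_mul] at this
  refine this.congr fun u => ?_
  ring

theorem tendsto_logKernel_mul_div_one (a : ℕ) {y : ℝ} (hy : 0 < y) :
    Tendsto (fun u => logKernel a u * (u / (1 + u * y))) (𝓝[<] 1)
      (𝓝 (logKernel a 1 * (1 / (1 + y)))) := by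
  have : ContinuousAt (fun u : ℝ => logKernel a u * (u / (1 + u * y))) 1 :=
    (continuousAt_logKernel a one_ne_zero).mul
      (ContinuousAt.div continuousAt_id (by fun_prop) (by simp; positivity))
  have h := this.tendsto
  rw [one_mul] at h
  exact h.mono_left nhdsWithin_le_nhds

theorem hasDerivAt_div_one_add_mul {y u : ℝ} (hy : 0 < y) (hu : 0 < u) :
    HasDerivAt (fun u => u / (1 + u * y)) (1 / (1 + u * y) ^ 2) u := by
  have h := (hasDerivAt_id u).div (((hasDerivAt_id u).mul_const y).const_add 1)
    (by simp; positivity)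
  refine h.congr_deriv ?_
  simp only [id]
  congr 1
  ring

theorem integral_logKernel_zero_div_sq {y : ℝ} (hy : 0 < y) :
    ∫ u in Set.Ioo (0 : ℝ) 1, logKernel 0 u * (1 / (1 + u * y) ^ 2) = 1 / (1 + y) := by
  have h := integral_Ioo_eq_sub_of_hasDerivAt
    (f := fun u => logKernel 0 u * (u / (1 + u * y)))
    (f' := fun u => logKernel 0 u * (1 / (1 + u * y) ^ 2)) (fun u hu => ?_) ?_
    (tendsto_logKernel_mul_div_zero 0 y) (tendsto_logKernel_mul_div_one 0 hy)
  · rw [h, logKernel_zero]; ring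
  · simp only [logKernel_zero, one_mul]
    exact hasDerivAt_div_one_add_mul hy hu.1
  · exact integrableOn_logKernel_mul_of_abs_le 0 (continuousOn_one_add_mul_inv hy 1 2)
      fun u hu => abs_div_one_add_mul_pow_le hy hu.1 zero_le_one 2

/-- Integration by parts with primitive u/(1+uy). The boundary terms vanish, since the kernel of
positive order is 0 at u = 1 and u times it tends to 0 at u = 0. -/
theorem integral_logKernel_succ_div_sq (a : ℕ) {y : ℝ} (hy : 0 < y) :
    ∫ u in Set.Ioo (0 : ℝ) 1, logKernel (a + 1) u * (1 / (1 + u * y) ^ 2) =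
      ∫ u in Set.Ioo (0 : ℝ) 1, logKernel a u * (1 / (1 + u * y)) := by
  have hi1 : IntegrableOn (fun u => logKernel (a + 1) u * (1 / (1 + u * y) ^ 2)) (Set.Ioo 0 1) :=
    integrableOn_logKernel_mul_of_abs_le _ (continuousOn_one_add_mul_inv hy 1 2)
      fun u hu => abs_div_one_add_mul_pow_le hy hu.1 zero_le_one 2
  have hi2 : IntegrableOn (fun u => logKernel a u * (1 / (1 + u * y))) (Set.Ioo 0 1) := by
    simpa using integrableOn_logKernel_mul_of_abs_le a (continuousOn_one_add_mul_inv hy 1 1)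
      fun u hu => abs_div_one_add_mul_pow_le hy hu.1 zero_le_one 1
  rw [← sub_eq_zero, ← integral_sub hi1 hi2]
  have h := integral_Ioo_eq_sub_of_hasDerivAt
    (f := fun u => logKernel (a + 1) u * (u / (1 + u * y)))
    (f' := fun u => logKernel (a + 1) u * (1 / (1 + u * y) ^ 2) -
      logKernel a u * (1 / (1 + u * y))) (fun u hu => ?_) (hi1.sub hi2)
    (tendsto_logKernel_mul_div_zero (a + 1) y) (tendsto_logKernel_mul_div_one (a + 1) hy)
  · rw [h, logKernel_succ_one]; ring
  · have hu0 := hu.1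
    refine ((hasDerivAt_logKernel_succ a hu.1.ne').mul
      (hasDerivAt_div_one_add_mul hy hu.1)).congr_deriv ?_
    field_simp
    ring

theorem tendsto_integral_logKernel_mul_zero (a : ℕ) {h : ℝ → ℝ → ℝ} {B : ℝ → ℝ}
    (hh : ∀ y, 0 < y → ∀ u ∈ Set.Ioo (0 : ℝ) 1, |h y u| ≤ B y) (hB : Tendsto B (𝓝 0) (𝓝 0)) :
    Tendsto (fun y => ∫ u in Set.Ioo (0 : ℝ) 1, logKernel a u * h y u) (𝓝[>] 0) (𝓝 0) := by
  have hB' := (hB.mono_left (nhdsWithin_le_nhds (s := Set.Ioi 0))).mul_const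
    (∫ u in Set.Ioo (0 : ℝ) 1, logKernel a u * u ^ (-(1 / 2) : ℝ))
  rw [zero_mul] at hB'
  refine squeeze_zero_norm' ?_ hB'
  filter_upwards [self_mem_nhdsWithin] with y hy
  have hB0 : 0 ≤ B y := (abs_nonneg _).trans (hh y hy (1 / 2) (by norm_num))
  exact abs_integral_logKernel_mul_le a fun u hu => le_mul_rpow_neg_half hB0 (hh y hy u hu) hu

theorem tendsto_negPolylog_zero (j : ℕ) : Tendsto (negPolylog j) (𝓝[>] 0) (𝓝 0) := by
  have h := (continuousAt_negPolylog j le_rfl).tendsto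
  rw [negPolylog_zero_right] at h
  exact h.mono_left nhdsWithin_le_nhds

/-- Both sides tend to 0 as y → 0. Differentiating the integral and integrating by parts lowers a,
exactly as y d/dy lowers the order on the right. -/
theorem integral_logKernel_mul_div (a : ℕ) {y : ℝ} (hy : 0 < y) :
    ∫ u in Set.Ioo (0 : ℝ) 1, logKernel a u * (y / (1 + u * y)) = negPolylog (a + 1) y := by
  have hlim : ∀ a : ℕ, Tendsto (fun y => ∫ u in Set.Ioo (0 : ℝ) 1,
      logKernel a u * (y / (1 + u * y))) (𝓝[>] 0) (𝓝 0) := fun a =>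
    tendsto_integral_logKernel_mul_zero a (B := fun y => y)
      (fun y hy u hu => by simpa using abs_div_one_add_mul_pow_le hy hu.1 hy.le 1) tendsto_id
  induction a generalizing y with
  | zero =>
    refine eqOn_of_hasDerivAt_of_tendsto (l := 𝓝[>] (0 : ℝ)) isOpen_Ioi isPreconnected_Ioi (fun z hz => ?_)
      (fun z hz => hasDerivAt_negPolylog_succ 0 hz) self_mem_nhdsWithin (hlim 0)
      (tendsto_negPolylog_zero _) hy
    refine (hasDerivAt_integral_logKernel_mul_div 0 hz).congr_deriv ?_
    have hz0 : 0 < z := hz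
    rw [integral_logKernel_zero_div_sq hz, negPolylog]
    field_simp
  | succ a ih =>
    refine eqOn_of_hasDerivAt_of_tendsto (l := 𝓝[>] (0 : ℝ)) isOpen_Ioi isPreconnected_Ioi (fun z hz => ?_)
      (fun z hz => hasDerivAt_negPolylog_succ (a + 1) hz) self_mem_nhdsWithin (hlim (a + 1))
      (tendsto_negPolylog_zero _) hy
    refine (hasDerivAt_integral_logKernel_mul_div (a + 1) hz).congr_deriv ?_
    have hz0 : 0 < z := hz
    rw [integral_logKernel_succ_div_sq a hz, ← ih hz, eq_div_iff hz0.ne', ← integral_mul_const]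
    congr 1
    ext u
    ring

end KernelIntegrals

/-! ### Zeta values as kernel integrals -/

section ZetaIntegrals

open Filter Topology MeasureTheory

/-- From log x ≤ x - 1 at x = u^(-1/2), then 1 ≥ u^(1/2). The factor 1 - u makes the kernel
integrable against 1/(1-u). -/
theorem neg_log_le_mul_rpow {u : ℝ} (hu : u ∈ Set.Ioo (0 : ℝ) 1) :
    -Real.log u ≤ 2 * u ^ (-(1 / 2) : ℝ) * (1 - u) := by
  obtain ⟨h0, h1⟩ := hu
  have hp : 0 < u ^ (-(1 / 2) : ℝ) := by positivity
  have h := Real.log_le_sub_one_of_pos hp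
  rw [Real.log_rpow h0] at h
  have hs : u ^ (-(1 / 2) : ℝ) * u ≤ 1 := by
    nth_rewrite 2 [← Real.rpow_one u]
    rw [← Real.rpow_add h0]
    exact Real.rpow_le_one h0.le h1.le (by norm_num)
  nlinarith

theorem logKernel_succ (a : ℕ) (u : ℝ) :
    logKernel (a + 1) u = logKernel a u * (-Real.log u / (a + 1)) := by
  unfold logKernel
  rw [Nat.factorial_succ, pow_succ]
  push_cast
  rw [div_mul_div_comm, mul_comm ((a : ℝ) + 1)]

theorem integrableOn_logKernel_succ_div (a : ℕ) :
    IntegrableOn (fun u => logKernel (a + 1) u * (1 / (1 - u))) (Set.Ioo 0 1) := by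
  have hne : ∀ u ∈ Set.Ioo (0 : ℝ) 1, 1 - u ≠ 0 := fun u hu => (sub_pos.2 hu.2).ne'
  have h := integrableOn_logKernel_mul_of_bounded a (C := 2)
    (h := fun u => -Real.log u / (a + 1) * (1 / (1 - u))) ?_ ?_
  · simpa only [logKernel_succ, mul_assoc] using h
  · exact ((Real.continuousOn_log.mono fun u hu => hu.1.ne').neg.div_const _).mul
      (ContinuousOn.div continuousOn_const (by fun_prop) hne)
  · intro u hu
    have hl := Real.log_neg hu.1 hu.2
    have hu1 : 0 < 1 - u := sub_pos.2 hu.2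
    have hl' : 0 ≤ -Real.log u := by linarith
    rw [abs_of_nonneg (by positivity), mul_one_div, div_le_iff₀ hu1]
    exact (div_le_self hl' (by linarith [(Nat.cast_nonneg a : (0 : ℝ) ≤ a)])).trans (neg_log_le_mul_rpow hu)

theorem tendsto_polylog_letter_one_pow_mul_zero (k : ℕ) :
    Tendsto (polylog (letter 1 ^ (k + 1) * letter 0)) (𝓝[<] 1) (𝓝 (zetaNat (k + 2))) := by
  have h := polylog_letter_one_pow_mul_zero_expansion k 0
  simp only [Polynomial.eval_C, pow_zero, mul_one] at h
  simpa using h.add_const (zetaNat (k + 2))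

theorem polylog_letter_one_pow_one_sub (k : ℕ) {u : ℝ} (hu : u ∈ Set.Ioo (0 : ℝ) 1) :
    polylog (letter 1 ^ k) (1 - u) = logKernel k u := by
  rw [polylog_letter_one_pow k (by rw [abs_lt]; constructor <;> linarith [hu.1, hu.2]), logKernel,
    sub_sub_cancel]

theorem constantCoeff_polylogSeries_letter_one_pow (k : ℕ) :
    PowerSeries.constantCoeff (polylogSeries (letter 1 ^ (k + 1))) = 0 := by
  rw [pow_succ, constantCoeff_polylogSeries_mul_letter]

theorem hasDerivAt_polylog_one_sub (k : ℕ) {u : ℝ} (hu : u ∈ Set.Ioo (0 : ℝ) 1) :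
    HasDerivAt (fun u => polylog (letter 1 ^ (k + 1) * letter 0) (1 - u))
      (-(logKernel (k + 1) u * (1 / (1 - u)))) u := by
  have hu1 : 0 < 1 - u := sub_pos.2 hu.2
  have h := HasDerivAt.comp u (hasDerivAt_polylog_mul_zero (letter 1 ^ (k + 1))
    (constantCoeff_polylogSeries_letter_one_pow k) (t := 1 - u) hu1.ne'
    (by rw [abs_lt]; constructor <;> linarith [hu.1, hu.2])) ((hasDerivAt_id u).const_sub 1)
  refine h.congr_deriv ?_
  rw [polylog_letter_one_pow_one_sub _ hu]
  ring

theorem tendsto_polylog_one_sub_zero (k : ℕ) :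
    Tendsto (fun u => polylog (letter 1 ^ (k + 1) * letter 0) (1 - u)) (𝓝[>] 0)
      (𝓝 (zetaNat (k + 2))) := by
  refine (tendsto_polylog_letter_one_pow_mul_zero k).comp ?_
  refine tendsto_nhdsWithin_iff.2 ⟨?_, ?_⟩
  · have : Tendsto (fun u : ℝ => 1 - u) (𝓝 0) (𝓝 (1 - 0)) := (continuous_const.sub continuous_id).tendsto 0
    rw [sub_zero] at this
    exact this.mono_left nhdsWithin_le_nhds
  · filter_upwards [self_mem_nhdsWithin] with u hu
    simpa using hu

theorem tendsto_polylog_one_sub_one (k : ℕ) :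
    Tendsto (fun u => polylog (letter 1 ^ (k + 1) * letter 0) (1 - u)) (𝓝[<] 1) (𝓝 0) := by
  have h0 : polylog (letter 1 ^ (k + 1) * letter 0) 0 = 0 := by
    rw [polylog_zero_right, constantCoeff_polylogSeries_mul_letter]
  have hc : ContinuousAt (fun u => polylog (letter 1 ^ (k + 1) * letter 0) (1 - u)) 1 :=
    ContinuousAt.comp (f := fun u : ℝ => 1 - u) (continuousAt_polylog _ (by simp)) (by fun_prop)
  have h := hc.tendsto
  rw [sub_self, h0] at h
  exact h.mono_left nhdsWithin_le_nhds

/-- At 1 - u the polylogarithm of e₁^k is the kernel itself, so that of e₁^(k+1) e₀ at 1 - u is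
minus a primitive; its limit at u = 0 is ζ(k+2) by duality. -/
theorem integral_logKernel_div_one_sub (k : ℕ) :
    ∫ u in Set.Ioo (0 : ℝ) 1, logKernel (k + 1) u * (1 / (1 - u)) = zetaNat (k + 2) := by
  have h := integral_Ioo_eq_sub_of_hasDerivAt
    (fun u hu => (hasDerivAt_polylog_one_sub k hu).neg.congr_deriv (neg_neg _))
    (integrableOn_logKernel_succ_div k) (tendsto_polylog_one_sub_zero k).neg
    (tendsto_polylog_one_sub_one k).neg
  rw [h]
  ring

theorem logKernel_sq (k : ℕ) (u : ℝ) : logKernel k (u ^ 2) = 2 ^ k * logKernel k u := by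
  unfold logKernel
  rw [Real.log_pow, mul_div_assoc', ← mul_pow]
  push_cast
  rw [neg_mul_eq_mul_neg]

/-- The relation between the alternating and the ordinary zeta value comes from 1/(1+u) = 1/(1-u) -
2u/(1-u²): the last term is handled by u ↦ u², under which the kernel of order k + 1 scales by
2^(k+1). -/
theorem negPolylog_add_two_one (k : ℕ) :
    negPolylog (k + 2) 1 = (1 - 1 / 2 ^ (k + 1)) * zetaNat (k + 2) := by
  have hsq0 : Tendsto (fun u : ℝ => u ^ 2) (𝓝[>] 0) (𝓝[>] 0) := by
    refine tendsto_nhdsWithin_iff.2 ⟨?_, ?_⟩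
    · have : Tendsto (fun u : ℝ => u ^ 2) (𝓝 0) (𝓝 (0 ^ 2)) := (continuous_pow 2).tendsto 0
      rw [zero_pow two_ne_zero] at this
      exact this.mono_left nhdsWithin_le_nhds
    · filter_upwards [self_mem_nhdsWithin] with u hu
      have : (0 : ℝ) < u := hu
      exact pow_pos this 2
  have hsq1 : Tendsto (fun u : ℝ => u ^ 2) (𝓝[<] 1) (𝓝[<] 1) := by
    refine tendsto_nhdsWithin_iff.2 ⟨?_, ?_⟩
    · have : Tendsto (fun u : ℝ => u ^ 2) (𝓝 1) (𝓝 (1 ^ 2)) := (continuous_pow 2).tendsto 1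
      rw [one_pow] at this
      exact this.mono_left nhdsWithin_le_nhds
    · filter_upwards [Ioo_mem_nhdsLT (zero_lt_one (α := ℝ))] with u hu
      exact pow_lt_one₀ hu.1.le hu.2 two_ne_zero
  have hd : ∀ u ∈ Set.Ioo (0 : ℝ) 1, HasDerivAt
      (fun u => 1 / 2 ^ (k + 1) * polylog (letter 1 ^ (k + 1) * letter 0) (1 - u ^ 2) -
        polylog (letter 1 ^ (k + 1) * letter 0) (1 - u))
      (logKernel (k + 1) u * (1 / (1 + u * 1))) u := by
    intro u hu
    have hu2 : u ^ 2 ∈ Set.Ioo (0 : ℝ) 1 := ⟨pow_pos hu.1 2, pow_lt_one₀ hu.1.le hu.2 two_ne_zero⟩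
    have h := ((HasDerivAt.comp (h := fun u : ℝ => u ^ 2) u (hasDerivAt_polylog_one_sub k hu2)
      (hasDerivAt_pow 2 u)).const_mul
      (1 / 2 ^ (k + 1) : ℝ)).sub (hasDerivAt_polylog_one_sub k hu)
    refine h.congr_deriv ?_
    have h1 : 1 - u ≠ 0 := (sub_pos.2 hu.2).ne'
    have h2 : 1 + u ≠ 0 := by linarith [hu.1]
    rw [logKernel_sq, show (1 : ℝ) - u ^ 2 = (1 - u) * (1 + u) by ring, mul_one]
    push_cast
    field_simp
    ring
  have h := integral_Ioo_eq_sub_of_hasDerivAt hd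
    (integrableOn_logKernel_mul_of_abs_le (k + 1)
      (by simpa only [pow_one] using continuousOn_one_add_mul_inv zero_lt_one 1 1)
      (fun u hu => by simpa only [pow_one] using
        abs_div_one_add_mul_pow_le zero_lt_one hu.1 zero_le_one 1))
    ((((tendsto_polylog_one_sub_zero k).comp hsq0).const_mul _).sub (tendsto_polylog_one_sub_zero k))
    ((((tendsto_polylog_one_sub_one k).comp hsq1).const_mul _).sub (tendsto_polylog_one_sub_one k))
  rw [← integral_logKernel_mul_div (k + 1) zero_lt_one, h]
  ring

end ZetaIntegrals

end FMZV

namespace FMZV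

/-! ### Inversion y ↔ 1/y -/

section LogPolynomials

/-- The polynomial `∑ pᵢ X^(j-i) / (j-i)!`. -/
noncomputable def logPoly (p : ℕ → ℝ) (j : ℕ) : Polynomial ℝ :=
  ∑ i ∈ Finset.range (j + 1), Polynomial.C (p i / (j - i).factorial) * Polynomial.X ^ (j - i)

/-- These polynomials are the coefficients of p(T) exp(xT), so their addition formula is that of the
exponential. -/
theorem eval_logPoly (p : ℕ → ℝ) (j : ℕ) (x : ℝ) : (logPoly p j).eval x =
    PowerSeries.coeff j (PowerSeries.mk p * PowerSeries.rescale x (PowerSeries.exp ℝ)) := by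
  rw [PowerSeries.coeff_mul, Finset.Nat.sum_antidiagonal_eq_sum_range_succ_mk, logPoly,
    Polynomial.eval_finsetSum]
  refine Finset.sum_congr rfl fun i _ => ?_
  simp [PowerSeries.coeff_exp]
  ring

theorem eval_logPoly_add (p : ℕ → ℝ) (j : ℕ) (x h : ℝ) : (logPoly p j).eval (x + h) =
    ∑ i ∈ Finset.range (j + 1), (logPoly p (j - i)).eval x * (h ^ i / i.factorial) := by
  rw [eval_logPoly, ← PowerSeries.exp_mul_exp_eq_exp_add, ← mul_assoc, mul_comm,
    PowerSeries.coeff_mul, Finset.Nat.sum_antidiagonal_eq_sum_range_succ_mk]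
  refine Finset.sum_congr rfl fun i _ => ?_
  simp [eval_logPoly, PowerSeries.coeff_exp]
  ring

theorem coeff_zero_logPoly (p : ℕ → ℝ) (j : ℕ) : (logPoly p j).coeff 0 = p j := by
  rw [Polynomial.coeff_zero_eq_eval_zero, eval_logPoly]
  simp

theorem eval_one_logPoly_zero (p : ℕ → ℝ) (x : ℝ) : (logPoly p 0).eval x = p 0 := by
  simp [logPoly]

theorem derivative_logPoly_succ (p : ℕ → ℝ) (j : ℕ) :
    Polynomial.derivative (logPoly p (j + 1)) = logPoly p j := by
  rw [logPoly, Finset.sum_range_succ, map_add, map_sum, logPoly]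
  simp only [Nat.sub_self, pow_zero, mul_one, Polynomial.derivative_C, add_zero]
  refine Finset.sum_congr rfl fun i hi => ?_
  have hi' : j + 1 - i = (j - i) + 1 := by have := Finset.mem_range.1 hi; omega
  rw [hi', Polynomial.derivative_C_mul, Polynomial.derivative_X_pow, Nat.add_sub_cancel,
    ← mul_assoc, ← Polynomial.C_mul, Nat.factorial_succ]
  have : (((j - i : ℕ) : ℝ) + 1) ≠ 0 := by positivity
  congr 2
  push_cast
  field_simp

/-- The constants in the inversion formula of `negPolylog`. -/
noncomputable def inversionConst (i : ℕ) : ℝ := negPolylog i 1 * (1 + (-1) ^ i)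

/-- Induction on j: the two sides have equal derivatives by the case j - 1, and `inversionConst` is
the constant that makes them agree at y = 1. For j = 0 it reads y/(1+y) = 1 - y⁻¹/(1+y⁻¹). -/
theorem negPolylog_inversion (j : ℕ) {y : ℝ} (hy : 0 < y) :
    negPolylog j y =
      (logPoly inversionConst j).eval (Real.log y) + (-1) ^ (j + 1) * negPolylog j y⁻¹ := by
  induction j generalizing y with
  | zero =>
    rw [eval_one_logPoly_zero, inversionConst]
    simp only [negPolylog]
    field_simp
    ring
  | succ j ih =>
    refine eqOn_of_hasDerivAt_of_tendsto (l := pure (1 : ℝ)) (s := Set.Ioi 0) isOpen_Ioi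
      isPreconnected_Ioi (fun z hz => hasDerivAt_negPolylog_succ j hz)
      (g := fun y => (logPoly inversionConst (j + 1)).eval (Real.log y) +
        (-1) ^ (j + 1 + 1) * negPolylog (j + 1) y⁻¹) (fun z hz => ?_)
      (c := negPolylog (j + 1) 1) ?_ (tendsto_pure_nhds _ _) ?_ hy
    · have hz0 : 0 < z := hz
      have h1 := HasDerivAt.comp z ((logPoly inversionConst (j + 1)).hasDerivAt (Real.log z))
        (Real.hasDerivAt_log hz0.ne')
      have h2 := (HasDerivAt.comp z (hasDerivAt_negPolylog_succ j (inv_pos.2 hz0))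
        (hasDerivAt_inv hz0.ne')).const_mul ((-1 : ℝ) ^ (j + 1 + 1))
      refine (h1.add h2).congr_deriv ?_
      rw [derivative_logPoly_succ, ih hz0]
      field_simp
      ring
    · simp
    · have h : negPolylog (j + 1) 1 = (logPoly inversionConst (j + 1)).eval (Real.log 1) +
          (-1) ^ (j + 1 + 1) * negPolylog (j + 1) 1⁻¹ := by
        rw [Real.log_one, ← Polynomial.coeff_zero_eq_eval_zero, coeff_zero_logPoly, inversionConst,
          inv_one]
        ring
      rw [h]
      exact tendsto_pure_nhds (fun y : ℝ => (logPoly inversionConst (j + 1)).eval (Real.log y) +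
        (-1) ^ (j + 1 + 1) * negPolylog (j + 1) y⁻¹) 1

end LogPolynomials

/-! ### Integral representation of the mixed words -/

section SlopeIntegral

open Filter Topology MeasureTheory

theorem continuousOn_negPolylog_mul (j : ℕ) {c : ℝ} (hc : 0 < c) :
    ContinuousOn (fun u => negPolylog j (u * c)) (Set.Ioo 0 1) := fun u hu =>
  (ContinuousAt.comp (f := fun u : ℝ => u * c)
    (continuousAt_negPolylog j (mul_pos hu.1 hc).le) (by fun_prop)).continuousWithinAt

theorem continuousOn_negPolylog_slope (j : ℕ) {y : ℝ} (hy : 0 < y) :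
    ContinuousOn (fun u => (negPolylog j y - negPolylog j (u * y)) / (1 - u)) (Set.Ioo 0 1) :=
  ContinuousOn.div (continuousOn_const.sub (continuousOn_negPolylog_mul j hy)) (by fun_prop)
    fun _ hu => (sub_pos.2 hu.2).ne'

theorem abs_negPolylog_slope_le (j : ℕ) {u y : ℝ} (hy : 0 ≤ y) (hu : u ∈ Set.Ioo (0 : ℝ) 1) :
    |(negPolylog j y - negPolylog j (u * y)) / (1 - u)| ≤ 2 ^ j * √y := by
  have h := negPolylog_sub_mem (j := j) hy hu
  have hu1 : 0 < 1 - u := sub_pos.2 hu.2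
  rw [abs_of_nonneg (div_nonneg h.1 hu1.le), div_le_iff₀ hu1]
  exact h.2

theorem hasDerivAt_integral_negPolylog_slope (a j : ℕ) {y : ℝ} (hy : 0 < y) :
    HasDerivAt (fun y => ∫ u in Set.Ioo (0 : ℝ) 1,
        logKernel a u * ((negPolylog (j + 1) y - negPolylog (j + 1) (u * y)) / (1 - u)))
      ((∫ u in Set.Ioo (0 : ℝ) 1,
        logKernel a u * ((negPolylog j y - negPolylog j (u * y)) / (1 - u))) / y) y := by
  -- Staying above y/2 makes the derivative bound 2^j/√z uniform in z.
  have hy2 : 0 < y / 2 := by positivity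
  have h := hasDerivAt_integral_logKernel_mul a (Ioi_mem_nhds (half_lt_self hy))
    (h := fun y u => (negPolylog (j + 1) y - negPolylog (j + 1) (u * y)) / (1 - u))
    (h' := fun y u => (negPolylog j y - negPolylog j (u * y)) / (1 - u) / y)
    (C := 2 ^ (j + 1) * √y) (C' := 2 ^ j / √(y / 2)) ?_ ?_ ?_ ?_ ?_
  · refine h.congr_deriv ?_
    rw [div_eq_mul_inv, ← integral_mul_const]
    congr 1
    ext u
    ring
  · exact fun z hz => continuousOn_negPolylog_slope _ (hy2.trans hz)
  · exact (continuousOn_negPolylog_slope j hy).div_const y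
  · exact fun u hu => abs_negPolylog_slope_le _ hy.le hu
  · intro u hu z hz
    have hz0 : 0 < z := hy2.trans hz
    have hs := Real.sqrt_pos.2 hz0
    rw [abs_div, abs_of_pos hz0]
    calc _ ≤ 2 ^ j * √z / z := by
          gcongr
          exact abs_negPolylog_slope_le j hz0.le hu
      _ = 2 ^ j / √z := by
          rw [div_eq_div_iff hz0.ne' hs.ne', mul_assoc, Real.mul_self_sqrt hz0.le]
      _ ≤ _ := by
          have := Real.sqrt_pos.2 hy2
          gcongr
          exact le_of_lt hz
  · intro u hu z hz
    have hz0 : 0 < z := hy2.trans hz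
    have hu0 := hu.1
    have h2 := HasDerivAt.comp (h := fun z : ℝ => u * z) z
      (hasDerivAt_negPolylog_succ j (mul_pos hu0 hz0)) ((hasDerivAt_id z).const_mul u)
    refine (((hasDerivAt_negPolylog_succ j hz0).sub h2).div_const (1 - u)).congr_deriv ?_
    field_simp

/-- The slope of y/(1+y) is y/((1+y)(1+uy)), so the kernel integral of L_(a+1) reappears with the
factor 1/(1+y). -/
theorem integral_negPolylog_zero_slope (a : ℕ) {y : ℝ} (hy : 0 < y) :
    ∫ u in Set.Ioo (0 : ℝ) 1,
      logKernel a u * ((negPolylog 0 y - negPolylog 0 (u * y)) / (1 - u)) =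
      negPolylog (a + 1) y / (1 + y) := by
  rw [← integral_logKernel_mul_div a hy, div_eq_mul_inv, ← integral_mul_const]
  refine setIntegral_congr_fun measurableSet_Ioo fun u hu => ?_
  have hu1 : 1 - u ≠ 0 := (sub_pos.2 hu.2).ne'
  have hu0 := hu.1
  simp only [negPolylog]
  field_simp
  ring

theorem tendsto_halfLinePolylog_zero {x : NCPoly}
    (hx : PowerSeries.constantCoeff (polylogSeries x) = 0) :
    Tendsto (halfLinePolylog x) (𝓝[>] 0) (𝓝 0) := by
  have h := (continuousAt_halfLinePolylog x le_rfl).tendsto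
  rw [halfLinePolylog_zero_right hx] at h
  exact h.mono_left nhdsWithin_le_nhds

/-- Both sides tend to 0 at y = 0. For b = 0 the derivative of the integral is L_(a+1)(y)/(y(1+y)),
the effect of the letter e₀; afterwards each increase of b is an integration against dy/y, the
letter e₀ + e₁. -/
theorem integral_negPolylog_slope (a b : ℕ) {y : ℝ} (hy : 0 < y) :
    ∫ u in Set.Ioo (0 : ℝ) 1,
      logKernel a u * ((negPolylog (b + 1) y - negPolylog (b + 1) (u * y)) / (1 - u)) =
      halfLinePolylog (letter 1 * letterSum ^ a * letter 0 * letterSum ^ b) y := by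
  have hx0 : PowerSeries.constantCoeff (polylogSeries (letter 1 * letterSum ^ a * letter 0)) = 0 :=
    constantCoeff_polylogSeries_mul_letter _ _
  have hx := constantCoeff_polylogSeries_mul_letterSum_pow hx0
  have hlim : ∀ b : ℕ, Tendsto (fun y => ∫ u in Set.Ioo (0 : ℝ) 1, logKernel a u *
      ((negPolylog (b + 1) y - negPolylog (b + 1) (u * y)) / (1 - u))) (𝓝[>] 0) (𝓝 0) := fun b =>
    tendsto_integral_logKernel_mul_zero a (B := fun y => 2 ^ (b + 1) * √y)
      (fun y hy u hu => abs_negPolylog_slope_le _ hy.le hu) (by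
        have : Continuous fun y : ℝ => 2 ^ (b + 1) * √y := by fun_prop
        simpa using this.tendsto 0)
  induction b generalizing y with
  | zero =>
    refine eqOn_of_hasDerivAt_of_tendsto (l := 𝓝[>] (0 : ℝ)) isOpen_Ioi isPreconnected_Ioi
      (fun z hz => hasDerivAt_integral_negPolylog_slope a 0 hz) (fun z hz => ?_)
      self_mem_nhdsWithin (hlim 0) (tendsto_halfLinePolylog_zero (hx 0)) hy
    have h := hasDerivAt_halfLinePolylog_mul_zero (letter 1 * letterSum ^ a)
      (constantCoeff_polylogSeries_mul_letterSum_pow (constantCoeff_polylogSeries_letter 1) a) hz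
    rw [pow_zero, mul_one]
    refine h.congr_deriv ?_
    rw [integral_negPolylog_zero_slope a hz, negPolylog, div_div, mul_comm z]
  | succ b ih =>
    refine eqOn_of_hasDerivAt_of_tendsto (l := 𝓝[>] (0 : ℝ)) isOpen_Ioi isPreconnected_Ioi
      (fun z hz => hasDerivAt_integral_negPolylog_slope a (b + 1) hz) (fun z hz => ?_)
      self_mem_nhdsWithin (hlim (b + 1)) (tendsto_halfLinePolylog_zero (hx (b + 1))) hy
    have h := hasDerivAt_halfLinePolylog_mul_letterSum
      (letter 1 * letterSum ^ a * letter 0 * letterSum ^ b) (hx b) hz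
    rw [pow_succ, ← mul_assoc]
    refine h.congr_deriv ?_
    rw [ih hz]

end SlopeIntegral

/-! ### Expansion of the mixed words at infinity -/

section InfinityExpansion

open Filter Topology MeasureTheory

/-- Source of the binomial coefficients in `slopePoly`. -/
theorem logKernel_mul (a i : ℕ) (u : ℝ) :
    logKernel a u * logKernel i u = ((a + i).choose i : ℝ) * logKernel (a + i) u := by
  unfold logKernel
  rw [div_mul_div_comm, ← pow_add, mul_div_assoc', eq_div_iff (by positivity),
    div_mul_eq_mul_div, div_eq_iff (by positivity)]
  have := Nat.add_choose_mul_factorial_mul_factorial a i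
  rw [← this]
  push_cast
  ring

/-- The asymptotic expansion at infinity of the polylogarithm of `e₁ (e₀+e₁)^a e₀ (e₀+e₁)^b`. -/
noncomputable def slopePoly (a b : ℕ) : Polynomial ℝ :=
  ∑ i ∈ Finset.range (b + 1), Polynomial.C ((-1) ^ i * ((a + i + 1).choose (i + 1) : ℝ) *
    zetaNat (a + i + 2)) * logPoly inversionConst (b - i)

/-- Apply the inversion formula at y and at uy inside the slope integral. The polynomial parts
integrate to `slopePoly` at log y, and the remainders combine into another slope, which is of size
(uy)^(-1/2). -/
theorem abs_halfLinePolylog_sub_le (a b : ℕ) {y : ℝ} (hy : 0 < y) :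
    |halfLinePolylog (letter 1 * letterSum ^ a * letter 0 * letterSum ^ b) y -
      (slopePoly a b).eval (Real.log y)| ≤
      (2 ^ (b + 1) * ∫ u in Set.Ioo (0 : ℝ) 1, logKernel a u * u ^ (-(1 / 2) : ℝ)) * √y⁻¹ := by
  set L := Real.log y with hL
  set c : ℕ → ℝ := fun i => (-1) ^ i * ((a + i + 1).choose (i + 1) : ℝ) *
    (logPoly inversionConst (b - i)).eval L with hc
  have hQ : (slopePoly a b).eval L = ∫ u in Set.Ioo (0 : ℝ) 1, ∑ i ∈ Finset.range (b + 1),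
      c i * (logKernel (a + i + 1) u * (1 / (1 - u))) := by
    rw [integral_finsetSum _ fun i _ => (integrableOn_logKernel_succ_div (a + i)).const_mul _,
      slopePoly, Polynomial.eval_finsetSum]
    refine Finset.sum_congr rfl fun i _ => ?_
    rw [integral_const_mul, integral_logKernel_div_one_sub, Polynomial.eval_mul,
      Polynomial.eval_C, hc]
    ring
  have hi : IntegrableOn (fun u => ∑ i ∈ Finset.range (b + 1),
      c i * (logKernel (a + i + 1) u * (1 / (1 - u)))) (Set.Ioo 0 1) :=
    integrable_finsetSum _ fun i _ => (integrableOn_logKernel_succ_div (a + i)).const_mul _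
  have hi' := integrableOn_logKernel_mul_of_abs_le a (continuousOn_negPolylog_slope (b + 1) hy)
    fun u hu => abs_negPolylog_slope_le (b + 1) hy.le hu
  rw [hQ, ← integral_negPolylog_slope a b hy, ← integral_sub hi' hi]
  have hcongr : ∀ u ∈ Set.Ioo (0 : ℝ) 1,
      logKernel a u * ((negPolylog (b + 1) y - negPolylog (b + 1) (u * y)) / (1 - u)) -
        ∑ i ∈ Finset.range (b + 1), c i * (logKernel (a + i + 1) u * (1 / (1 - u))) =
      logKernel a u * ((-1) ^ (b + 2) * ((negPolylog (b + 1) (u * (u * y)⁻¹) -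
        negPolylog (b + 1) (u * y)⁻¹) / (1 - u))) := by
    intro u hu
    have hu0 := hu.1
    have hu1 : 1 - u ≠ 0 := (sub_pos.2 hu.2).ne'
    -- Hence the two inverted values form a slope based at (uy)⁻¹, so the bound on slopes applies
    -- again.
    have huy : u * (u * y)⁻¹ = y⁻¹ := by field_simp
    -- Expand at log(uy) = log y + log u; each power of log u becomes a kernel of positive order,
    -- which absorbs the pole at u = 1.
    have hmain : (logPoly inversionConst (b + 1)).eval (L + Real.log u) =
        (logPoly inversionConst (b + 1)).eval L - ∑ i ∈ Finset.range (b + 1),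
          (-1) ^ i * (logPoly inversionConst (b - i)).eval L * logKernel (i + 1) u := by
      rw [eval_logPoly_add, Finset.sum_range_succ', add_comm, sub_eq_add_neg,
        ← Finset.sum_neg_distrib]
      congr 1
      · simp
      · refine Finset.sum_congr rfl fun i _ => ?_
        rw [Nat.add_sub_add_right, logKernel, neg_pow (Real.log u), pow_succ (-1 : ℝ) i]
        have hs : ((-1 : ℝ) ^ i) * (-1) ^ i = 1 := by rw [← mul_pow]; simp
        linear_combination (-((logPoly inversionConst (b - i)).eval L *
          (Real.log u ^ (i + 1) / (i + 1).factorial))) * hs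
    have hsum : ∑ i ∈ Finset.range (b + 1), c i * (logKernel (a + i + 1) u * (1 / (1 - u))) =
        logKernel a u * ((∑ i ∈ Finset.range (b + 1), (-1) ^ i *
          (logPoly inversionConst (b - i)).eval L * logKernel (i + 1) u) / (1 - u)) := by
      rw [Finset.sum_div, Finset.mul_sum]
      refine Finset.sum_congr rfl fun i _ => ?_
      have := logKernel_mul a (i + 1) u
      rw [← add_assoc] at this
      rw [hc]
      linear_combination (-((-1) ^ i * (logPoly inversionConst (b - i)).eval L / (1 - u))) * this
    rw [hsum, huy, negPolylog_inversion (b + 1) hy,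
      negPolylog_inversion (b + 1) (mul_pos hu0 hy), Real.log_mul hu0.ne' hy.ne',
      add_comm (Real.log u), ← hL, hmain]
    ring
  rw [setIntegral_congr_fun measurableSet_Ioo hcongr]
  refine (abs_integral_logKernel_mul_le a (C := 2 ^ (b + 1) * √y⁻¹) fun u hu => ?_).trans_eq
    (by ring)
  have hu0 := hu.1
  have h := abs_negPolylog_slope_le (b + 1) (y := (u * y)⁻¹) (by positivity) hu
  rw [abs_mul, abs_pow, abs_neg, abs_one, one_pow, one_mul, ← neg_sub, neg_div, abs_neg]
  refine h.trans_eq ?_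
  rw [mul_inv, Real.sqrt_mul (by positivity), Real.rpow_neg hu0.le, ← Real.sqrt_eq_rpow,
    Real.sqrt_inv]
  ring

theorem hasLogExpansion_log_div :
    HasLogExpansion (fun t => Real.log (t / (1 - t))) Polynomial.X := by
  refine HasLogExpansion.of_bound (C := 2) (δ := 1) zero_lt_one ?_
  filter_upwards [Ioo_mem_nhdsLT (show (1 / 2 : ℝ) < 1 by norm_num)] with t ht
  have h0 : 0 < t := by linarith [ht.1]
  have h1 : 0 < 1 - t := sub_pos.2 ht.2
  rw [Polynomial.eval_X, Real.log_div h0.ne' h1.ne', sub_neg_eq_add, sub_add_cancel,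
    Real.rpow_one, abs_of_nonpos (Real.log_nonpos h0.le ht.2.le)]
  have h := Real.one_sub_inv_le_log_of_pos h0
  have : t⁻¹ - 1 ≤ 2 * (1 - t) := by
    rw [sub_le_iff_le_add, inv_le_iff_one_le_mul₀ h0]
    nlinarith [ht.1, ht.2]
  linarith

/-- Back in t, the error y^(-1/2) is of size (1-t)^(1/2), and log y = -log(1-t) + log t, where log t
is O(1-t); so the polynomial is unchanged. -/
theorem hasLogExpansion_polylog_of_halfLine {x : NCPoly} {Q : Polynomial ℝ} {C : ℝ}
    (h : ∀ y, 0 < y → |halfLinePolylog x y - Q.eval (Real.log y)| ≤ C * √y⁻¹) :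
    HasLogExpansion (polylog x) Q := by
  have hC : 0 ≤ C := by simpa using (abs_nonneg _).trans (h 1 one_pos)
  have hmem := Ioo_mem_nhdsLT (show (1 / 2 : ℝ) < 1 by norm_num)
  have h1 : HasLogExpansion (fun t => polylog x t - Q.eval (Real.log (t / (1 - t)))) 0 := by
    refine HasLogExpansion.of_bound (C := C * √2) (δ := 1 / 2) (by norm_num) ?_
    filter_upwards [hmem] with t ht
    have ht0 : 0 < t := by linarith [ht.1]
    have ht1 : 0 < 1 - t := sub_pos.2 ht.2
    have hy := h (t / (1 - t)) (by positivity)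
    have ht' : t / (1 - t) / (1 + t / (1 - t)) = t := by
      field_simp
      ring
    rw [halfLinePolylog, ht'] at hy
    rw [Polynomial.eval_zero, sub_zero]
    refine hy.trans ?_
    rw [mul_assoc, ← Real.sqrt_eq_rpow, ← Real.sqrt_mul zero_le_two, inv_div]
    gcongr
    rw [div_le_iff₀ ht0]
    nlinarith [ht.1]
  have h2 := h1.add (hasLogExpansion_log_div.eval Q)
  rw [zero_add, Polynomial.comp_X] at h2
  exact h2.congr (Eventually.of_forall fun t => by simp)

theorem hasLogExpansion_polylog_letterSum_pow (j : ℕ) :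
    HasLogExpansion (polylog (letter 1 * letterSum ^ j)) (logPoly inversionConst (j + 1)) := by
  refine hasLogExpansion_polylog_of_halfLine (C := 2 ^ (j + 1)) fun y hy => ?_
  have h := negPolylog_inversion (j + 1) hy
  have h' : halfLinePolylog (letter 1 * letterSum ^ j) y = negPolylog (j + 1) y := rfl
  have hy' : 0 ≤ y⁻¹ := by positivity
  rw [h', h, add_sub_cancel_left, abs_mul, abs_pow, abs_neg, abs_one, one_pow, one_mul,
    abs_of_nonneg (negPolylog_nonneg _ hy')]
  exact negPolylog_le _ hy'

theorem hasLogExpansion_polylog_letterSum_pow_mul (a b : ℕ) :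
    HasLogExpansion (polylog (letter 1 * letterSum ^ a * letter 0 * letterSum ^ b))
      (slopePoly a b) :=
  hasLogExpansion_polylog_of_halfLine fun _ hy => abs_halfLinePolylog_sub_le a b hy

theorem inversionConst_zero : inversionConst 0 = 1 := by
  simp only [inversionConst, negPolylog]
  norm_num

theorem coe_starSum_mzvSh_replicate_one (j : ℕ) :
    ((starSum mzvSh (List.replicate j 1) : MZVAlg) : ℝ) = inversionConst j := by
  cases j with
  | zero => rw [List.replicate_zero, starSum_nil, mzvSh_nil, inversionConst_zero, OneMemClass.coe_one]
  | succ j =>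
  rw [coe_starSum_mzvSh_eq (P := logPoly inversionConst (j + 1)), coeff_zero_logPoly]
  rw [starSum_eIndex_replicate_one]
  exact hasLogExpansion_polylog_letterSum_pow j

theorem coe_starSum_mzvSh_index121 (a b : ℕ) :
    ((starSum mzvSh (index121 a b) : MZVAlg) : ℝ) = ∑ i ∈ Finset.range (b + 1),
      (-1) ^ i * ((a + i + 1).choose (i + 1) : ℝ) * zetaNat (a + i + 2) *
        inversionConst (b - i) := by
  rw [coe_starSum_mzvSh_eq (P := slopePoly a b)]
  · simp only [slopePoly, Polynomial.finsetSum_coeff, Polynomial.coeff_C_mul, coeff_zero_logPoly]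
  · rw [starSum_eIndex_index121]
    exact hasLogExpansion_polylog_letterSum_pow_mul a b

end InfinityExpansion

end FMZV

namespace FMZV

/-! ### Reduction modulo ζ(2) and the star formula -/

section StarValues

theorem zetaNat_two : zetaNat 2 = Real.pi ^ 2 / 6 :=
  (hasSum_zetaNat le_rfl).unique hasSum_zeta_two

/-- Euler's evaluation: ζ(2n) is a rational multiple of π^(2n), and ζ(2) = π²/6. -/
theorem zetaNat_even (m : ℕ) : ∃ q : ℚ, zetaNat (2 * (m + 1)) = q * zetaNat 2 ^ (m + 1) := by
  refine ⟨(-1) ^ (m + 1 + 1) * 2 ^ (2 * (m + 1) - 1) * 6 ^ (m + 1) * bernoulli (2 * (m + 1)) /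
    (2 * (m + 1)).factorial, ?_⟩
  rw [(hasSum_zetaNat (by omega)).unique (hasSum_zeta_nat (k := m + 1) (by omega)), zetaNat_two,
    div_pow, ← pow_mul]
  push_cast
  field_simp

theorem inversionConst_odd (m : ℕ) : inversionConst (2 * m + 1) = 0 := by
  simp [inversionConst, pow_succ, pow_mul]

theorem inversionConst_even (m : ℕ) :
    ∃ q : ℚ, inversionConst (2 * (m + 1)) = q * zetaNat 2 ^ (m + 1) := by
  obtain ⟨q, hq⟩ := zetaNat_even m
  refine ⟨2 * (1 - 1 / 2 ^ (2 * m + 1)) * q, ?_⟩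
  have h := negPolylog_add_two_one (2 * m)
  rw [show 2 * m + 2 = 2 * (m + 1) by ring, hq] at h
  rw [inversionConst, h, pow_mul (-1 : ℝ)]
  push_cast
  norm_num
  ring

/-- In odd weight the inversion constant is 0, and in even weight a rational multiple of a positive
power of ζ(2); the cofactor is explicit and lies in 𝒵, so divisibility holds there and not only in
ℝ. -/
theorem mzvZ_two_dvd_starSum_replicate_one (j : ℕ) :
    mzvZ [2] ∣ starSum mzvSh (List.replicate (j + 1) 1) := by
  have h2 : ((mzvZ [2] : MZVAlg) : ℝ) = zetaNat 2 := coe_mzvZ_singleton 2 le_rfl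
  rcases Nat.even_or_odd' j with ⟨m, rfl | rfl⟩
  · have h : starSum mzvSh (List.replicate (2 * m + 1) 1) = 0 := Subtype.ext <| by
      rw [coe_starSum_mzvSh_replicate_one, inversionConst_odd, ZeroMemClass.coe_zero]
    exact h ▸ dvd_zero _
  · obtain ⟨q, hq⟩ := inversionConst_even m
    refine ⟨algebraMap ℚ MZVAlg q * mzvZ [2] ^ m, Subtype.ext ?_⟩
    rw [coe_starSum_mzvSh_replicate_one, show 2 * m + 1 + 1 = 2 * (m + 1) by ring, hq,
      MulMemClass.coe_mul, MulMemClass.coe_mul, SubmonoidClass.coe_pow, h2,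
      Subalgebra.coe_algebraMap, eq_ratCast, pow_succ]
    ring

theorem starSum_mzvShBar_eq_mk (k : Index) :
    starSum mzvShBar k = Ideal.Quotient.mk (Ideal.span {mzvZ [2]}) (starSum mzvSh k) :=
  (map_starSum _ mzvSh k).symm

theorem starSum_mzvShBar_replicate_one (j : ℕ) (hj : 0 < j) :
    starSum mzvShBar (List.replicate j 1) = 0 := by
  obtain ⟨j, rfl⟩ := Nat.exists_eq_succ_of_ne_zero hj.ne'
  rw [starSum_mzvShBar_eq_mk, Ideal.Quotient.eq_zero_iff_mem, Ideal.mem_span_singleton]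
  exact mzvZ_two_dvd_starSum_replicate_one j

theorem starSum_mzvSh_index121 (a b : ℕ) :
    starSum mzvSh (index121 a b) = ∑ i ∈ Finset.range (b + 1),
      (-1) ^ i * ((a + i + 1).choose (i + 1) : MZVAlg) * mzvZ [Nat.succPNat (a + i + 1)] *
        starSum mzvSh (List.replicate (b - i) 1) := by
  apply Subtype.ext
  rw [coe_starSum_mzvSh_index121, AddSubmonoidClass.coe_finsetSum]
  refine Finset.sum_congr rfl fun i _ => ?_
  rw [MulMemClass.coe_mul, MulMemClass.coe_mul, coe_starSum_mzvSh_replicate_one,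
    coe_mzvZ_singleton _ (by rw [Nat.succPNat_coe]; omega), Nat.succPNat_coe]
  push_cast
  rfl

/-- Each term with i < b contains a merge sum of a nonempty run of ones, hence a factor ζ(2); only i
= b remains. -/
theorem starSum_mzvShBar_index121 (a b : ℕ) (k : ℕ+) (hk : (k : ℕ) = a + b + 2) :
    starSum mzvShBar (index121 a b) =
      (-1) ^ b * ((a + b + 1).choose (b + 1) : MZVBar) * zetaBar k := by
  rw [starSum_mzvShBar_eq_mk, starSum_mzvSh_index121, Finset.sum_range_succ, map_add, map_sum,
    Finset.sum_eq_zero, zero_add]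
  · have hk' : Nat.succPNat (a + b + 1) = k := PNat.eq (by rw [Nat.succPNat_coe, hk])
    rw [Nat.sub_self, List.replicate_zero, starSum_nil, mzvSh_nil, mul_one, hk', map_mul, map_mul,
      map_pow, map_neg, map_one, map_natCast, zetaBar]
  · intro i hi
    rw [map_mul, ← starSum_mzvShBar_eq_mk,
      starSum_mzvShBar_replicate_one _ (Nat.sub_pos_of_lt (Finset.mem_range.1 hi)), mul_zero]

theorem zetaStarS_index121 (a b : ℕ) (k : ℕ+) (hk : (k : ℕ) = a + b + 2) :
    zetaStarS 1 (index121 a b) =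
      (-1) ^ b * (Nat.choose (a + b + 2) (a + 1) : SRing 1) * frakZS 1 k := by
  rw [zetaStarS_one_eq, sign_choose_mul_frakZS, symSum_index121]
  · congr 2
    rw [starSum_mzvShBar_index121 a b k hk, starSum_mzvShBar_index121 b a k (by omega),
      Nat.choose_succ_succ' (a + b + 1) a, Nat.cast_add, ← Nat.choose_symm (show a ≤ a + b + 1 by omega),
      show a + b + 1 - a = b + 1 by omega, add_comm b a, pow_add]
    have h := neg_one_pow_mul_self MZVBar a
    linear_combination ((-1) ^ b * ((a + b + 1).choose (a + 1) : MZVBar) * zetaBar k) * h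
  · rw [starSum_nil, mzvShBar, mzvSh_nil, map_one]
  · exact starSum_mzvShBar_replicate_one

end StarValues

end FMZV

theorem mainTheorem11 (a b : ℕ) :
    (FMZV.zetaA 1 (FMZV.index121 a b) =
        (-1) ^ b * (Nat.choose (a + b + 2) (a + 1) : FMZV.ARing 1) *
          FMZV.frakZA 1 ⟨a + b + 2, Nat.succ_pos _⟩ ∧
      FMZV.zetaStarA 1 (FMZV.index121 a b) =
        (-1) ^ b * (Nat.choose (a + b + 2) (a + 1) : FMZV.ARing 1) *
          FMZV.frakZA 1 ⟨a + b + 2, Nat.succ_pos _⟩) ∧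
    (FMZV.zetaS 1 (FMZV.index121 a b) =
        (-1) ^ b * (Nat.choose (a + b + 2) (a + 1) : FMZV.SRing 1) *
          FMZV.frakZS 1 ⟨a + b + 2, Nat.succ_pos _⟩ ∧
      FMZV.zetaStarS 1 (FMZV.index121 a b) =
        (-1) ^ b * (Nat.choose (a + b + 2) (a + 1) : FMZV.SRing 1) *
          FMZV.frakZS 1 ⟨a + b + 2, Nat.succ_pos _⟩) := by
  exact ⟨⟨FMZV.zetaA_index121 a b, FMZV.zetaStarA_index121 a b⟩,
    FMZV.zetaS_index121 a b _ rfl, FMZV.zetaStarS_index121 a b _ rfl⟩
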